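/- Let $k\ge 4$ be an even integer and let $p$ be a prime number with $p-1>2k-2$. Let $\mathbb H_2=\{Z\in M_2(\mathbb C) : {}^tZ=Z,\ \operatorname{Im} Z>0\}$, let $\Gamma=\mathrm{Sp}_4(\mathbb Z)$, and let $\Gamma_\infty\subset\Gamma$ be the subgroup of the matrices $\begin{pmatrix}A&B\\0_2&D\end{pmatrix}$ in $\Gamma$. For $Z\in\mathbb H_2$ put $$E_k(Z)=\sum_{\gamma=\left(\begin{smallmatrix}A&B\\C&D\end{smallmatrix}\right)\in\Gamma_\infty\backslash\Gamma}\det(CZ+D)^{-k},\qquad G_k(Z)=\tfrac12\,\zeta(1-k)\,\zeta(3-2k)\,E_k(Z),$$ where $\zeta$ is the Riemann zeta function. The series $E_k(Z)$ converges absolutely for every $Z\in\mathbb H_2$, and $G_k$ has a Fourier expansion $$G_k(Z)=\sum_{T}A_{G_k}(T)\,e^{2\pi\sqrt{-1}\,\mathrm{tr}(TZ)}\qquad(Z\in\mathbb H_2),$$ converging absolutely, where $T$ runs over the positive semi-definite symmetric $2\times2$ matrices with integral diagonal entries and off-diagonal entries in $\tfrac12\mathbb Z$. In any such expansion every coefficient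 $A_{G_k}(T)$ is a rational number and lies in $\mathbb Z_p$. -/

import Mathlib

noncomputable section

namespace SiegelTwo

open Matrix

/-- The Siegel upper half space of degree 2: complex symmetric `2 × 2` matrices whose imaginary
part is positive definite. -/
def upperHalfSpace : Set (Matrix (Fin 2) (Fin 2) ℂ) :=
  {Z | Zᵀ = Z ∧ (Z.map Complex.im).PosDef}

/-- `Sp₄(ℤ)`, as the group of integral matrices in `2 × 2` blocks preserving the standard
symplectic form. -/
abbrev Gam : Type := symplecticGroup (Fin 2) ℤ

/-- The lower left block `C` of `γ = (A, B; C, D)`. -/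
def blockC (γ : Gam) : Matrix (Fin 2) (Fin 2) ℤ := γ.1.toBlocks₂₁

/-- The lower right block `D` of `γ = (A, B; C, D)`. -/
def blockD (γ : Gam) : Matrix (Fin 2) (Fin 2) ℤ := γ.1.toBlocks₂₂

/-- The automorphic factor `j(γ, Z) = det (C Z + D)`. -/
def autFactor (γ : Gam) (Z : Matrix (Fin 2) (Fin 2) ℂ) : ℂ :=
  ((blockC γ).map (Int.cast : ℤ → ℂ) * Z + (blockD γ).map (Int.cast : ℤ → ℂ)).det

theorem blockC_one : blockC 1 = 0 := by
  ext i j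
  simp [blockC, toBlocks₂₁]

theorem blockC_mul (γ δ : Gam) :
    blockC (γ * δ) =
      blockC γ * δ.1.toBlocks₁₁ + blockD γ * blockC δ := by
  ext i j
  simp [blockC, blockD, toBlocks₂₁, toBlocks₁₁, toBlocks₂₂, Matrix.mul_apply]

theorem blockD_mul (γ δ : Gam) :
    blockD (γ * δ) =
      blockC γ * δ.1.toBlocks₁₂ + blockD γ * blockD δ := by
  ext i j
  simp [blockC, blockD, toBlocks₂₁, toBlocks₁₂, toBlocks₂₂, Matrix.mul_apply]

theorem blockC_inv (γ : Gam) : blockC γ⁻¹ = -(blockC γ)ᵀ := by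
  have h : ((γ⁻¹ : Gam) : Matrix (Fin 2 ⊕ Fin 2) (Fin 2 ⊕ Fin 2) ℤ)
      = (-J (Fin 2) ℤ) * γ.1ᵀ * J (Fin 2) ℤ := rfl
  unfold blockC
  rw [h]
  conv_lhs => rw [← fromBlocks_toBlocks γ.1]
  simp [J, fromBlocks_transpose, fromBlocks_multiply, fromBlocks_neg]

/-- The subgroup `Γ_∞` of all `γ = (A, B; 0, D)` in `Sp₄(ℤ)`. -/
def GamInf : Subgroup Gam where
  carrier := {γ | blockC γ = 0}
  one_mem' := blockC_one
  mul_mem' := by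
    intro a b ha hb
    simp only [Set.mem_ofPred_eq] at ha hb ⊢
    rw [blockC_mul, ha, hb]
    simp
  inv_mem' := by
    intro a ha
    simp only [Set.mem_ofPred_eq] at ha ⊢
    rw [blockC_inv, ha]
    simp

theorem blockC_left (γ δ : Gam) (h : γ ∈ GamInf) : blockC (γ * δ) = blockD γ * blockC δ := by
  have h' : blockC γ = 0 := h
  rw [blockC_mul, h']; simp

theorem blockD_left (γ δ : Gam) (h : γ ∈ GamInf) : blockD (γ * δ) = blockD γ * blockD δ := by
  have h' : blockC γ = 0 := h
  rw [blockD_mul, h']; simp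

theorem blockD_one : blockD 1 = 1 := by
  ext i j
  simp [blockD, toBlocks₂₂, Matrix.one_apply]

theorem det_blockD_sq (γ : Gam) (h : γ ∈ GamInf) : (blockD γ).det ^ 2 = 1 := by
  have h1 : blockD γ * blockD γ⁻¹ = 1 := by
    rw [← blockD_left γ _ h, mul_inv_cancel, blockD_one]
  have h2 : IsUnit (blockD γ).det :=
    IsUnit.of_mul_eq_one (blockD γ⁻¹).det (by rw [← det_mul, h1, det_one])
  rcases Int.isUnit_iff.1 h2 with h | h <;> simp [h]

theorem autFactor_left (γ δ : Gam) (h : γ ∈ GamInf) (Z : Matrix (Fin 2) (Fin 2) ℂ) :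
    autFactor (γ * δ) Z = ((blockD γ).det : ℂ) * autFactor δ Z := by
  have hm : ∀ M N : Matrix (Fin 2) (Fin 2) ℤ, (M * N).map (Int.cast : ℤ → ℂ)
      = M.map (Int.cast : ℤ → ℂ) * N.map (Int.cast : ℤ → ℂ) :=
    fun M N => Matrix.map_mul (f := Int.castRingHom ℂ)
  have hd : ((blockD γ).det : ℂ) = ((blockD γ).map (Int.cast : ℤ → ℂ)).det :=
    RingHom.map_det (Int.castRingHom ℂ) (blockD γ)
  unfold autFactor
  rw [blockC_left γ δ h, blockD_left γ δ h, hm, hm, hd, ← det_mul, mul_add, Matrix.mul_assoc]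

/-- The coset space `Γ_∞ \ Γ`. -/
abbrev Cosets : Type := Quotient (QuotientGroup.rightRel GamInf)

/-- The function `j(γ, Z)⁻ᵏ` on `Γ_∞ \ Γ`, which is well defined because `k` is even. -/
def eisensteinTerm (k : ℕ) (hk : Even k) (Z : Matrix (Fin 2) (Fin 2) ℂ) : Cosets → ℂ :=
  Quotient.lift (fun γ : Gam => 1 / autFactor γ Z ^ k) (by
    intro a b hab
    have hab' : b * a⁻¹ ∈ GamInf := QuotientGroup.rightRel_apply.1 hab
    obtain ⟨m, rfl⟩ := hk
    have hb : b = (b * a⁻¹) * a := by group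
    have hs : (((blockD (b * a⁻¹)).det : ℂ)) ^ 2 = 1 := by
      exact_mod_cast det_blockD_sq _ hab'
    have key : autFactor b Z ^ (m + m) = autFactor a Z ^ (m + m) := by
      rw [hb, autFactor_left _ _ hab', mul_pow, ← two_mul, pow_mul _ 2 m, hs, one_pow, one_mul]
    simp only [key])

/-- The Siegel Eisenstein series `E_k(Z) = ∑_{γ ∈ Γ_∞ \ Γ} j(γ, Z)⁻ᵏ`. -/
def siegelE (k : ℕ) (hk : Even k) (Z : Matrix (Fin 2) (Fin 2) ℂ) : ℂ :=
  ∑' γ : Cosets, eisensteinTerm k hk Z γ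

/-- The normalized Siegel Eisenstein series `G_k = ½ ζ(1 - k) ζ(3 - 2k) E_k`. -/
def siegelG (k : ℕ) (hk : Even k) (Z : Matrix (Fin 2) (Fin 2) ℂ) : ℂ :=
  1 / 2 * riemannZeta (1 - (k : ℂ)) * riemannZeta (3 - 2 * (k : ℂ)) * siegelE k hk Z

/-- Positive semi-definite symmetric `2 × 2` matrices with integral diagonal entries and
half-integral (that is, in `½ℤ`) off-diagonal entries. -/
def halfIntegral : Set (Matrix (Fin 2) (Fin 2) ℝ) :=
  {T | T.PosSemidef ∧ (∀ i, ∃ n : ℤ, T i i = n) ∧ ∀ i j, ∃ n : ℤ, 2 * T i j = n}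

/-- `q^T = exp(2π√-1 tr(TZ))`. -/
def qPow (T : Matrix (Fin 2) (Fin 2) ℝ) (Z : Matrix (Fin 2) (Fin 2) ℂ) : ℂ :=
  Complex.exp (2 * Real.pi * Complex.I * (T.map (Complex.ofReal) * Z).trace)

/-- `F(Z) = ∑_T A(T) q^T` on the Siegel upper half space, the sum being over all positive
semi-definite half-integral `T` and (unconditionally, hence absolutely) convergent. -/
def HasFourierExpansion (F : Matrix (Fin 2) (Fin 2) ℂ → ℂ) (A : halfIntegral → ℂ) : Prop :=
  ∀ Z ∈ upperHalfSpace, HasSum (fun T : halfIntegral => A T * qPow T Z) (F Z)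

/-- The complex number `a` is rational and, as a `p`-adic number, lies in `ℤ_p`. -/
def IsPadicIntegral (p : ℕ) [Fact p.Prime] (a : ℂ) : Prop :=
  ∃ r : ℚ, a = (r : ℂ) ∧ ∃ z : ℤ_[p], (z : ℚ_[p]) = (r : ℚ_[p])

end SiegelTwo

end

/-! ### Lipschitz' formula in one variable, for real exponents -/

noncomputable section
namespace SiegelTwo
open MeasureTheory Complex Filter Set Topology

/-! The Fourier coefficients are computed explicitly and then checked for denominators.

A coset of `GamInf` is determined by the 2×2 minors of its lower half (C D), up to sign. By the
symplectic condition there are five of them, and they run through the primitive integral solutions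
of ae = bd - c². Allowing all contents multiplies the series by ζ(k). So ζ(k)E_k is the sum of (a(τω
- z²) + bτ + 2cz + dω + e)^(-k) over isotropic vectors up to sign (`zeta_mul_siegelE`).

Vectors with a > 0 give a·det(Z + S/a) with S isotropic modulo a. Lipschitz' formula of degree two
(`InH.lipschitz_two`) turns their sum into coefficients: a constant times det(T)^(k-3/2) times the
singular series of T. Vectors with a = 0 and (b, c, d) nonzero give divisor sums, by Lipschitz'
formula in one variable. The remaining vectors give ζ(k) at T = 0.

The singular series has an Euler product. At a prime power its exponential sums count zeros of the
binary form T on the projective line (`isoSum_pow`), which leads to recursions when q divides T or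
q² can be removed from the discriminant. If the discriminant is D·f² with D fundamental, ζ(2k-2)
times the singular series is L(k-1, χ_D) times a rational number whose denominator divides f^(2k-3)
(`exists_int_singularSeries`); det(T)^(k-3/2) contains that power of f.

The functional equations of ζ remove the powers of π (`siegelCoeff_eq`). Up to integers, there
remain ζ(3-2k), ½ζ(1-k)ζ(3-2k), and (k-1)⁻¹ N^(k-2) ∑ χ_D(j) B_{k-1}(j/N) with N = |D|. Since p ≥
2k, all Bernoulli numbers in play are p-integral, because of their recursion. The only other
possible denominator is N, in N⁻¹ ∑ χ_D(j) j^(k-1). If p divides N, it does so once, and p divides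
this power sum: substituting uj for j, where u lifts a primitive root modulo p, multiplies it modulo
p by a factor different from 1, because 2(k-1) < p - 1.

Fourier coefficients are unique by integration over real translations, so the statement holds for
every expansion. -/

theorem integrableOn_rpow_mul_exp {κ : ℝ} (hκ : 0 < κ) {r : ℝ} (hr : 0 < r) :
    IntegrableOn (fun t : ℝ => t ^ (κ - 1) * Real.exp (-(r * t))) (Ioi 0) := by
  -- An undefined integral has the default value 0, whereas this one is known to evaluate to a
  -- positive number.
  by_contra h
  have h1 := Real.integral_rpow_mul_exp_neg_mul_Ioi hκ hr
  rw [integral_undef h] at h1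
  have : 0 < (1 / r) ^ κ * Real.Gamma κ :=
    mul_pos (Real.rpow_pos_of_pos (by positivity) _) (Real.Gamma_pos_of_pos hκ)
  linarith

/-- The Laplace transform of a power function. -/
theorem laplace_rpow {κ : ℝ} (hκ : 0 < κ) {s : ℂ} (hs : 0 < s.re) :
    ∫ t in Ioi (0 : ℝ), ((t ^ (κ - 1) : ℝ) : ℂ) * cexp (-(s * t))
      = Real.Gamma κ * s ^ (-(κ : ℂ)) := by
  -- The left side is the complex moment generating function of t^(κ-1) dt on the half line, at -s.
  -- It is analytic for negative real part, so the identity theorem extends the real Gamma integral.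
  set μ : Measure ℝ := (volume.restrict (Ioi (0 : ℝ))).withDensity
    (fun t => ENNReal.ofReal (t ^ (κ - 1))) with hμ
  have hmeas : Measurable fun t : ℝ => (t ^ (κ - 1)).toNNReal := by fun_prop
  have h_integral : ∀ z : ℂ, ProbabilityTheory.complexMGF id μ z
      = ∫ t in Ioi (0 : ℝ), ((t ^ (κ - 1) : ℝ) : ℂ) * cexp (z * t) := by
    intro z
    rw [ProbabilityTheory.complexMGF, hμ]
    have := integral_withDensity_eq_integral_smul (μ := volume.restrict (Ioi (0 : ℝ))) hmeas
      (fun t : ℝ => cexp (z * t))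
    refine this.trans (setIntegral_congr_fun measurableSet_Ioi fun t ht => ?_)
    have ht' : 0 ≤ t ^ (κ - 1) := Real.rpow_nonneg (le_of_lt ht) _
    simp [NNReal.smul_def, Real.coe_toNNReal _ ht']
  have hset : Iio (0 : ℝ) ⊆ interior (ProbabilityTheory.integrableExpSet id μ) := by
    refine isOpen_Iio.subset_interior_iff.2 fun r hr => ?_
    have hr' : 0 < -r := by simpa using hr
    change Integrable (fun t => Real.exp (r * id t)) μ
    refine (integrable_withDensity_iff_integrable_smul (μ := volume.restrict (Ioi (0 : ℝ))) hmeas).2 ?_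
    refine (integrableOn_rpow_mul_exp hκ hr').congr ?_
    filter_upwards [ae_restrict_mem measurableSet_Ioi] with t ht
    have ht' : 0 ≤ t ^ (κ - 1) := Real.rpow_nonneg (le_of_lt ht) _
    simp [NNReal.smul_def, Real.coe_toNNReal _ ht']
  have hopen : IsOpen {z : ℂ | z.re < 0} := isOpen_lt continuous_re continuous_const
  have hF : AnalyticOnNhd ℂ (ProbabilityTheory.complexMGF id μ) {z : ℂ | z.re < 0} := by
    refine ProbabilityTheory.analyticOnNhd_complexMGF.mono fun z hz => hset hz
  have hG : AnalyticOnNhd ℂ (fun z : ℂ => (Real.Gamma κ : ℂ) * (-z) ^ (-(κ : ℂ))) {z : ℂ | z.re < 0} := by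
    refine DifferentiableOn.analyticOnNhd (fun z hz => ?_) hopen
    refine DifferentiableAt.differentiableWithinAt ?_
    refine DifferentiableAt.const_mul ?_ _
    refine DifferentiableAt.cpow (by fun_prop) (by fun_prop) (Or.inl ?_)
    simpa using hz
  have hreal : ∀ r : ℝ, r < 0 → ProbabilityTheory.complexMGF id μ r
      = (Real.Gamma κ : ℂ) * (-(r : ℂ)) ^ (-(κ : ℂ)) := by
    intro r hr
    have hr' : 0 < -r := by linarith
    have h1 := Real.integral_rpow_mul_exp_neg_mul_Ioi hκ hr'
    rw [h_integral]
    have h2 : ∫ t in Ioi (0 : ℝ), ((t ^ (κ - 1) : ℝ) : ℂ) * cexp (r * t)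
        = ((∫ t in Ioi (0 : ℝ), t ^ (κ - 1) * Real.exp (-(-r * t)) : ℝ) : ℂ) := by
      rw [← integral_complex_ofReal]
      refine integral_congr_ae (ae_of_all _ fun t => ?_)
      simp
    rw [h2, h1, mul_comm]
    have h3 : (1 / -r) ^ κ = (-r) ^ (-κ) := by
      rw [one_div, Real.inv_rpow hr'.le, Real.rpow_neg hr'.le]
    rw [h3, ofReal_mul, ofReal_cpow hr'.le]
    simp
  have hpre : IsPreconnected {z : ℂ | z.re < 0} :=
    (convex_halfSpace_re_lt 0).isPreconnected
  -- Real points accumulate at -1, so agreement on the negative reals suffices.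
  have hfreq : ∃ᶠ z in 𝓝[≠] (-1 : ℂ), ProbabilityTheory.complexMGF id μ z
      = (Real.Gamma κ : ℂ) * (-z) ^ (-(κ : ℂ)) := by
    have ht : Tendsto (fun x : ℝ => (x : ℂ)) (𝓝[≠] (-1 : ℝ)) (𝓝[≠] (-1 : ℂ)) := by
      refine tendsto_nhdsWithin_iff.2 ⟨?_, ?_⟩
      · have : Tendsto (fun x : ℝ => (x : ℂ)) (𝓝 (-1 : ℝ)) (𝓝 ((-1 : ℝ) : ℂ)) :=
          continuous_ofReal.tendsto _
        simpa using this.mono_left nhdsWithin_le_nhds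
      · filter_upwards [self_mem_nhdsWithin] with x hx
        intro h
        apply hx
        have : (x : ℂ) = ((-1 : ℝ) : ℂ) := by simpa using h
        simpa using ofReal_injective this
    refine ht.frequently (Eventually.frequently ?_)
    have : ∀ᶠ x : ℝ in 𝓝[≠] (-1), x < 0 :=
      nhdsWithin_le_nhds (Iio_mem_nhds (by norm_num))
    filter_upwards [this] with x hx using hreal x hx
  have key := hF.eqOn_of_preconnected_of_frequently_eq hG hpre (by simp) hfreq
  have h := key (show -s ∈ {z : ℂ | z.re < 0} by simpa using hs)
  rw [h_integral] at h
  simpa using h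


/-- The function `x₊^(κ-1) exp(-2 π x s)` on the real line. -/
def expRamp (κ : ℝ) (s : ℂ) (x : ℝ) : ℂ :=
  (((max x 0) ^ (κ - 1) : ℝ) : ℂ) * cexp (-(2 * Real.pi * x * s))

theorem continuous_expRamp {κ : ℝ} (hκ : 1 < κ) (s : ℂ) : Continuous (expRamp κ s) := by
  have h1 : Continuous fun x : ℝ => (max x 0) ^ (κ - 1) :=
    (continuous_id.max continuous_const).rpow_const fun x => Or.inr (by linarith)
  unfold expRamp
  fun_prop

theorem expRamp_of_nonpos {κ : ℝ} (hκ : 1 < κ) (s : ℂ) {x : ℝ} (hx : x ≤ 0) :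
    expRamp κ s x = 0 := by
  simp [expRamp, max_eq_right hx, Real.zero_rpow (by linarith : κ - 1 ≠ 0)]

theorem norm_expRamp (κ : ℝ) (s : ℂ) (x : ℝ) :
    ‖expRamp κ s x‖ = (max x 0) ^ (κ - 1) * Real.exp (-(2 * Real.pi * s.re) * x) := by
  rw [expRamp, norm_mul, Complex.norm_real, Complex.norm_exp, Real.norm_of_nonneg
    (Real.rpow_nonneg (le_max_right _ _) _)]
  congr 2
  simp
  ring

theorem expRamp_isBigO {κ : ℝ} (hκ : 1 < κ) {s : ℂ} (hs : 0 < s.re) (b : ℝ) :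
    expRamp κ s =O[cocompact ℝ] fun x : ℝ => |x| ^ (-b) := by
  rw [cocompact_eq_atBot_atTop, Asymptotics.isBigO_sup]
  constructor
  · refine Asymptotics.IsBigO.of_bound 0 ?_
    filter_upwards [eventually_le_atBot 0] with x hx
    simp [expRamp_of_nonpos hκ s hx]
  · have h1 := (isLittleO_exp_neg_mul_rpow_atTop (a := 2 * Real.pi * s.re)
      (by positivity) (-b - (κ - 1))).isBigO
    have h2 : (fun x : ℝ => expRamp κ s x) =O[atTop]
        fun x : ℝ => x ^ (κ - 1) * Real.exp (-(2 * Real.pi * s.re) * x) := by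
      refine Asymptotics.IsBigO.of_bound 1 ?_
      filter_upwards [eventually_ge_atTop 0] with x hx
      rw [norm_expRamp, max_eq_left hx, one_mul]
      exact le_abs_self _
    refine h2.trans ?_
    have h3 := (Asymptotics.isBigO_refl (fun x : ℝ => x ^ (κ - 1)) atTop).mul h1
    refine h3.trans (Asymptotics.IsBigO.of_bound 1 ?_)
    filter_upwards [eventually_gt_atTop 0] with x hx
    rw [← Real.rpow_add hx, abs_of_pos hx, one_mul]
    ring_nf
    exact le_rfl

-- The Fourier integral is the Laplace integral at the point 2π(s + iξ).
open FourierTransform in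
theorem fourier_expRamp {κ : ℝ} (hκ : 1 < κ) {s : ℂ} (hs : 0 < s.re) (ξ : ℝ) :
    𝓕 (expRamp κ s) ξ = Real.Gamma κ * (((2 * Real.pi : ℝ) : ℂ) * (s + I * ξ)) ^ (-(κ : ℂ)) := by
  rw [Real.fourier_real_eq_integral_exp_smul]
  have hre : 0 < (((2 * Real.pi : ℝ) : ℂ) * (s + I * ξ)).re := by
    simp
    positivity
  rw [← laplace_rpow (by linarith) hre]
  rw [← setIntegral_eq_integral_of_forall_compl_eq_zero (s := Ioi (0 : ℝ))]
  · refine setIntegral_congr_fun measurableSet_Ioi fun t ht => ?_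
    have ht' : max t 0 = t := max_eq_left (le_of_lt ht)
    simp only [expRamp, ht', smul_eq_mul]
    rw [mul_left_comm, ← Complex.exp_add]
    congr 2
    push_cast
    ring
  · intro x hx
    rw [expRamp_of_nonpos hκ s (by simpa using hx), smul_zero]

theorem ofReal_mul_cpow {r : ℝ} (hr : 0 < r) {z : ℂ} (hz : z ≠ 0) (w : ℂ) :
    ((r : ℂ) * z) ^ w = (r : ℂ) ^ w * z ^ w := by
  have hr' : (r : ℂ) ≠ 0 := ofReal_ne_zero.2 hr.ne'
  rw [cpow_def_of_ne_zero (mul_ne_zero hr' hz), cpow_def_of_ne_zero hr', cpow_def_of_ne_zero hz,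
    log_ofReal_mul hr hz, ofReal_log hr.le, ← Complex.exp_add, add_mul]

theorem norm_cpow_neg_real {z : ℂ} (hz : z ≠ 0) (κ : ℝ) : ‖z ^ (-(κ : ℂ))‖ = ‖z‖ ^ (-κ) := by
  rw [norm_cpow_of_ne_zero hz]; simp

/-- For bounded ξ the real part of s is a lower bound. Once 1 + |ξ| exceeds 2(1 + |im s|), the
imaginary part |ξ| - |im s| is. -/
theorem norm_add_I_mul_ge {s : ℂ} (hs : 0 < s.re) :
    ∃ c : ℝ, 0 < c ∧ ∀ ξ : ℝ, c * (1 + |ξ|) ≤ ‖s + I * ξ‖ := by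
  set B := 1 + |s.im| with hB
  have hB0 : 0 < B := by positivity
  refine ⟨min (s.re / (2 * B)) (1 / 4), by positivity, fun ξ => ?_⟩
  have h1 : s.re ≤ ‖s + I * ξ‖ := by
    have := (s + I * ξ).re_le_norm
    simpa using this
  have h2 : |ξ| - |s.im| ≤ ‖s + I * ξ‖ := by
    have := (s + I * ξ).abs_im_le_norm
    simp only [add_im, mul_im, I_re, ofReal_im, mul_zero, I_im, ofReal_re, one_mul, zero_add] at this
    have h3 := abs_sub_abs_le_abs_sub ξ (-s.im)
    rw [abs_neg, sub_neg_eq_add, add_comm ξ] at h3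
    linarith
  rcases le_or_gt (1 + |ξ|) (2 * B) with h | h
  · calc _ ≤ s.re / (2 * B) * (1 + |ξ|) := by gcongr; exact min_le_left _ _
      _ ≤ s.re / (2 * B) * (2 * B) := by gcongr
      _ = s.re := by field_simp
      _ ≤ _ := h1
  · calc _ ≤ 1 / 4 * (1 + |ξ|) := by gcongr; exact min_le_right _ _
      _ ≤ |ξ| - |s.im| := by linarith [abs_nonneg s.im]
      _ ≤ _ := h2

theorem norm_cpow_add_I_mul_le {s : ℂ} (hs : 0 < s.re) {κ : ℝ} (hκ : 0 < κ) :
    ∃ C : ℝ, 0 < C ∧ ∀ ξ : ℝ, ‖(s + I * ξ) ^ (-(κ : ℂ))‖ ≤ C * (1 + |ξ|) ^ (-κ) := by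
  obtain ⟨c, hc, h⟩ := norm_add_I_mul_ge hs
  refine ⟨c ^ (-κ), by positivity, fun ξ => ?_⟩
  have hne : s + I * ξ ≠ 0 := by
    intro h0
    have := congrArg re h0
    simp at this
    linarith
  rw [norm_cpow_neg_real hne, ← Real.mul_rpow hc.le (by positivity)]
  exact Real.rpow_le_rpow_of_nonpos (by positivity) (h ξ) (by linarith)

theorem summable_one_add_abs_rpow {κ : ℝ} (hκ : 1 < κ) :
    Summable fun w : ℤ => (1 + |(w : ℝ)|) ^ (-κ) := by
  refine Summable.of_norm_bounded_eventually (Real.summable_abs_int_rpow hκ) ?_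
  filter_upwards [(finite_singleton (0 : ℤ)).compl_mem_cofinite] with w hw
  have hw' : 0 < |(w : ℝ)| := by simpa using hw
  rw [Real.norm_of_nonneg (by positivity)]
  exact Real.rpow_le_rpow_of_nonpos hw' (by linarith) (by linarith)

theorem summable_cpow_sub_I_mul {s : ℂ} (hs : 0 < s.re) {κ : ℝ} (hκ : 1 < κ) :
    Summable fun w : ℤ => ‖(s - I * w) ^ (-(κ : ℂ))‖ := by
  obtain ⟨C, hC, h⟩ := norm_cpow_add_I_mul_le hs (by linarith : 0 < κ)
  refine Summable.of_nonneg_of_le (fun _ => norm_nonneg _) (fun w => ?_)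
    ((summable_one_add_abs_rpow hκ).mul_left C)
  have := h (-w)
  simpa [sub_eq_add_neg] using this

/-- Lipschitz' formula, with a real exponent and a twist. -/
theorem lipschitz_one {κ : ℝ} (hκ : 1 < κ) {s : ℂ} (hs : 0 < s.re) (θ : ℝ) :
    ∑' w : ℤ, (s - I * w) ^ (-(κ : ℂ)) * cexp (2 * Real.pi * I * θ * w)
      = (((2 * Real.pi) ^ κ / Real.Gamma κ : ℝ) : ℂ) * ∑' m : ℤ, expRamp κ s (m - θ) := by
  have hG := Real.Gamma_pos_of_pos (by linarith : 0 < κ)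
  have h2π : (0 : ℝ) ≤ 2 * Real.pi := by positivity
  have hfou : ∀ ξ : ℝ, FourierTransform.fourier (expRamp κ s) ξ
      = ((Real.Gamma κ * (2 * Real.pi) ^ (-κ) : ℝ) : ℂ) * (s + I * ξ) ^ (-(κ : ℂ)) := by
    intro ξ
    have hre : (s + I * ξ) ≠ 0 := by
      intro h0
      have := congrArg re h0
      simp at this
      linarith
    rw [fourier_expRamp hκ hs, ofReal_mul_cpow (by positivity) hre]
    push_cast [ofReal_cpow h2π]
    ring
  have hdecay : FourierTransform.fourier (expRamp κ s) =O[cocompact ℝ] fun x : ℝ => |x| ^ (-κ) := by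
    obtain ⟨C, hC, h⟩ := norm_cpow_add_I_mul_le hs (by linarith : 0 < κ)
    refine Asymptotics.IsBigO.of_bound (Real.Gamma κ * (2 * Real.pi) ^ (-κ) * C) ?_
    have : ∀ᶠ x : ℝ in cocompact ℝ, x ≠ 0 := by
      simpa using (isCompact_singleton (x := (0 : ℝ))).compl_mem_cocompact
    filter_upwards [this] with x hx
    have hx' : 0 < |x| := by simpa using hx
    rw [hfou, norm_mul, Complex.norm_real, Real.norm_of_nonneg (by positivity),
      Real.norm_of_nonneg (by positivity), mul_assoc (Real.Gamma κ * _)]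
    refine mul_le_mul_of_nonneg_left ((h x).trans ?_) (by positivity)
    refine mul_le_mul_of_nonneg_left ?_ hC.le
    exact Real.rpow_le_rpow_of_nonpos hx' (by linarith) (by linarith)
  -- Poisson summation at the point -θ produces the twist. Replacing w by -w afterwards turns s + iw
  -- into s - iw.
  have hP := Real.tsum_eq_tsum_fourier_of_rpow_decay (continuous_expRamp hκ s) hκ
    (expRamp_isBigO hκ hs κ) hdecay (-θ)
  have h1 : ∑' m : ℤ, expRamp κ s (m - θ) = ∑' n : ℤ, expRamp κ s (-θ + n) := by
    congr 1; ext m; congr 1; ring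
  rw [h1, hP, ← (Equiv.neg ℤ).tsum_eq, ← tsum_mul_left]
  congr 1
  ext w
  rw [hfou, fourier_coe_apply]
  have h3 : ((2 * Real.pi) ^ κ / Real.Gamma κ) * (Real.Gamma κ * (2 * Real.pi) ^ (-κ)) = 1 := by
    rw [Real.rpow_neg h2π]
    have : (2 * Real.pi) ^ κ ≠ 0 := by positivity
    field_simp
  rw [← mul_assoc, ← mul_assoc, ← ofReal_mul, h3, ofReal_one, one_mul]
  congr 2
  · simp
  · rw [Equiv.neg_apply]
    push_cast
    ring

end SiegelTwo
end

/-! ### Lower bounds for det(Z + X) and absolute convergence over ℤ³ -/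

noncomputable section
namespace SiegelTwo
open MeasureTheory Complex Filter Set Topology

/-- The coordinates of a point of the Siegel upper half space of degree two. -/
structure InH (τ z ω : ℂ) : Prop where
  im_pos : 0 < τ.im
  det_pos : z.im ^ 2 < τ.im * ω.im

namespace InH

variable {τ z ω : ℂ}

theorem im_pos' (h : InH τ z ω) : 0 < ω.im := by
  have := h.det_pos
  by_contra hc
  nlinarith [h.im_pos, sq_nonneg z.im]

theorem add_real (h : InH τ z ω) (x₁ x₂ x₃ : ℝ) : InH (τ + x₁) (z + x₂) (ω + x₃) :=
  ⟨by simpa using h.im_pos, by simpa using h.det_pos⟩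

end InH

/-- The smaller eigenvalue of a positive definite symmetric matrix is at least determinant divided
by trace; this quotient is the ε. -/
theorem exists_le_quadratic {y₁ y₂ y₃ : ℝ} (h₁ : 0 < y₁) (h : y₂ ^ 2 < y₁ * y₃) :
    ∃ ε : ℝ, 0 < ε ∧ ε ≤ y₁ ∧ ε ≤ y₃ ∧
      ∀ x y : ℝ, ε * (x ^ 2 + y ^ 2) ≤ y₁ * x ^ 2 + 2 * y₂ * x * y + y₃ * y ^ 2 := by
  have h₃ : 0 < y₃ := by
    by_contra hc
    nlinarith [sq_nonneg y₂]
  have hs : 0 < y₁ + y₃ := by linarith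
  have key : ∀ x y : ℝ, (y₁ * y₃ - y₂ ^ 2) / (y₁ + y₃) * (x ^ 2 + y ^ 2)
      ≤ y₁ * x ^ 2 + 2 * y₂ * x * y + y₃ * y ^ 2 := by
    intro x y
    rw [div_mul_eq_mul_div, div_le_iff₀ hs]
    nlinarith [sq_nonneg (y₁ * x + y₂ * y), sq_nonneg (y₂ * x + y₃ * y)]
  refine ⟨(y₁ * y₃ - y₂ ^ 2) / (y₁ + y₃), div_pos (by linarith) hs, ?_, ?_, key⟩
  · simpa using key 1 0
  · simpa using key 0 1

theorem norm_ge_one_add_abs {τ : ℂ} (h : 0 < τ.im) :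
    ∃ c : ℝ, 0 < c ∧ ∀ x : ℝ, c * (1 + |x|) ≤ ‖τ + x‖ := by
  have hs : 0 < (-I * τ).re := by simpa using h
  obtain ⟨c, hc, H⟩ := norm_add_I_mul_ge hs
  refine ⟨c, hc, fun x => ?_⟩
  have h1 := H (-x)
  rw [abs_neg] at h1
  have h2 : -I * τ + I * ((-x : ℝ) : ℂ) = -I * (τ + x) := by push_cast; ring
  rwa [h2, norm_mul, norm_neg, norm_I, one_mul] at h1

/-- The imaginary part of conj(ω)·det Z is the form Im Z at (re ω, -re z) plus the same form at (im
ω, -im z). Hence ε(|ω|² + |z|²) ≤ |ω|·|det Z|, and symmetrically with τ. The bound for z follows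
from |ω|² + |z|² ≥ 2|ω||z|. -/
theorem norm_det_ge {τ z ω : ℂ} {ε : ℝ} (hε : 0 < ε)
    (H : ∀ x y : ℝ, ε * (x ^ 2 + y ^ 2) ≤ τ.im * x ^ 2 + 2 * z.im * x * y + ω.im * y ^ 2) :
    ε * ‖τ‖ ≤ ‖τ * ω - z ^ 2‖ ∧ ε * ‖z‖ ≤ ‖τ * ω - z ^ 2‖ ∧ ε * ‖ω‖ ≤ ‖τ * ω - z ^ 2‖ := by
  have e1 : ε * (‖ω‖ ^ 2 + ‖z‖ ^ 2) ≤ ‖ω‖ * ‖τ * ω - z ^ 2‖ := by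
    have h1 := H ω.re (-z.re)
    have h2 := H ω.im (-z.im)
    have h3 : ((starRingEnd ℂ) ω * (τ * ω - z ^ 2)).im ≤ ‖ω‖ * ‖τ * ω - z ^ 2‖ := by
      refine (im_le_norm _).trans ?_
      rw [norm_mul, RCLike.norm_conj]
    refine le_trans ?_ h3
    rw [← normSq_eq_norm_sq, ← normSq_eq_norm_sq, normSq_apply, normSq_apply]
    simp [pow_two, mul_im, mul_re]
    nlinarith
  have e2 : ε * (‖τ‖ ^ 2 + ‖z‖ ^ 2) ≤ ‖τ‖ * ‖τ * ω - z ^ 2‖ := by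
    have h1 := H (-z.re) τ.re
    have h2 := H (-z.im) τ.im
    have h3 : ((starRingEnd ℂ) τ * (τ * ω - z ^ 2)).im ≤ ‖τ‖ * ‖τ * ω - z ^ 2‖ := by
      refine (im_le_norm _).trans ?_
      rw [norm_mul, RCLike.norm_conj]
    refine le_trans ?_ h3
    rw [← normSq_eq_norm_sq, ← normSq_eq_norm_sq, normSq_apply, normSq_apply]
    simp [pow_two, mul_im, mul_re]
    nlinarith
  have hd := norm_nonneg (τ * ω - z ^ 2)
  have e3 : ε * ‖ω‖ ≤ ‖τ * ω - z ^ 2‖ := by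
    rcases (norm_nonneg ω).eq_or_lt with h0 | h0
    · rw [← h0]; simp
    · refine le_of_mul_le_mul_left ?_ h0
      nlinarith [mul_nonneg hε.le (sq_nonneg ‖z‖)]
  have e4 : ε * ‖τ‖ ≤ ‖τ * ω - z ^ 2‖ := by
    rcases (norm_nonneg τ).eq_or_lt with h0 | h0
    · rw [← h0]; simp
    · refine le_of_mul_le_mul_left ?_ h0
      nlinarith [mul_nonneg hε.le (sq_nonneg ‖z‖)]
  refine ⟨e4, ?_, e3⟩
  rcases (norm_nonneg ω).eq_or_lt with h0 | h0
  · rw [← h0] at e1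
    have : ‖z‖ ^ 2 ≤ 0 := by
      by_contra hc
      nlinarith [mul_pos hε (not_le.1 hc)]
    have : ‖z‖ = 0 := by nlinarith [norm_nonneg z]
    rw [this]; simp
  · refine le_of_mul_le_mul_left ?_ h0
    nlinarith [mul_nonneg hε.le (sq_nonneg (‖ω‖ - ‖z‖)), mul_nonneg (mul_nonneg hε.le h0.le) (norm_nonneg z)]

/-- Real translations leave Im Z unchanged, so `norm_det_ge` applies to Z + X with a fixed ε.
Diagonal entries never vanish and dominate 1 + |x|. The off-diagonal entry may vanish, so for small
x₂ the bound is borrowed from ω + x₃. -/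
theorem InH.det_bound {τ z ω : ℂ} (h : InH τ z ω) :
    ∃ c : ℝ, 0 < c ∧ ∀ x₁ x₂ x₃ : ℝ,
      c * (1 + |x₁|) ≤ ‖(τ + x₁) * (ω + x₃) - (z + x₂) ^ 2‖ ∧
      c * (1 + |x₂|) ≤ ‖(τ + x₁) * (ω + x₃) - (z + x₂) ^ 2‖ ∧
      c * (1 + |x₃|) ≤ ‖(τ + x₁) * (ω + x₃) - (z + x₂) ^ 2‖ := by
  obtain ⟨ε, hε, -, -, H⟩ := exists_le_quadratic h.im_pos h.det_pos
  obtain ⟨c₁, hc₁, H₁⟩ := norm_ge_one_add_abs h.im_pos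
  obtain ⟨c₃, hc₃, H₃⟩ := norm_ge_one_add_abs h.im_pos'
  set B := 1 + ‖z‖
  have hB : 1 ≤ B := by simp [B]
  refine ⟨min (ε * c₁) (min (ε * c₃) (min (ε / 2) (ε * c₃ / (2 * B)))),
    lt_min (by positivity) (lt_min (by positivity) (lt_min (by positivity) (by positivity))), fun x₁ x₂ x₃ => ?_⟩
  obtain ⟨d1, d2, d3⟩ := norm_det_ge (τ := τ + x₁) (z := z + x₂) (ω := ω + x₃) hε
    (by simpa using H)
  refine ⟨?_, ?_, ?_⟩
  · calc _ ≤ ε * c₁ * (1 + |x₁|) := by gcongr; exact min_le_left _ _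
      _ = ε * (c₁ * (1 + |x₁|)) := by ring
      _ ≤ ε * ‖τ + x₁‖ := by gcongr; exact H₁ _
      _ ≤ _ := d1
  · rcases le_or_gt (1 + |x₂|) (2 * B) with hx | hx
    · calc _ ≤ ε * c₃ / (2 * B) * (1 + |x₂|) := by
            gcongr
            exact (min_le_right _ _).trans ((min_le_right _ _).trans (min_le_right _ _))
        _ ≤ ε * c₃ / (2 * B) * (2 * B) := by gcongr
        _ = ε * (c₃ * 1) := by field_simp
        _ ≤ ε * (c₃ * (1 + |x₃|)) := by gcongr; linarith [abs_nonneg x₃]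
        _ ≤ ε * ‖ω + x₃‖ := by gcongr; exact H₃ _
        _ ≤ _ := d3
    · have h1 : |x₂| - ‖z‖ ≤ ‖z + x₂‖ := by
        have := norm_sub_norm_le (x₂ : ℂ) (-z)
        rw [norm_neg, sub_neg_eq_add, Complex.norm_real, Real.norm_eq_abs, add_comm (x₂ : ℂ)] at this
        exact this
      calc _ ≤ ε / 2 * (1 + |x₂|) := by
            gcongr
            exact (min_le_right _ _).trans ((min_le_right _ _).trans (min_le_left _ _))
        _ = ε * ((1 + |x₂|) / 2) := by ring
        _ ≤ ε * (|x₂| - ‖z‖) := by gcongr; simp only [B] at hx; linarith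
        _ ≤ ε * ‖z + x₂‖ := by gcongr
        _ ≤ _ := d2
  · calc _ ≤ ε * c₃ * (1 + |x₃|) := by
          gcongr
          exact (min_le_right _ _).trans (min_le_left _ _)
      _ = ε * (c₃ * (1 + |x₃|)) := by ring
      _ ≤ ε * ‖ω + x₃‖ := by gcongr; exact H₃ _
      _ ≤ _ := d3

/-- The exponent 4 is shared equally among three variables. Since 4/3 > 1, the product is summable
over ℤ³. -/
theorem inv_pow_le_of_three {k : ℕ} (hk : 4 ≤ k) {c M a₁ a₂ a₃ : ℝ} (hc : 0 < c)
    (h₁ : 1 ≤ a₁) (h₂ : 1 ≤ a₂) (h₃ : 1 ≤ a₃)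
    (g₁ : c * a₁ ≤ M) (g₂ : c * a₂ ≤ M) (g₃ : c * a₃ ≤ M) :
    (M ^ k)⁻¹ ≤ (c ^ k)⁻¹ * (a₁ ^ (-(4 / 3) : ℝ) * (a₂ ^ (-(4 / 3) : ℝ) * a₃ ^ (-(4 / 3) : ℝ))) := by
  set B := M / c with hB
  have hM : M = c * B := by rw [hB]; field_simp
  have b₁ : a₁ ≤ B := by rw [hB, le_div_iff₀ hc]; linarith
  have b₂ : a₂ ≤ B := by rw [hB, le_div_iff₀ hc]; linarith
  have b₃ : a₃ ≤ B := by rw [hB, le_div_iff₀ hc]; linarith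
  have hB1 : 1 ≤ B := h₁.trans b₁
  have hB0 : 0 < B := by linarith
  rw [hM, mul_pow, mul_inv]
  refine mul_le_mul_of_nonneg_left ?_ (by positivity)
  have e : (B ^ 4)⁻¹ = B ^ (-(4 / 3) : ℝ) * (B ^ (-(4 / 3) : ℝ) * B ^ (-(4 / 3) : ℝ)) := by
    rw [← Real.rpow_add hB0, ← Real.rpow_add hB0, ← Real.rpow_natCast, ← Real.rpow_neg hB0.le]
    norm_num
  calc (B ^ k)⁻¹ ≤ (B ^ 4)⁻¹ := by
        gcongr
    _ = _ := e
    _ ≤ _ := by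
      have := Real.rpow_le_rpow_of_nonpos (by linarith : 0 < a₁) b₁ (by norm_num : (-(4 / 3) : ℝ) ≤ 0)
      have := Real.rpow_le_rpow_of_nonpos (by linarith : 0 < a₂) b₂ (by norm_num : (-(4 / 3) : ℝ) ≤ 0)
      have := Real.rpow_le_rpow_of_nonpos (by linarith : 0 < a₃) b₃ (by norm_num : (-(4 / 3) : ℝ) ≤ 0)
      gcongr

/-- A summable majorant on `ℤ³`. -/
def latticeBound (N : ℤ × ℤ × ℤ) : ℝ :=
  (1 + |(N.1 : ℝ)|) ^ (-(4 / 3) : ℝ) * ((1 + |(N.2.1 : ℝ)|) ^ (-(4 / 3) : ℝ) *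
    (1 + |(N.2.2 : ℝ)|) ^ (-(4 / 3) : ℝ))

theorem latticeBound_nonneg (N : ℤ × ℤ × ℤ) : 0 ≤ latticeBound N := by
  unfold latticeBound; positivity

theorem summable_latticeBound : Summable latticeBound := by
  have h := summable_one_add_abs_rpow (κ := 4 / 3) (by norm_num)
  have h2 : Summable fun N : ℤ × ℤ => (1 + |(N.1 : ℝ)|) ^ (-(4 / 3) : ℝ) *
      (1 + |(N.2 : ℝ)|) ^ (-(4 / 3) : ℝ) :=
    h.mul_of_nonneg h (fun _ => by positivity) (fun _ => by positivity)
  exact h.mul_of_nonneg h2 (fun _ => by positivity) (fun _ => by positivity)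

/-- Uniformity over real shifts in a bounded box allows all shifts S/a, for all moduli a, to be
treated with one constant. -/
theorem InH.inv_det_pow_le {τ z ω : ℂ} (h : InH τ z ω) {k : ℕ} (hk : 4 ≤ k) :
    ∃ C : ℝ, 0 < C ∧ ∀ x₁ x₂ x₃ : ℝ, |x₁| ≤ 1 → |x₂| ≤ 1 → |x₃| ≤ 1 → ∀ N : ℤ × ℤ × ℤ,
      ‖(((τ + x₁ + N.1) * (ω + x₃ + N.2.2) - (z + x₂ + N.2.1) ^ 2) ^ k)⁻¹‖
        ≤ C * latticeBound N := by
  obtain ⟨c, hc, H⟩ := h.det_bound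
  refine ⟨((c / 2) ^ k)⁻¹, by positivity, fun x₁ x₂ x₃ h₁ h₂ h₃ N => ?_⟩
  obtain ⟨d1, d2, d3⟩ := H (x₁ + N.1) (x₂ + N.2.1) (x₃ + N.2.2)
  have aux : ∀ x n : ℝ, |x| ≤ 1 → c / 2 * (1 + |n|) ≤ c * (1 + |x + n|) := by
    intro x n hx
    have h4 : |n| ≤ |x + n| + 1 := by
      have := abs_sub (x + n) x
      rw [add_sub_cancel_left] at this
      linarith
    nlinarith [abs_nonneg (x + n)]
  rw [norm_inv, norm_pow]
  push_cast at d1 d2 d3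
  rw [add_assoc, add_assoc, add_assoc]
  exact inv_pow_le_of_three hk (by positivity) (by simp) (by simp) (by simp)
    ((aux _ _ h₁).trans d1) ((aux _ _ h₂).trans d2) ((aux _ _ h₃).trans d3)

theorem summable_int_pow_mul_exp (k : ℕ) {c : ℝ} (hc : 0 < c) :
    Summable fun n : ℤ => |(n : ℝ)| ^ k * Real.exp (-(c * |(n : ℝ)|)) := by
  have h := Real.summable_pow_mul_exp_neg_nat_mul k hc
  refine Summable.of_nat_of_neg ?_ ?_
  · refine h.congr fun n => ?_
    simp
  · refine h.congr fun n => ?_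
    simp

theorem summable_int_exp {c : ℝ} (hc : 0 < c) :
    Summable fun n : ℤ => Real.exp (-(c * |(n : ℝ)|)) := by
  simpa using summable_int_pow_mul_exp 0 hc

end SiegelTwo
end

/-! ### Partial sums: the formula in the first variable and Gaussian sums -/

noncomputable section
namespace SiegelTwo
open MeasureTheory Complex Filter Set Topology

/-- `e(x) = exp(2 π i x)`. -/
def ee (x : ℂ) : ℂ := cexp (2 * Real.pi * I * x)

theorem ee_add (x y : ℂ) : ee (x + y) = ee x * ee y := by
  rw [ee, ee, ee, ← Complex.exp_add, mul_add]

theorem ee_zero : ee 0 = 1 := by simp [ee]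

theorem norm_ee (x : ℂ) : ‖ee x‖ = Real.exp (-(2 * Real.pi * x.im)) := by
  rw [ee, Complex.norm_exp]; simp

theorem ee_ne_zero (x : ℂ) : ee x ≠ 0 := Complex.exp_ne_zero _

theorem expRamp_neg_I_mul (κ : ℝ) (σ : ℂ) (x : ℝ) :
    expRamp κ (-I * σ) x = (((max x 0) ^ (κ - 1) : ℝ) : ℂ) * ee (x * σ) := by
  rw [expRamp, ee]; congr 2; ring

/-- The coefficients in Lipschitz' formula of degree two. -/
def lipCoeff (k : ℕ) (T : ℤ × ℤ × ℤ) : ℝ :=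
  if 0 < T.1 then (max ((T.1 : ℝ) * T.2.2 - (T.2.1 : ℝ) ^ 2 / 4) 0) ^ ((k : ℝ) - 3 / 2) else 0

/-- The linear form `tr(TZ)`. -/
def trForm (T : ℤ × ℤ × ℤ) (τ z ω : ℂ) : ℂ := T.1 * τ + T.2.1 * z + T.2.2 * ω

/-- This is `lipschitz_one` without twist, rotated from the right half plane: σ + u = i(-iσ - iu).
-/
theorem lipschitz_inv_pow {k : ℕ} (hk : 2 ≤ k) {σ : ℂ} (hσ : 0 < σ.im) :
    ∑' u : ℤ, ((σ + u) ^ k)⁻¹ = (I ^ k)⁻¹ * (((2 * Real.pi) ^ k / Real.Gamma k : ℝ) : ℂ) *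
      ∑' m : ℤ, expRamp k (-I * σ) m := by
  have hs : 0 < (-I * σ).re := by simpa using hσ
  have h := lipschitz_one (κ := k) (by exact_mod_cast hk) hs 0
  simp only [sub_zero, Real.rpow_natCast] at h
  rw [mul_assoc, ← h, ← tsum_mul_left]
  congr 1
  ext u
  have h2 : σ + u = I * (-I * σ - I * u) := by
    linear_combination (σ + u) * I_mul_I
  rw [h2, mul_pow, mul_inv]
  simp [cpow_neg]

/-- The number τ - (z + v)²/ω is a Schur complement. Its imaginary part is quadratic in v;
completing the square leaves the constant im τ - (im z)²/im ω, which is positive. Its homogenization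
in (v, 1) is therefore positive definite. -/
theorem InH.exists_le_im {τ z ω : ℂ} (h : InH τ z ω) :
    ∃ δ : ℝ, 0 < δ ∧ ∀ v : ℝ, δ * (1 + |v|) ≤ (τ - (z + v) ^ 2 / ω).im := by
  have ht := h.im_pos'
  set D := normSq ω with hD
  have hω : ω ≠ 0 := by rintro rfl; simp at ht
  have hD0 : 0 < D := normSq_pos.2 hω
  have hDe : D = ω.re ^ 2 + ω.im ^ 2 := by rw [hD, normSq_apply]; ring
  set q := ω.im * z.re - ω.re * z.im with hq
  set e := τ.im - z.im ^ 2 / ω.im with he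
  have he0 : 0 < e := by
    rw [he, sub_pos, div_lt_iff₀ ht]; exact h.det_pos
  have formula : ∀ v : ℝ, (τ - (z + v) ^ 2 / ω).im
      = ω.im / D * v ^ 2 + 2 * (q / D) * v * 1 + (q ^ 2 / (ω.im * D) + e) * 1 ^ 2 := by
    intro v
    rw [sub_im, div_im, ← hD]
    simp only [pow_two, add_re, add_im, mul_re, mul_im, ofReal_re, ofReal_im, add_zero]
    rw [he, hq]
    field_simp
    rw [hDe]
    ring
  obtain ⟨ε, hε, -, -, H⟩ := exists_le_quadratic (y₁ := ω.im / D) (y₂ := q / D)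
    (y₃ := q ^ 2 / (ω.im * D) + e) (by positivity) (by
      have : ω.im / D * (q ^ 2 / (ω.im * D) + e) = (q / D) ^ 2 + ω.im / D * e := by
        field_simp
      rw [this]
      have : 0 < ω.im / D * e := by positivity
      linarith)
  refine ⟨ε / 2, by positivity, fun v => ?_⟩
  rw [formula]
  refine le_trans ?_ (H v 1)
  rw [div_mul_eq_mul_div, mul_div_assoc]
  refine mul_le_mul_of_nonneg_left ?_ hε.le
  nlinarith [sq_nonneg (|v| - 1), sq_abs v]

theorem rpow_le_pow_of_one_le {x : ℝ} (hx : 1 ≤ x) {a : ℝ} {k : ℕ} (h : a ≤ k) :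
    x ^ a ≤ x ^ k := by
  rw [← Real.rpow_natCast]
  exact Real.rpow_le_rpow_of_exponent_le hx h

theorem InH.summable_expRamp {τ z ω : ℂ} (h : InH τ z ω) {k : ℕ} (hk : 2 ≤ k) :
    Summable fun x : ℤ × ℤ => expRamp k (-I * (τ - (z + x.1) ^ 2 / ω)) x.2 := by
  obtain ⟨δ, hδ, H⟩ := h.exists_le_im
  have h1 := (summable_int_exp (c := 2 * Real.pi * δ) (by positivity)).mul_of_nonneg
    (summable_int_pow_mul_exp k (c := 2 * Real.pi * δ) (by positivity))
    (fun _ => by positivity) (fun _ => by positivity)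
  refine Summable.of_norm_bounded h1 fun x => ?_
  obtain ⟨v, n⟩ := x
  rcases le_or_gt n 0 with hn | hn
  · rw [expRamp_of_nonpos (by exact_mod_cast hk) _ (by exact_mod_cast hn), norm_zero]
    positivity
  · have hn1 : (1 : ℝ) ≤ n := by exact_mod_cast hn
    rw [norm_expRamp, max_eq_left (by linarith), abs_of_pos (by linarith : (0 : ℝ) < n)]
    have hv := H v
    have e1 : (-I * (τ - (z + (v : ℂ)) ^ 2 / ω)).re = (τ - (z + (v : ℝ)) ^ 2 / ω).im := by
      simp
    rw [e1]
    have e2 : (n : ℝ) ^ ((k : ℝ) - 1) ≤ (n : ℝ) ^ k := rpow_le_pow_of_one_le hn1 (by linarith)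
    have e3 : Real.exp (-(2 * Real.pi * (τ - (z + (v : ℝ)) ^ 2 / ω).im) * n)
        ≤ Real.exp (-(2 * Real.pi * δ * |(v : ℝ)|)) * Real.exp (-(2 * Real.pi * δ * n)) := by
      rw [← Real.exp_add, Real.exp_le_exp]
      have e4 : δ * (n + |(v : ℝ)|) ≤ (τ - (z + (v : ℝ)) ^ 2 / ω).im * n := by
        refine le_trans ?_ (mul_le_mul_of_nonneg_right hv (by linarith))
        nlinarith [mul_nonneg hδ.le (mul_nonneg (abs_nonneg (v : ℝ)) (by linarith : (0 : ℝ) ≤ n - 1))]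
      nlinarith [Real.pi_pos]
    calc _ ≤ (n : ℝ) ^ k * (Real.exp (-(2 * Real.pi * δ * |(v : ℝ)|)) * Real.exp (-(2 * Real.pi * δ * n))) := by
          gcongr
      _ = _ := by ring

/-- Poisson summation for a Gaussian. -/
theorem tsum_gaussian {n : ℤ} (hn : 0 < n) (z : ℂ) {ω : ℂ} (hω : 0 < ω.im) :
    ∑' v : ℤ, ee (n * (-(z + v) ^ 2 / ω)) = (((2 * n : ℝ) ^ (-(1 / 2) : ℝ) : ℝ) : ℂ) *
      (-I * ω) ^ (1 / 2 : ℂ) * ∑' r : ℤ, ee (r * z + (r : ℂ) ^ 2 / (4 * n) * ω) := by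
  have hn0 : (n : ℂ) ≠ 0 := by exact_mod_cast hn.ne'
  have hn1 : (0 : ℝ) < n := by exact_mod_cast hn
  have hω0 : ω ≠ 0 := by rintro rfl; simp at hω
  have hs : -I * ω ≠ 0 := by simpa using hω0
  -- Both sides are Jacobi theta series: the right one at (z, ω/2n), the left one at the inverted
  -- point.
  have h := jacobiTheta₂_functional_equation z (ω / (2 * n))
  have e1 : jacobiTheta₂ z (ω / (2 * n)) = ∑' r : ℤ, ee (r * z + (r : ℂ) ^ 2 / (4 * n) * ω) := by
    rw [jacobiTheta₂]
    congr 1; ext r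
    rw [jacobiTheta₂_term, ee]
    congr 1
    field_simp
    ring
  have e2 : cexp (-Real.pi * I * z ^ 2 / (ω / (2 * n))) *
      jacobiTheta₂ (z / (ω / (2 * n))) (-1 / (ω / (2 * n))) = ∑' v : ℤ, ee (n * (-(z + v) ^ 2 / ω)) := by
    rw [jacobiTheta₂, ← tsum_mul_left, ← (Equiv.neg ℤ).tsum_eq]
    congr 1; ext v
    rw [jacobiTheta₂_term, ee, ← Complex.exp_add, Equiv.neg_apply]
    congr 1
    field_simp
    push_cast
    ring
  have e3 : (-I * (ω / (2 * n))) = (((2 * n : ℝ)⁻¹ : ℝ) : ℂ) * (-I * ω) := by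
    push_cast; field_simp
  have e4 : (((2 * n : ℝ)⁻¹ : ℝ) : ℂ) ^ (1 / 2 : ℂ) = (((2 * n : ℝ) ^ (-(1 / 2) : ℝ) : ℝ) : ℂ) := by
    have : (1 / 2 : ℂ) = ((1 / 2 : ℝ) : ℂ) := by push_cast; rfl
    rw [this, ← ofReal_cpow (by positivity), Real.rpow_neg (by positivity), Real.inv_rpow (by positivity)]
  rw [mul_assoc, e2, e3, ofReal_mul_cpow (by positivity) hs, e4, e1] at h
  rw [h, ← mul_assoc, mul_one_div, div_self, one_mul]
  refine mul_ne_zero ?_ ?_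
  · exact ofReal_ne_zero.2 (by positivity)
  · rw [Ne, cpow_eq_zero_iff]; tauto

end SiegelTwo
end

/-! ### Lipschitz' formula of degree two -/

noncomputable section
namespace SiegelTwo
open MeasureTheory Complex Filter Set Topology

/-- A nonzero term has n, m ≥ 1 and r² < 4nm, hence |r| ≤ n + m and im tr(TZ) ≥ ε(n + m). Half of
this decay is spent on n and m, the other half on r. -/
theorem InH.summable_lipCoeff {τ z ω : ℂ} (h : InH τ z ω) (k : ℕ) (hk : 2 ≤ k) :
    Summable fun T : ℤ × ℤ × ℤ => ‖(lipCoeff k T : ℂ) * ee (trForm T τ z ω)‖ := by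
  obtain ⟨ε, hε, hε₁, hε₃, H⟩ := exists_le_quadratic h.im_pos h.det_pos
  have hc : 0 < Real.pi * ε := by positivity
  have h1 := (summable_int_pow_mul_exp k hc).mul_of_nonneg
    ((summable_int_exp hc).mul_of_nonneg (summable_int_pow_mul_exp k hc)
    (fun _ => by positivity) (fun _ => by positivity)) (fun _ => by positivity)
    (fun _ => by positivity)
  refine Summable.of_nonneg_of_le (fun _ => norm_nonneg _) (fun T => ?_) h1
  obtain ⟨n, r, m⟩ := T
  dsimp only
  rw [norm_mul, norm_ee, Complex.norm_real, lipCoeff]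
  dsimp only
  have hk0 : (k : ℝ) - 3 / 2 ≠ 0 := by
    have : (2 : ℝ) ≤ k := by exact_mod_cast hk
    intro h; linarith
  split_ifs with hn
  swap
  · simp only [norm_zero, zero_mul]; positivity
  rcases le_or_gt ((n : ℝ) * m - (r : ℝ) ^ 2 / 4) 0 with hd | hd
  · rw [max_eq_right hd, Real.zero_rpow hk0, norm_zero, zero_mul]
    positivity
  have hn1 : (1 : ℝ) ≤ n := by exact_mod_cast hn
  have hm0 : (0 : ℝ) < m := by
    by_contra hm
    nlinarith [sq_nonneg (r : ℝ)]
  have hm1 : (1 : ℝ) ≤ m := by exact_mod_cast (by exact_mod_cast hm0 : (0 : ℤ) < m)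
  rw [max_eq_left hd.le, Real.norm_of_nonneg (by positivity), abs_of_pos (by linarith : (0:ℝ) < n),
    abs_of_pos hm0]
  have hr : |(r : ℝ)| ≤ n + m := by
    refine abs_le_of_sq_le_sq ?_ (by linarith)
    nlinarith [sq_nonneg ((n : ℝ) - m)]
  have e1 : ((n : ℝ) * m - (r : ℝ) ^ 2 / 4) ^ ((k : ℝ) - 3 / 2) ≤ (n : ℝ) ^ k * (m : ℝ) ^ k := by
    rw [← mul_pow]
    refine (Real.rpow_le_rpow hd.le (z := (k : ℝ) - 3 / 2) (by nlinarith [sq_nonneg (r : ℝ)] :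
      _ ≤ (n : ℝ) * m) ?_).trans (rpow_le_pow_of_one_le (by nlinarith) (by linarith))
    have : (2 : ℝ) ≤ k := by exact_mod_cast hk
    linarith
  have e2 : ε * (n + m) ≤ (trForm (n, r, m) τ z ω).im := by
    have h3 : (trForm (n, r, m) τ z ω).im = n * τ.im + r * z.im + m * ω.im := by
      simp [trForm]
    rw [h3]
    refine le_of_mul_le_mul_left ?_ (by linarith : (0 : ℝ) < n)
    have := H n (r / 2)
    nlinarith [mul_nonneg (sub_nonneg.2 hε₃) hd.le]
  have e3 : Real.exp (-(2 * Real.pi * (trForm (n, r, m) τ z ω).im)) ≤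
      Real.exp (-(Real.pi * ε * n)) * (Real.exp (-(Real.pi * ε * |(r : ℝ)|)) * Real.exp (-(Real.pi * ε * m))) := by
    rw [← Real.exp_add, ← Real.exp_add, Real.exp_le_exp]
    have := mul_le_mul_of_nonneg_left hr hc.le
    have := mul_le_mul_of_nonneg_left e2 Real.pi_pos.le
    nlinarith
  calc _ ≤ (n : ℝ) ^ k * (m : ℝ) ^ k * (Real.exp (-(Real.pi * ε * n)) * (Real.exp (-(Real.pi * ε * |(r : ℝ)|)) * Real.exp (-(Real.pi * ε * m)))) := by
        gcongr
    _ = _ := by ring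

/-- The integer w does not change the absolute value. Multiplied by n, the imaginary part of the
argument is the form Im Z at (n, r/2). -/
theorem InH.norm_theta_term_le {τ z ω : ℂ} (h : InH τ z ω) :
    ∃ c : ℝ, 0 < c ∧ ∀ n r w : ℤ, 0 < n →
      ‖ee (n * τ + r * z + (r : ℂ) ^ 2 / (4 * n) * (ω + w))‖
        ≤ Real.exp (-(c * |(n : ℝ)|)) * Real.exp (-(c * |(r : ℝ)|)) := by
  obtain ⟨ε, hε, hε₁, hε₃, H⟩ := exists_le_quadratic h.im_pos h.det_pos
  refine ⟨Real.pi * ε, by positivity, fun n r w hn => ?_⟩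
  have hn0 : (0 : ℝ) < n := by exact_mod_cast hn
  have h3 : (n * τ + r * z + (r : ℂ) ^ 2 / (4 * n) * (ω + w)).im
      = n * τ.im + r * z.im + (r : ℝ) ^ 2 / (4 * n) * ω.im := by
    have : (r : ℂ) ^ 2 / (4 * n) = (((r : ℝ) ^ 2 / (4 * n) : ℝ) : ℂ) := by push_cast; rfl
    rw [this, add_im, add_im, im_ofReal_mul, add_im]
    simp
  rw [norm_ee, h3, ← Real.exp_add, Real.exp_le_exp, abs_of_pos hn0]
  have h4 : ε * (n + (r : ℝ) ^ 2 / (4 * n)) ≤ n * τ.im + r * z.im + (r : ℝ) ^ 2 / (4 * n) * ω.im := by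
    refine le_of_mul_le_mul_left ?_ hn0
    have := H n (r / 2)
    have e : (n : ℝ) * ((r : ℝ) ^ 2 / (4 * n)) = (r / 2) ^ 2 := by field_simp; ring
    have e1 : (n : ℝ) * (ε * (n + (r : ℝ) ^ 2 / (4 * n))) = ε * (n ^ 2 + n * ((r : ℝ) ^ 2 / (4 * n))) := by ring
    have e2 : (n : ℝ) * (n * τ.im + r * z.im + (r : ℝ) ^ 2 / (4 * n) * ω.im)
      = n ^ 2 * τ.im + n * r * z.im + (n * ((r : ℝ) ^ 2 / (4 * n))) * ω.im := by ring
    rw [e1, e2, e]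
    nlinarith
  have h5 : (n + |(r : ℝ)|) / 2 ≤ n + (r : ℝ) ^ 2 / (4 * n) := by
    refine le_of_mul_le_mul_left ?_ hn0
    have e : (n : ℝ) * ((r : ℝ) ^ 2 / (4 * n)) = r ^ 2 / 4 := by field_simp
    rw [mul_add _ _ ((r : ℝ) ^ 2 / (4 * n)), e]
    nlinarith [sq_nonneg (n - |(r : ℝ)| / 2), sq_abs (r : ℝ), sq_nonneg (n : ℝ)]
  have h6 := mul_le_mul_of_nonneg_left h5 hε.le
  have h7 := mul_le_mul_of_nonneg_left (h6.trans h4) Real.pi_pos.le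
  linarith

/-- The constant of Lipschitz' formula of degree two. -/
def lipConst (k : ℕ) : ℝ :=
  (-1) ^ k * ((2 * Real.pi) ^ k / Real.Gamma k) * ((2 : ℝ) ^ (-(1 / 2) : ℝ)) *
    ((2 * Real.pi) ^ ((k : ℝ) - 1 / 2) / Real.Gamma ((k : ℝ) - 1 / 2))

/-- The summand after the sums over `u` and `v` have been transformed. -/
def thetaTerm (k : ℕ) (τ z ω : ℂ) (w n r : ℤ) : ℂ :=
  if 0 < n then (-I * ω - I * w) ^ (-(((k : ℝ) - 1 / 2 : ℝ) : ℂ)) *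
    (((2 : ℝ) ^ (-(1 / 2) : ℝ) * (n : ℝ) ^ ((k : ℝ) - 3 / 2) : ℝ) : ℂ) *
    ee (n * τ + r * z + (r : ℂ) ^ 2 / (4 * n) * (ω + w)) else 0

theorem InH.summable_thetaTerm {τ z ω : ℂ} (h : InH τ z ω) {k : ℕ} (hk : 2 ≤ k) :
    Summable fun x : ℤ × ℤ × ℤ => thetaTerm k τ z ω x.1 x.2.1 x.2.2 := by
  obtain ⟨c, hc, H⟩ := h.norm_theta_term_le
  have hs : 0 < (-I * ω).re := by simpa using h.im_pos'
  have hk2 : (2 : ℝ) ≤ k := by exact_mod_cast hk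
  have h1 := (summable_cpow_sub_I_mul hs (κ := (k : ℝ) - 1 / 2) (by linarith)).mul_of_nonneg
    (((summable_int_pow_mul_exp k hc).mul_of_nonneg (summable_int_exp hc)
    (fun _ => by positivity) (fun _ => by positivity))) (fun _ => by positivity)
    (fun _ => by positivity)
  refine Summable.of_norm_bounded h1 fun x => ?_
  obtain ⟨w, n, r⟩ := x
  dsimp only [thetaTerm]
  split_ifs with hn
  swap
  · rw [norm_zero]; positivity
  have hn1 : (1 : ℝ) ≤ n := by exact_mod_cast hn
  have hn0 : (0 : ℝ) < n := by linarith
  rw [norm_mul, norm_mul, mul_assoc]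
  refine mul_le_mul_of_nonneg_left ?_ (norm_nonneg _)
  rw [Complex.norm_real, Real.norm_of_nonneg (by positivity), mul_assoc (|(n : ℝ)| ^ k),
    abs_of_pos hn0]
  have e1 : (2 : ℝ) ^ (-(1 / 2) : ℝ) ≤ 1 :=
    Real.rpow_le_one_of_one_le_of_nonpos (by norm_num) (by norm_num)
  have e2 : (n : ℝ) ^ ((k : ℝ) - 3 / 2) ≤ (n : ℝ) ^ k := rpow_le_pow_of_one_le hn1 (by linarith)
  have e3 := H n r w hn
  rw [abs_of_pos hn0] at e3
  calc _ ≤ 1 * (n : ℝ) ^ k * (Real.exp (-(c * n)) * Real.exp (-(c * |(r : ℝ)|))) := by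
        gcongr
    _ = _ := by ring

/-- The sum over w is `lipschitz_one` with exponent k - 1/2 and twist θ = r²/4n. The factor
n^(k-3/2) combines with (m - θ)^(k-3/2) into (nm - r²/4)^(k-3/2). -/
theorem tsum_thetaTerm {k : ℕ} (hk : 2 ≤ k) (τ z : ℂ) {ω : ℂ} (hω : 0 < ω.im) (n r : ℤ) :
    ∑' w : ℤ, thetaTerm k τ z ω w n r = (((2 : ℝ) ^ (-(1 / 2) : ℝ) *
      ((2 * Real.pi) ^ ((k : ℝ) - 1 / 2) / Real.Gamma ((k : ℝ) - 1 / 2)) : ℝ) : ℂ) *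
      ∑' m : ℤ, (lipCoeff k (n, r, m) : ℂ) * ee (trForm (n, r, m) τ z ω) := by
  by_cases hn : 0 < n
  swap
  · simp [thetaTerm, lipCoeff, hn]
  have hk2 : (2 : ℝ) ≤ k := by exact_mod_cast hk
  have hn0 : (0 : ℝ) < n := by exact_mod_cast hn
  have hs : 0 < (-I * ω).re := by simpa using hω
  set θ : ℝ := (r : ℝ) ^ 2 / (4 * n) with hθ
  have hθc : (r : ℂ) ^ 2 / (4 * n) = (θ : ℂ) := by rw [hθ]; push_cast; rfl
  have h := lipschitz_one (κ := (k : ℝ) - 1 / 2) (by linarith) hs θ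
  have e1 : ∀ w : ℤ, thetaTerm k τ z ω w n r
      = ((((2 : ℝ) ^ (-(1 / 2) : ℝ) * (n : ℝ) ^ ((k : ℝ) - 3 / 2) : ℝ) : ℂ) *
        ee (n * τ + r * z + θ * ω)) * ((-I * ω - I * w) ^ (-(((k : ℝ) - 1 / 2 : ℝ) : ℂ)) *
          cexp (2 * Real.pi * I * θ * w)) := by
    intro w
    rw [thetaTerm, if_pos hn, hθc, mul_add (θ : ℂ), ← add_assoc, ee_add]
    have : ee (θ * w) = cexp (2 * Real.pi * I * θ * w) := by rw [ee]; congr 1; ring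
    rw [this]
    ring
  have e2 : ∀ m : ℤ, (n : ℝ) ^ ((k : ℝ) - 3 / 2) * (max ((m : ℝ) - θ) 0) ^ ((k : ℝ) - 1 / 2 - 1)
      = lipCoeff k (n, r, m) := by
    intro m
    rw [lipCoeff, if_pos hn, show (k : ℝ) - 1 / 2 - 1 = (k : ℝ) - 3 / 2 by ring,
      ← Real.mul_rpow hn0.le (le_max_right _ _), mul_max_of_nonneg _ _ hn0.le, mul_zero, hθ]
    congr 3
    field_simp
  simp_rw [e1]
  rw [tsum_mul_left, h, ← tsum_mul_left, ← tsum_mul_left, ← tsum_mul_left]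
  congr 1
  ext m
  rw [show ((m : ℝ) - θ) = ((m - θ : ℝ)) from rfl, expRamp_neg_I_mul, ← e2]
  have e3 : ee (trForm (n, r, m) τ z ω) = ee (n * τ + r * z + θ * ω) * ee (((m - θ : ℝ) : ℂ) * ω) := by
    rw [← ee_add, trForm]; congr 1; push_cast; ring
  rw [e3]
  push_cast
  ring

/-- After division by ω the sum over u is a one-variable Lipschitz sum at τ - (z + v)²/ω. In the
result, the sum over v for fixed n is Gaussian. Its transformation contributes (-iω)^(1/2), which
lowers the exponent from k to k - 1/2. -/
theorem InH.tsum_inner {τ z ω : ℂ} (h : InH τ z ω) {k : ℕ} (hk : 2 ≤ k) :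
    ∑' v : ℤ, ∑' u : ℤ, (((τ + u) * ω - (z + v) ^ 2) ^ k)⁻¹ =
      (((-1) ^ k * ((2 * Real.pi) ^ k / Real.Gamma k) : ℝ) : ℂ) *
        ∑' n : ℤ, ∑' r : ℤ, thetaTerm k τ z ω 0 n r := by
  have hω := h.im_pos'
  have hω0 : ω ≠ 0 := by rintro rfl; simp at hω
  obtain ⟨δ, hδ, H⟩ := h.exists_le_im
  have e1 : ∀ v : ℤ, ∑' u : ℤ, (((τ + u) * ω - (z + v) ^ 2) ^ k)⁻¹
      = ((ω ^ k)⁻¹ * (I ^ k)⁻¹ * (((2 * Real.pi) ^ k / Real.Gamma k : ℝ) : ℂ)) *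
        ∑' n : ℤ, expRamp k (-I * (τ - (z + v) ^ 2 / ω)) n := by
    intro v
    have hσ : 0 < (τ - (z + v) ^ 2 / ω).im := by
      have := H v
      push_cast at this
      exact lt_of_lt_of_le (by positivity) this
    rw [mul_assoc, mul_assoc, ← mul_assoc (I ^ k)⁻¹, ← lipschitz_inv_pow hk hσ, ← tsum_mul_left]
    congr 1; ext u
    rw [← mul_inv, ← mul_pow]
    congr 2
    field_simp
    ring
  simp_rw [e1]
  have hcomm : ∑' v : ℤ, ∑' n : ℤ, expRamp k (-I * (τ - (z + v) ^ 2 / ω)) n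
      = ∑' n : ℤ, ∑' v : ℤ, expRamp k (-I * (τ - (z + v) ^ 2 / ω)) n :=
    Summable.tsum_comm (f := fun (n : ℤ) (v : ℤ) => expRamp k (-I * (τ - (z + v) ^ 2 / ω)) n)
      (h.summable_expRamp hk).prod_symm
  rw [tsum_mul_left, hcomm, ← tsum_mul_left, ← tsum_mul_left]
  congr 1; ext n
  by_cases hn : 0 < n
  swap
  · have : ∀ v : ℤ, expRamp k (-I * (τ - (z + v) ^ 2 / ω)) n = 0 := fun v =>
      expRamp_of_nonpos (by exact_mod_cast hk) _ (by exact_mod_cast not_lt.1 hn)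
    simp only [this]
    simp [thetaTerm, hn]
  have hn0 : (0 : ℝ) < n := by exact_mod_cast hn
  have e2 : ∀ v : ℤ, expRamp k (-I * (τ - (z + v) ^ 2 / ω)) n
      = (((n : ℝ) ^ ((k : ℝ) - 1) : ℝ) : ℂ) * ee (n * τ) * ee (n * (-(z + v) ^ 2 / ω)) := by
    intro v
    rw [expRamp_neg_I_mul, max_eq_left hn0.le, mul_assoc, ← ee_add]
    congr 2
    push_cast
    ring
  simp only [e2]
  rw [tsum_mul_left, tsum_gaussian hn z hω, ← tsum_mul_left, ← tsum_mul_left, ← tsum_mul_left,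
    ← tsum_mul_left]
  congr 1; ext r
  rw [thetaTerm, if_pos hn, add_assoc (n * τ), ee_add (n * τ)]
  have hs : -I * ω ≠ 0 := by simpa using hω0
  have e3 : (-I * ω - I * ((0 : ℤ) : ℂ)) ^ (-(((k : ℝ) - 1 / 2 : ℝ) : ℂ))
      = ((-I * ω) ^ k)⁻¹ * (-I * ω) ^ (1 / 2 : ℂ) := by
    rw [Int.cast_zero, mul_zero, sub_zero, ← cpow_natCast, ← cpow_neg, ← cpow_add _ _ hs]
    congr 1
    push_cast
    ring
  have e4 : (n : ℝ) ^ ((k : ℝ) - 1) * (2 * n : ℝ) ^ (-(1 / 2) : ℝ)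
      = (2 : ℝ) ^ (-(1 / 2) : ℝ) * (n : ℝ) ^ ((k : ℝ) - 3 / 2) := by
    rw [Real.mul_rpow (by norm_num) hn0.le, mul_left_comm, ← Real.rpow_add hn0]
    congr 2
    ring
  have e5 : (ω ^ k)⁻¹ * (I ^ k)⁻¹ = (-1) ^ k * ((-I * ω) ^ k)⁻¹ := by
    have h6 : ((-1 : ℂ)) ^ k = ((-1) ^ k)⁻¹ := by
      rcases neg_one_pow_eq_or ℂ k with h | h <;> rw [h] <;> norm_num
    rw [h6, ← mul_inv, ← mul_inv, ← mul_pow, ← mul_pow]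
    congr 2
    ring
  have e4' := congrArg (fun x : ℝ => (x : ℂ)) e4
  simp only [ofReal_mul] at e4'
  rw [e3, e5, Int.cast_zero, add_zero]
  simp only [ofReal_mul, ofReal_pow, ofReal_neg, ofReal_one]
  linear_combination ((-1) ^ k * ((-I * ω) ^ k)⁻¹ * (((2 * Real.pi) ^ k / Real.Gamma k : ℝ) : ℂ) *
    ee (n * τ) * (-I * ω) ^ (1 / 2 : ℂ) * ee (r * z + (r : ℂ) ^ 2 / (4 * n) * ω)) * e4'

theorem thetaTerm_add_int (k : ℕ) (τ z ω : ℂ) (w n r : ℤ) :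
    thetaTerm k τ z (ω + w) 0 n r = thetaTerm k τ z ω w n r := by
  unfold thetaTerm
  congr 3
  · congr 1
    · push_cast; ring
  · congr 1
    push_cast; ring

/-- Lipschitz' formula of degree two. -/
theorem InH.lipschitz_two {τ z ω : ℂ} (h : InH τ z ω) {k : ℕ} (hk : 4 ≤ k) :
    ∑' N : ℤ × ℤ × ℤ, (((τ + N.1) * (ω + N.2.2) - (z + N.2.1) ^ 2) ^ k)⁻¹ =
      (lipConst k : ℂ) * ∑' T : ℤ × ℤ × ℤ, (lipCoeff k T : ℂ) * ee (trForm T τ z ω) := by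
  have hk2 : 2 ≤ k := by omega
  obtain ⟨C, hC, HC⟩ := h.inv_det_pow_le hk
  have hsum : Summable fun N : ℤ × ℤ × ℤ =>
      (((τ + N.1) * (ω + N.2.2) - (z + N.2.1) ^ 2) ^ k)⁻¹ := by
    refine Summable.of_norm_bounded (summable_latticeBound.mul_left C) fun N => ?_
    simpa using HC 0 0 0 (by simp) (by simp) (by simp) N
  -- The order of the coordinates is reversed so that the translation w of ω becomes the outermost
  -- summation and can be carried out last.
  let e : ℤ × ℤ × ℤ ≃ ℤ × ℤ × ℤ :=
    ⟨fun x => (x.2.2, x.2.1, x.1), fun x => (x.2.2, x.2.1, x.1), fun _ => rfl, fun _ => rfl⟩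
  have hsum' := (e.summable_iff).2 hsum
  rw [← e.tsum_eq]
  have s1 := hsum'.tsum_prod
  rw [show (fun N => (((τ + (e N).1) * (ω + (e N).2.2) - (z + (e N).2.1) ^ 2) ^ k)⁻¹) = _ from rfl]
  refine s1.trans ?_
  have s2 : ∀ w : ℤ, ∑' x : ℤ × ℤ, (((τ + x.2) * (ω + w) - (z + x.1) ^ 2) ^ k)⁻¹
      = (((-1) ^ k * ((2 * Real.pi) ^ k / Real.Gamma k) : ℝ) : ℂ) *
        ∑' x : ℤ × ℤ, thetaTerm k τ z ω w x.1 x.2 := by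
    intro w
    have hw : InH τ z (ω + w) := by simpa using h.add_real 0 0 w
    have t1 : Summable fun x : ℤ × ℤ => (((τ + x.2) * (ω + w) - (z + x.1) ^ 2) ^ k)⁻¹ :=
      hsum'.prod_factor w
    have t2 : Summable fun x : ℤ × ℤ => thetaTerm k τ z ω w x.1 x.2 :=
      (h.summable_thetaTerm hk2).prod_factor w
    rw [t1.tsum_prod, t2.tsum_prod]
    have := hw.tsum_inner hk2
    simp only [thetaTerm_add_int] at this
    exact this
  have s3 : ∀ x : ℤ × ℤ, ∑' w : ℤ, thetaTerm k τ z ω w x.1 x.2 = _ := fun x =>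
    tsum_thetaTerm hk2 τ z h.im_pos' x.1 x.2
  calc _ = ∑' w : ℤ, (((-1) ^ k * ((2 * Real.pi) ^ k / Real.Gamma k) : ℝ) : ℂ) *
        ∑' x : ℤ × ℤ, thetaTerm k τ z ω w x.1 x.2 := by
        congr 1; ext w; exact s2 w
    _ = (((-1) ^ k * ((2 * Real.pi) ^ k / Real.Gamma k) : ℝ) : ℂ) *
        ∑' x : ℤ × ℤ, ∑' w : ℤ, thetaTerm k τ z ω w x.1 x.2 := by
        rw [tsum_mul_left]
        congr 1
        exact ((h.summable_thetaTerm hk2).prod_symm.tsum_comm (f := fun (x : ℤ × ℤ) (w : ℤ) => thetaTerm k τ z ω w x.1 x.2))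
    _ = _ := by
        simp_rw [s3]
        rw [tsum_mul_left, ← mul_assoc, ← ofReal_mul]
        have s4 : ∑' T : ℤ × ℤ × ℤ, (lipCoeff k T : ℂ) * ee (trForm T τ z ω)
            = ∑' x : ℤ × ℤ, ∑' m : ℤ, (lipCoeff k (x.1, x.2, m) : ℂ) * ee (trForm (x.1, x.2, m) τ z ω) := by
          have h5 := (h.summable_lipCoeff k hk2).of_norm
          rw [← (Equiv.prodAssoc ℤ ℤ ℤ).tsum_eq]
          exact ((Equiv.prodAssoc ℤ ℤ ℤ).summable_iff.2 h5).tsum_prod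
        rw [s4]
        congr 2
        rw [lipConst]
        ring

end SiegelTwo
end

/-! ### Minors of the lower half of a symplectic matrix -/

noncomputable section
namespace SiegelTwo
open Matrix

/-- Integral vectors of length five, the coefficients of `a(τω - z²) + bτ + 2 c z + dω + e`. -/
@[ext] structure IVec where
  a : ℤ
  b : ℤ
  c : ℤ
  d : ℤ
  e : ℤ

namespace IVec

/-- Scalar multiples. -/
def scale (m : ℤ) (v : IVec) : IVec := ⟨m * v.a, m * v.b, m * v.c, m * v.d, m * v.e⟩

/-- Isotropic vectors. -/
def Iso (v : IVec) : Prop := v.a * v.e = v.b * v.d - v.c ^ 2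

/-- Primitive vectors. -/
def Prim (v : IVec) : Prop :=
  ∀ n : ℤ, n ∣ v.a → n ∣ v.b → n ∣ v.c → n ∣ v.d → n ∣ v.e → IsUnit n

/-- The value of the associated function at a point of the upper half space. -/
def jval (v : IVec) (τ z ω : ℂ) : ℂ := v.a * (τ * ω - z ^ 2) + v.b * τ + 2 * v.c * z + v.d * ω + v.e

theorem jval_scale (m : ℤ) (v : IVec) (τ z ω : ℂ) :
    (v.scale m).jval τ z ω = m * v.jval τ z ω := by
  simp [jval, scale]; ring

/-- The action of a translation. -/
def shift (s₁ s₂ s₃ : ℤ) (v : IVec) : IVec :=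
  ⟨v.a, v.b + s₃ * v.a, v.c - s₂ * v.a, v.d + s₁ * v.a,
    v.e + s₁ * v.b + 2 * s₂ * v.c + s₃ * v.d + (s₁ * s₃ - s₂ ^ 2) * v.a⟩

/-- The action of the full inversion. -/
def inversion (v : IVec) : IVec := ⟨v.e, -v.d, v.c, -v.b, v.a⟩

/-- The action of the inversion in the first variable. -/
def inversionFst (v : IVec) : IVec := ⟨v.d, v.e, v.c, -v.a, -v.b⟩

/-- The action of the inversion in the last variable. -/
def inversionLast (v : IVec) : IVec := ⟨v.b, -v.a, v.c, v.e, -v.d⟩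

theorem Prim.shift {v : IVec} (h : v.Prim) (s₁ s₂ s₃ : ℤ) : (v.shift s₁ s₂ s₃).Prim := by
  intro n ha hb hc hd he
  simp only [IVec.shift] at ha hb hc hd he
  have hb' : n ∣ v.b := by simpa using dvd_sub hb (ha.mul_left s₃)
  have hc' : n ∣ v.c := by simpa using dvd_add hc (ha.mul_left s₂)
  have hd' : n ∣ v.d := by simpa using dvd_sub hd (ha.mul_left s₁)
  refine h n ha hb' hc' hd' ?_
  have h1 : n ∣ s₁ * v.b + 2 * s₂ * v.c + s₃ * v.d + (s₁ * s₃ - s₂ ^ 2) * v.a :=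
    dvd_add (dvd_add (dvd_add (hb'.mul_left _) (hc'.mul_left _)) (hd'.mul_left _)) (ha.mul_left _)
  have h2 := dvd_sub he h1
  ring_nf at h2
  simpa using h2

theorem Iso.shift {v : IVec} (h : v.Iso) (s₁ s₂ s₃ : ℤ) : (v.shift s₁ s₂ s₃).Iso := by
  simp only [Iso, IVec.shift] at *
  linear_combination h

theorem Prim.inversion {v : IVec} (h : v.Prim) : v.inversion.Prim := by
  intro n ha hb hc hd he
  simp only [IVec.inversion, dvd_neg] at ha hb hc hd he
  exact h n he hd hc hb ha

theorem Iso.inversion {v : IVec} (h : v.Iso) : v.inversion.Iso := by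
  simp only [Iso, IVec.inversion] at *
  linear_combination h

theorem Prim.inversionFst {v : IVec} (h : v.Prim) : v.inversionFst.Prim := by
  intro n ha hb hc hd he
  simp only [IVec.inversionFst, dvd_neg] at ha hb hc hd he
  exact h n hd he hc ha hb

theorem Iso.inversionFst {v : IVec} (h : v.Iso) : v.inversionFst.Iso := by
  simp only [Iso, IVec.inversionFst] at *
  linear_combination h

theorem Prim.inversionLast {v : IVec} (h : v.Prim) : v.inversionLast.Prim := by
  intro n ha hb hc hd he
  simp only [IVec.inversionLast, dvd_neg] at ha hb hc hd he
  exact h n hb ha hc he hd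

theorem Iso.inversionLast {v : IVec} (h : v.Iso) : v.inversionLast.Iso := by
  simp only [Iso, IVec.inversionLast] at *
  linear_combination h

end IVec

theorem toBlocks₁₁_inv (γ : Gam) : (γ⁻¹).1.toBlocks₁₁ = (blockD γ)ᵀ := by
  have h : ((γ⁻¹ : Gam) : Matrix (Fin 2 ⊕ Fin 2) (Fin 2 ⊕ Fin 2) ℤ)
      = (-J (Fin 2) ℤ) * γ.1ᵀ * J (Fin 2) ℤ := rfl
  unfold blockD
  rw [h]
  conv_lhs => rw [← fromBlocks_toBlocks γ.1]
  simp [J, fromBlocks_transpose, fromBlocks_multiply, fromBlocks_neg]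

theorem blockC_mul_inv (γ δ : Gam) :
    blockC (γ * δ⁻¹) = blockC γ * (blockD δ)ᵀ - blockD γ * (blockC δ)ᵀ := by
  rw [blockC_mul, toBlocks₁₁_inv, blockC_inv, Matrix.mul_neg, sub_eq_add_neg]

theorem symm_rel (γ : Gam) : blockC γ 0 0 * blockD γ 1 0 + blockC γ 0 1 * blockD γ 1 1
    = blockC γ 1 0 * blockD γ 0 0 + blockC γ 1 1 * blockD γ 0 1 := by
  have h := blockC_mul_inv γ γ
  rw [mul_inv_cancel, blockC_one] at h
  have := congrFun (congrFun h 0) 1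
  simp [Matrix.mul_apply, Fin.sum_univ_two] at this
  linarith

/-- The vector of minors of the lower half of `γ`. -/
def minors (γ : Gam) : IVec where
  a := blockC γ 0 0 * blockC γ 1 1 - blockC γ 0 1 * blockC γ 1 0
  b := blockC γ 0 0 * blockD γ 1 1 - blockD γ 0 1 * blockC γ 1 0
  c := blockC γ 0 1 * blockD γ 1 1 - blockD γ 0 1 * blockC γ 1 1
  d := blockD γ 0 0 * blockC γ 1 1 - blockC γ 0 1 * blockD γ 1 0
  e := blockD γ 0 0 * blockD γ 1 1 - blockD γ 0 1 * blockD γ 1 0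

/-- This is the Plücker relation. The symmetry of C·ᵗD identifies two of the six minors, which is
why five entries suffice. -/
theorem minors_iso (γ : Gam) : (minors γ).Iso := by
  have h := symm_rel γ
  simp only [IVec.Iso, minors]
  linear_combination (blockC γ 0 1 * blockD γ 1 1 - blockD γ 0 1 * blockC γ 1 1) * h

theorem autFactor_eq (γ : Gam) {Z : Matrix (Fin 2) (Fin 2) ℂ} (hZ : Zᵀ = Z) :
    autFactor γ Z = (minors γ).jval (Z 0 0) (Z 0 1) (Z 1 1) := by
  have h1 : Z 1 0 = Z 0 1 := congrFun (congrFun hZ 0) 1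
  have h := congrArg (Int.cast : ℤ → ℂ) (symm_rel γ)
  push_cast at h
  simp only [autFactor, det_fin_two, Matrix.add_apply, Matrix.mul_apply, Fin.sum_univ_two,
    Matrix.map_apply, h1, IVec.jval, minors]
  push_cast
  linear_combination (-Z 0 1) * h

/-- With P and Q the right-hand blocks of the inverse, CP + DQ = 1. By Cauchy–Binet its determinant
1 is an integral combination of the minors of (C D). -/
theorem minors_prim (γ : Gam) : (minors γ).Prim := by
  intro n ha hb hc hd he
  have h := symm_rel γ
  have h1 : blockC γ * (γ⁻¹).1.toBlocks₁₂ + blockD γ * blockD γ⁻¹ = 1 := by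
    rw [← blockD_mul, mul_inv_cancel, blockD_one]
  have h2 := congrArg det h1
  set P := (γ⁻¹).1.toBlocks₁₂
  set Q := blockD γ⁻¹
  simp only [det_one, det_fin_two, Matrix.add_apply, Matrix.mul_apply, Fin.sum_univ_two] at h2
  simp only [minors] at ha hb hc hd he
  refine isUnit_of_dvd_one ?_
  rw [← h2]
  have key := dvd_add (dvd_add (dvd_add (dvd_add (ha.mul_right (P 0 0 * P 1 1 - P 0 1 * P 1 0))
    (he.mul_right (Q 0 0 * Q 1 1 - Q 0 1 * Q 1 0)))
    (hb.mul_right (P 0 0 * Q 1 1 - P 0 1 * Q 1 0)))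
    (hc.mul_right (P 1 0 * Q 1 1 - P 1 1 * Q 1 0 - (P 0 0 * Q 0 1 - P 0 1 * Q 0 0))))
    (hd.mul_right (P 1 1 * Q 0 0 - P 1 0 * Q 0 1))
  convert! key using 1
  linear_combination (P 0 0 * Q 0 1 - P 0 1 * Q 0 0) * h

theorem minors_left (g γ : Gam) (hg : g ∈ GamInf) :
    minors (g * γ) = (minors γ).scale (blockD g).det := by
  simp only [minors, blockC_left g γ hg, blockD_left g γ hg, Matrix.mul_apply, Fin.sum_univ_two,
    IVec.scale, det_fin_two]
  ext <;> dsimp only <;> ring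

/-- The vectors s and t span an isotropic plane, and the vanishing of the 3×3 minors of (x, s, t)
places x in it over ℚ. Each 2×2 minor of (s, t) times the pairing of x with s is a combination of
the hypotheses, and some such minor is nonzero. -/
theorem pairing_eq_zero {x₁ x₂ x₃ x₄ s₁ s₂ s₃ s₄ t₁ t₂ t₃ t₄ : ℤ}
    (hst : s₁ * t₃ + s₂ * t₄ - s₃ * t₁ - s₄ * t₂ = 0)
    (h₁ : x₂ * (s₃ * t₄ - s₄ * t₃) - x₃ * (s₂ * t₄ - s₄ * t₂) + x₄ * (s₂ * t₃ - s₃ * t₂) = 0)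
    (h₂ : x₁ * (s₃ * t₄ - s₄ * t₃) - x₃ * (s₁ * t₄ - s₄ * t₁) + x₄ * (s₁ * t₃ - s₃ * t₁) = 0)
    (h₃ : x₁ * (s₂ * t₄ - s₄ * t₂) - x₂ * (s₁ * t₄ - s₄ * t₁) + x₄ * (s₁ * t₂ - s₂ * t₁) = 0)
    (h₄ : x₁ * (s₂ * t₃ - s₃ * t₂) - x₂ * (s₁ * t₃ - s₃ * t₁) + x₃ * (s₁ * t₂ - s₂ * t₁) = 0)
    (hne : ¬ (s₁ * t₂ - s₂ * t₁ = 0 ∧ s₁ * t₃ - s₃ * t₁ = 0 ∧ s₁ * t₄ - s₄ * t₁ = 0 ∧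
      s₂ * t₃ - s₃ * t₂ = 0 ∧ s₂ * t₄ - s₄ * t₂ = 0 ∧ s₃ * t₄ - s₄ * t₃ = 0)) :
    x₁ * s₃ + x₂ * s₄ - x₃ * s₁ - x₄ * s₂ = 0 := by
  by_contra hc
  apply hne
  have e12 : (s₁ * t₂ - s₂ * t₁) * (x₁ * s₃ + x₂ * s₄ - x₃ * s₁ - x₄ * s₂) = 0 := by
    linear_combination -(s₁ * x₂ - s₂ * x₁) * hst - s₁ * h₄ - s₂ * h₃
  have e13 : (s₁ * t₃ - s₃ * t₁) * (x₁ * s₃ + x₂ * s₄ - x₃ * s₁ - x₄ * s₂) = 0 := by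
    linear_combination -(s₁ * x₃ - s₃ * x₁) * hst - s₄ * h₄ - s₂ * h₂
  have e14 : (s₁ * t₄ - s₄ * t₁) * (x₁ * s₃ + x₂ * s₄ - x₃ * s₁ - x₄ * s₂) = 0 := by
    linear_combination -(s₁ * x₄ - s₄ * x₁) * hst - s₄ * h₃ + s₁ * h₂
  have e23 : (s₂ * t₃ - s₃ * t₂) * (x₁ * s₃ + x₂ * s₄ - x₃ * s₁ - x₄ * s₂) = 0 := by
    linear_combination -(s₂ * x₃ - s₃ * x₂) * hst + s₃ * h₄ - s₂ * h₁
  have e24 : (s₂ * t₄ - s₄ * t₂) * (x₁ * s₃ + x₂ * s₄ - x₃ * s₁ - x₄ * s₂) = 0 := by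
    linear_combination -(s₂ * x₄ - s₄ * x₂) * hst + s₃ * h₃ + s₁ * h₁
  have e34 : (s₃ * t₄ - s₄ * t₃) * (x₁ * s₃ + x₂ * s₄ - x₃ * s₁ - x₄ * s₂) = 0 := by
    linear_combination -(s₃ * x₄ - s₄ * x₃) * hst + s₃ * h₂ + s₄ * h₁
  exact ⟨(mul_eq_zero.1 e12).resolve_right hc, (mul_eq_zero.1 e13).resolve_right hc,
    (mul_eq_zero.1 e14).resolve_right hc, (mul_eq_zero.1 e23).resolve_right hc,
    (mul_eq_zero.1 e24).resolve_right hc, (mul_eq_zero.1 e34).resolve_right hc⟩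

/-- Proportional Plücker coordinates mean equal row spaces. This common space is isotropic, so the
rows of δ pair to zero with those of γ; these pairings are the entries of the lower left block of
δγ⁻¹. -/
theorem mem_gamInf_of_minors_eq {γ δ : Gam} {ε : ℤ} (h : minors δ = (minors γ).scale ε) (hε : ε ≠ 0) :
    δ * γ⁻¹ ∈ GamInf := by
  change blockC (δ * γ⁻¹) = 0
  have hs := symm_rel γ
  have hd := symm_rel δ
  have hne : ¬ ((minors γ).a = 0 ∧ (minors γ).b = 0 ∧ (minors γ).c = 0 ∧ (minors γ).d = 0 ∧
      (minors γ).e = 0) := by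
    rintro ⟨h1, h2, h3, h4, h5⟩
    have := minors_prim γ 0 (by simp [h1]) (by simp [h2]) (by simp [h3]) (by simp [h4]) (by simp [h5])
    exact not_isUnit_zero this
  have ha := congrArg IVec.a h
  have hb := congrArg IVec.b h
  have hc := congrArg IVec.c h
  have hd' := congrArg IVec.d h
  have he := congrArg IVec.e h
  simp only [minors, IVec.scale] at ha hb hc hd' he hne
  rw [blockC_mul_inv]
  have main : ∀ i : Fin 2, (blockC δ i 0 * blockD γ 0 0 + blockC δ i 1 * blockD γ 0 1
      - blockD δ i 0 * blockC γ 0 0 - blockD δ i 1 * blockC γ 0 1 = 0) ∧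
      (blockC δ i 0 * blockD γ 1 0 + blockC δ i 1 * blockD γ 1 1
      - blockD δ i 0 * blockC γ 1 0 - blockD δ i 1 * blockC γ 1 1 = 0) := by
    intro i
    -- T1 to T4 are the 3×3 minors of row i of δ stacked on both rows of γ. Multiplied by ε, the
    -- minors of γ become those of δ, and row i occurs twice.
    have T1 : blockC δ i 1 * (blockD γ 0 0 * blockD γ 1 1 - blockD γ 0 1 * blockD γ 1 0)
        - blockD δ i 0 * (blockC γ 0 1 * blockD γ 1 1 - blockD γ 0 1 * blockC γ 1 1)
        + blockD δ i 1 * (blockC γ 0 1 * blockD γ 1 0 - blockD γ 0 0 * blockC γ 1 1) = 0 := by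
      refine (mul_eq_zero.1 (?_ : ε * _ = 0)).resolve_left hε
      fin_cases i <;> simp only [Fin.zero_eta, Fin.mk_one] <;>
      linear_combination (-blockC δ _ 1) * he + blockD δ _ 0 * hc + blockD δ _ 1 * hd'
    have T2 : blockC δ i 0 * (blockD γ 0 0 * blockD γ 1 1 - blockD γ 0 1 * blockD γ 1 0)
        - blockD δ i 0 * (blockC γ 0 0 * blockD γ 1 1 - blockD γ 0 1 * blockC γ 1 0)
        + blockD δ i 1 * (blockC γ 0 0 * blockD γ 1 0 - blockD γ 0 0 * blockC γ 1 0) = 0 := by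
      refine (mul_eq_zero.1 (?_ : ε * _ = 0)).resolve_left hε
      fin_cases i <;> simp only [Fin.zero_eta, Fin.mk_one] <;>
      linear_combination (-blockC δ _ 0) * he + blockD δ _ 0 * hb + blockD δ _ 1 * (hc + ε * hs - hd)
    have T3 : blockC δ i 0 * (blockC γ 0 1 * blockD γ 1 1 - blockD γ 0 1 * blockC γ 1 1)
        - blockC δ i 1 * (blockC γ 0 0 * blockD γ 1 1 - blockD γ 0 1 * blockC γ 1 0)
        + blockD δ i 1 * (blockC γ 0 0 * blockC γ 1 1 - blockC γ 0 1 * blockC γ 1 0) = 0 := by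
      refine (mul_eq_zero.1 (?_ : ε * _ = 0)).resolve_left hε
      fin_cases i <;> simp only [Fin.zero_eta, Fin.mk_one] <;>
      linear_combination (-blockC δ _ 0) * hc + blockC δ _ 1 * hb - blockD δ _ 1 * ha
    have T4 : blockC δ i 0 * (blockC γ 0 1 * blockD γ 1 0 - blockD γ 0 0 * blockC γ 1 1)
        - blockC δ i 1 * (blockC γ 0 0 * blockD γ 1 0 - blockD γ 0 0 * blockC γ 1 0)
        + blockD δ i 0 * (blockC γ 0 0 * blockC γ 1 1 - blockC γ 0 1 * blockC γ 1 0) = 0 := by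
      refine (mul_eq_zero.1 (?_ : ε * _ = 0)).resolve_left hε
      fin_cases i <;> simp only [Fin.zero_eta, Fin.mk_one] <;>
      linear_combination blockC δ _ 0 * hd' - blockC δ _ 1 * (hc + ε * hs - hd) - blockD δ _ 0 * ha
    constructor
    · refine pairing_eq_zero (t₁ := blockC γ 1 0) (t₂ := blockC γ 1 1) (t₃ := blockD γ 1 0)
        (t₄ := blockD γ 1 1) (by linarith) T1 T2 T3 T4 ?_
      rintro ⟨h1, h2, h3, h4, h5, h6⟩
      exact hne ⟨h1, h3, h5, by linarith, h6⟩
    · refine pairing_eq_zero (t₁ := blockC γ 0 0) (t₂ := blockC γ 0 1) (t₃ := blockD γ 0 0)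
        (t₄ := blockD γ 0 1) (by linarith) (by linarith) (by linarith) (by linarith) (by linarith) ?_
      rintro ⟨h1, h2, h3, h4, h5, h6⟩
      exact hne ⟨by linarith, by linarith, by linarith, by linarith, by linarith⟩
  ext i j
  simp only [Matrix.sub_apply, Matrix.mul_apply, Fin.sum_univ_two, Matrix.transpose_apply,
    Matrix.zero_apply]
  fin_cases j
  · have := (main i).1; simp only [Fin.zero_eta]; linarith
  · have := (main i).2; simp only [Fin.mk_one]; linarith

end SiegelTwo
end

/-! ### Every primitive isotropic vector comes from the group -/

noncomputable section
namespace SiegelTwo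
open Matrix

/-- A block matrix in `Sp₄(ℤ)`. -/
def ofBlocks (A B C D : Matrix (Fin 2) (Fin 2) ℤ) (h₁ : A * Bᵀ = B * Aᵀ) (h₂ : C * Dᵀ = D * Cᵀ)
    (h₃ : A * Dᵀ - B * Cᵀ = 1) : Gam :=
  ⟨fromBlocks A B C D, by
    have h₃' := congrArg transpose h₃
    simp only [transpose_sub, transpose_mul, transpose_transpose, transpose_one] at h₃'
    rw [SymplecticGroup.mem_iff]
    simp only [J, fromBlocks_transpose, fromBlocks_multiply]
    congr 1
    · simp [h₁]
    · simp only [mul_zero, mul_one, mul_neg, zero_add, add_zero, neg_mul]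
      rw [← h₃]; abel
    · simp only [mul_zero, mul_one, mul_neg, zero_add, add_zero, neg_mul]
      rw [← h₃']; abel
    · simp [h₂]⟩

theorem blockC_mul_ofBlocks (γ : Gam) (A B C D : Matrix (Fin 2) (Fin 2) ℤ) (h₁ h₂ h₃) :
    blockC (γ * ofBlocks A B C D h₁ h₂ h₃) = blockC γ * A + blockD γ * C := by
  rw [blockC_mul]; simp [ofBlocks, blockC]

theorem blockD_mul_ofBlocks (γ : Gam) (A B C D : Matrix (Fin 2) (Fin 2) ℤ) (h₁ h₂ h₃) :
    blockD (γ * ofBlocks A B C D h₁ h₂ h₃) = blockC γ * B + blockD γ * D := by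
  rw [blockD_mul]; simp [ofBlocks, blockD]

theorem exists_minors_shift (γ : Gam) (s₁ s₂ s₃ : ℤ) :
    ∃ δ, minors δ = (minors γ).shift s₁ s₂ s₃ := by
  have h := symm_rel γ
  refine ⟨γ * ofBlocks 1 !![s₁, s₂; s₂, s₃] 0 1 ?_ ?_ ?_, ?_⟩
  · ext i j; fin_cases i <;> fin_cases j <;> simp
  · simp
  · simp
  · simp only [minors, blockC_mul_ofBlocks, blockD_mul_ofBlocks, IVec.shift]
    ext <;> simp [Matrix.mul_apply, Fin.sum_univ_two] <;> first | ring1 | linear_combination (-s₂) * h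

theorem exists_minors_inversion (γ : Gam) : ∃ δ, minors δ = (minors γ).inversion := by
  refine ⟨γ * ofBlocks 0 (-1) 1 0 ?_ ?_ ?_, ?_⟩
  · simp
  · simp
  · simp
  · simp only [minors, blockC_mul_ofBlocks, blockD_mul_ofBlocks, IVec.inversion]
    ext <;> simp <;> ring

theorem exists_minors_inversionFst (γ : Gam) : ∃ δ, minors δ = (minors γ).inversionFst := by
  refine ⟨γ * ofBlocks !![0, 0; 0, 1] !![-1, 0; 0, 0] !![1, 0; 0, 0] !![0, 0; 0, 1] ?_ ?_ ?_, ?_⟩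
  · decide
  · decide
  · decide
  · simp only [minors, blockC_mul_ofBlocks, blockD_mul_ofBlocks, IVec.inversionFst]
    ext <;> simp [Matrix.mul_apply, Fin.sum_univ_two] <;> ring

theorem exists_minors_inversionLast (γ : Gam) : ∃ δ, minors δ = (minors γ).inversionLast := by
  refine ⟨γ * ofBlocks !![1, 0; 0, 0] !![0, 0; 0, -1] !![0, 0; 0, 1] !![1, 0; 0, 0] ?_ ?_ ?_, ?_⟩
  · decide
  · decide
  · decide
  · simp only [minors, blockC_mul_ofBlocks, blockD_mul_ofBlocks, IVec.inversionLast]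
    ext <;> simp [Matrix.mul_apply, Fin.sum_univ_two] <;> ring

theorem minors_one : minors 1 = ⟨0, 0, 0, 0, 1⟩ := by
  simp [minors, blockC_one, blockD_one]

namespace IVec

/-- The vectors which are, up to sign, the minors of an element of `Sp₄(ℤ)`. -/
def Reach (v : IVec) : Prop := ∃ γ : Gam, minors γ = v ∨ minors γ = v.scale (-1)

theorem Reach.of_shift {v : IVec} (s₁ s₂ s₃ : ℤ) (h : (v.shift s₁ s₂ s₃).Reach) : v.Reach := by
  obtain ⟨γ, h | h⟩ := h <;> obtain ⟨δ, hδ⟩ := exists_minors_shift γ (-s₁) (-s₂) (-s₃)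
  · refine ⟨δ, Or.inl ?_⟩
    rw [hδ, h]
    ext <;> simp only [shift] <;> ring
  · refine ⟨δ, Or.inr ?_⟩
    rw [hδ, h]
    ext <;> simp only [shift, scale] <;> ring

theorem Reach.of_inversion {v : IVec} (h : v.inversion.Reach) : v.Reach := by
  obtain ⟨γ, h | h⟩ := h <;> obtain ⟨δ, hδ⟩ := exists_minors_inversion γ
  · refine ⟨δ, Or.inl ?_⟩
    rw [hδ, h]
    ext <;> simp [inversion]
  · refine ⟨δ, Or.inr ?_⟩
    rw [hδ, h]
    ext <;> simp [inversion, scale]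

/-- This partial inversion has order four, so it is undone by applying it three more times. -/
theorem Reach.of_inversionFst {v : IVec} (h : v.inversionFst.Reach) : v.Reach := by
  obtain ⟨γ, h | h⟩ := h <;> obtain ⟨γ', hγ⟩ := exists_minors_inversionFst γ <;>
    obtain ⟨γ'', hγ'⟩ := exists_minors_inversionFst γ' <;>
    obtain ⟨δ, hδ⟩ := exists_minors_inversionFst γ''
  · refine ⟨δ, Or.inl ?_⟩
    rw [hδ, hγ', hγ, h]
    ext <;> simp [inversionFst]
  · refine ⟨δ, Or.inr ?_⟩
    rw [hδ, hγ', hγ, h]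
    ext <;> simp [inversionFst, scale]

/-- Again the operation has order four. -/
theorem Reach.of_inversionLast {v : IVec} (h : v.inversionLast.Reach) : v.Reach := by
  obtain ⟨γ, h | h⟩ := h <;> obtain ⟨γ', hγ⟩ := exists_minors_inversionLast γ <;>
    obtain ⟨γ'', hγ'⟩ := exists_minors_inversionLast γ' <;>
    obtain ⟨δ, hδ⟩ := exists_minors_inversionLast γ''
  · refine ⟨δ, Or.inl ?_⟩
    rw [hδ, hγ', hγ, h]
    ext <;> simp [inversionLast]
  · refine ⟨δ, Or.inr ?_⟩
    rw [hδ, hγ', hγ, h]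
    ext <;> simp [inversionLast, scale]

theorem exists_two_mul_abs_le (b : ℤ) {a : ℤ} (ha : a ≠ 0) : ∃ s : ℤ, 2 * |b + s * a| ≤ |a| := by
  refine ⟨-round ((b : ℚ) / a), ?_⟩
  have h := abs_sub_round ((b : ℚ) / a)
  have ha' : (0 : ℚ) < |(a : ℚ)| := by positivity
  have h2 : |(b : ℚ) + (-round ((b : ℚ) / a) : ℤ) * a| = |(b : ℚ) / a - round ((b : ℚ) / a)| * |(a : ℚ)| := by
    rw [← abs_mul]
    congr 1
    push_cast
    field_simp
    ring
  have h3 : 2 * |(b : ℚ) + (-round ((b : ℚ) / a) : ℤ) * a| ≤ |(a : ℚ)| := by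
    rw [h2]; nlinarith
  exact_mod_cast h3

/-- Euclidean descent on |a|. Translations bring b, c, d below |a|/2 in absolute value, and then
isotropy gives |e| < |a|. An inversion moves a nonzero one among e, d, b into first place. If all
three vanish, so does c, and primitivity forces a = ±1. -/
theorem Prim.reach_of_ne_zero (n : ℕ) : ∀ v : IVec, v.Iso → v.Prim → v.a.natAbs = n → v.a ≠ 0 →
    v.Reach := by
  induction n using Nat.strong_induction_on with
  | _ n ih =>
    intro v hi hp hn ha
    obtain ⟨s₃, h₃⟩ := exists_two_mul_abs_le v.b ha
    obtain ⟨s₂, h₂⟩ := exists_two_mul_abs_le v.c ha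
    obtain ⟨s₁, h₁⟩ := exists_two_mul_abs_le v.d ha
    apply Reach.of_shift s₁ (-s₂) s₃
    have hi' := hi.shift s₁ (-s₂) s₃
    have hp' := hp.shift s₁ (-s₂) s₃
    set w := v.shift s₁ (-s₂) s₃ with hw
    have wa : w.a = v.a := rfl
    have hb : 2 * |w.b| ≤ |w.a| := h₃
    have hc : 2 * |w.c| ≤ |w.a| := by
      have : w.c = v.c + s₂ * v.a := by simp [hw, IVec.shift]
      rw [this, wa]; exact h₂
    have hd : 2 * |w.d| ≤ |w.a| := h₁
    rw [← wa] at ha hn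
    have hpos : 0 < |w.a| := abs_pos.2 ha
    have he : |w.e| < |w.a| := by
      have h1 : |w.a| * |w.e| ≤ |w.b| * |w.d| + |w.c| * |w.c| := by
        rw [← abs_mul, hi', ← abs_mul, ← abs_mul, pow_two]
        exact abs_sub _ _
      nlinarith [abs_nonneg w.b, abs_nonneg w.c, abs_nonneg w.d]
    by_cases e0 : w.e = 0
    swap
    · apply Reach.of_inversion
      refine ih w.e.natAbs ?_ _ hi'.inversion hp'.inversion rfl e0
      rw [← hn]; zify; exact he
    by_cases d0 : w.d = 0
    swap
    · apply Reach.of_inversionFst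
      refine ih w.d.natAbs ?_ _ hi'.inversionFst hp'.inversionFst rfl d0
      rw [← hn]; zify; linarith [abs_nonneg w.d]
    by_cases b0 : w.b = 0
    swap
    · apply Reach.of_inversionLast
      refine ih w.b.natAbs ?_ _ hi'.inversionLast hp'.inversionLast rfl b0
      rw [← hn]; zify; linarith [abs_nonneg w.b]
    have c0 : w.c = 0 := by
      have : w.a * w.e = w.b * w.d - w.c ^ 2 := hi'
      rw [e0, b0] at this
      have : w.c ^ 2 = 0 := by linarith
      simpa using this
    have hu : IsUnit w.a := hp' w.a dvd_rfl (by simp [b0]) (by simp [c0]) (by simp [d0]) (by simp [e0])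
    apply Reach.of_inversion
    refine ⟨1, ?_⟩
    rw [minors_one]
    rcases Int.isUnit_iff.1 hu with h | h
    · left; ext <;> simp [IVec.inversion, b0, c0, d0, e0, h]
    · right; ext <;> simp [IVec.inversion, IVec.scale, b0, c0, d0, e0, h]

theorem Prim.reach {v : IVec} (hp : v.Prim) (hi : v.Iso) : v.Reach := by
  by_cases a0 : v.a = 0
  swap
  · exact reach_of_ne_zero _ v hi hp rfl a0
  by_cases e0 : v.e = 0
  swap
  · exact Reach.of_inversion (reach_of_ne_zero _ _ hi.inversion hp.inversion rfl e0)
  by_cases d0 : v.d = 0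
  swap
  · exact Reach.of_inversionFst (reach_of_ne_zero _ _ hi.inversionFst hp.inversionFst rfl d0)
  by_cases b0 : v.b = 0
  swap
  · exact Reach.of_inversionLast (reach_of_ne_zero _ _ hi.inversionLast hp.inversionLast rfl b0)
  have c0 : v.c = 0 := by
    have : v.a * v.e = v.b * v.d - v.c ^ 2 := hi
    rw [e0, b0] at this
    have : v.c ^ 2 = 0 := by linarith
    simpa using this
  exact absurd (hp 0 (by simp [a0]) (by simp [b0]) (by simp [c0]) (by simp [d0]) (by simp [e0]))
    not_isUnit_zero

end IVec

end SiegelTwo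
end

/-! ### Cosets as primitive isotropic vectors up to sign -/

noncomputable section
namespace SiegelTwo
open Matrix

namespace IVec

/-- The greatest common divisor of the entries. -/
def content (v : IVec) : ℕ :=
  Int.gcd v.a (Int.gcd v.b (Int.gcd v.c (Int.gcd v.d v.e)))

theorem dvd_content_iff (n : ℕ) (v : IVec) : n ∣ v.content ↔
    (n : ℤ) ∣ v.a ∧ (n : ℤ) ∣ v.b ∧ (n : ℤ) ∣ v.c ∧ (n : ℤ) ∣ v.d ∧ (n : ℤ) ∣ v.e := by
  rw [content, ← Int.natCast_dvd_natCast]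
  simp only [Int.dvd_coe_gcd_iff]

theorem content_scale (m : ℤ) (v : IVec) : (v.scale m).content = m.natAbs * v.content := by
  refine Nat.dvd_antisymm ?_ ?_
  · rcases eq_or_ne m 0 with rfl | hm
    · simp
    have key : ∀ x : ℤ, ((v.scale m).content : ℤ) ∣ m * x → (v.scale m).content ∣ m.natAbs * x.natAbs := by
      intro x hx
      rw [← Int.natAbs_mul]
      exact Int.natCast_dvd.1 hx
    obtain ⟨h1, h2, h3, h4, h5⟩ := (dvd_content_iff _ (v.scale m)).1 dvd_rfl
    simp only [content, Int.gcd, Int.natAbs_natCast]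
    simp only [← Nat.gcd_mul_left]
    exact Nat.dvd_gcd (key _ h1) (Nat.dvd_gcd (key _ h2) (Nat.dvd_gcd (key _ h3)
      (Nat.dvd_gcd (key _ h4) (key _ h5))))
  · obtain ⟨h1, h2, h3, h4, h5⟩ := (dvd_content_iff _ v).1 dvd_rfl
    have key : ∀ x : ℤ, (v.content : ℤ) ∣ x → ((m.natAbs * v.content : ℕ) : ℤ) ∣ m * x := by
      intro x hx
      push_cast
      exact mul_dvd_mul (by simp) hx
    rw [dvd_content_iff]
    exact ⟨key _ h1, key _ h2, key _ h3, key _ h4, key _ h5⟩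

theorem prim_iff (v : IVec) : v.Prim ↔ v.content = 1 := by
  constructor
  · intro h
    obtain ⟨h1, h2, h3, h4, h5⟩ := (dvd_content_iff _ v).1 dvd_rfl
    have := h _ h1 h2 h3 h4 h5
    exact Int.ofNat_isUnit.1 this |> Nat.isUnit_iff.1
  · intro h n h1 h2 h3 h4 h5
    have : n.natAbs ∣ v.content := (dvd_content_iff _ v).2
      ⟨Int.natAbs_dvd.2 h1, Int.natAbs_dvd.2 h2, Int.natAbs_dvd.2 h3, Int.natAbs_dvd.2 h4, Int.natAbs_dvd.2 h5⟩
    rw [h] at this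
    exact Int.isUnit_iff_natAbs_eq.2 (Nat.dvd_one.1 this)

theorem scale_scale (m n : ℤ) (v : IVec) : (v.scale n).scale m = v.scale (m * n) := by
  ext <;> simp [scale, mul_assoc]

theorem scale_one (v : IVec) : v.scale 1 = v := by ext <;> simp [scale]

theorem scale_injective {m : ℤ} (hm : m ≠ 0) {v w : IVec} (h : v.scale m = w.scale m) : v = w := by
  simp only [scale, mk.injEq] at h
  obtain ⟨h1, h2, h3, h4, h5⟩ := h
  ext
  · exact mul_left_cancel₀ hm h1
  · exact mul_left_cancel₀ hm h2
  · exact mul_left_cancel₀ hm h3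
  · exact mul_left_cancel₀ hm h4
  · exact mul_left_cancel₀ hm h5

theorem Iso.scale {v : IVec} (h : v.Iso) (m : ℤ) : (v.scale m).Iso := by
  simp only [Iso, IVec.scale] at *
  linear_combination m ^ 2 * h

theorem Iso.of_scale {v : IVec} {m : ℤ} (hm : m ≠ 0) (h : (v.scale m).Iso) : v.Iso := by
  simp only [Iso, IVec.scale] at *
  refine mul_left_cancel₀ (pow_ne_zero 2 hm) ?_
  linear_combination h

/-- Normalisation of the sign of an isotropic vector. -/
def Pos (v : IVec) : Prop :=
  0 < v.a ∨ (v.a = 0 ∧ 0 ≤ v.b ∧ 0 ≤ v.d ∧ 0 < v.b + v.d) ∨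
    (v.a = 0 ∧ v.b = 0 ∧ v.c = 0 ∧ v.d = 0 ∧ 0 < v.e)

theorem Pos.not_neg {v : IVec} (h : v.Pos) : ¬ (v.scale (-1)).Pos := by
  unfold Pos at *
  simp only [scale]
  omega

theorem Pos.scale {v : IVec} (h : v.Pos) {m : ℤ} (hm : 0 < m) : (v.scale m).Pos := by
  unfold Pos at *
  simp only [IVec.scale]
  rcases h with h | ⟨h1, h2, h3, h4⟩ | ⟨h1, h2, h3, h4, h5⟩
  · left; positivity
  · right; left
    refine ⟨by simp [h1], by positivity, by positivity, ?_⟩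
    rw [← mul_add]; positivity
  · right; right
    simp only [h1, h2, h3, h4, mul_zero, true_and]
    positivity

theorem Pos.of_scale {v : IVec} {m : ℤ} (hm : 0 < m) (h : (v.scale m).Pos) : v.Pos := by
  have hm' := hm.ne'
  unfold Pos at *
  simp only [IVec.scale, ← mul_add, mul_pos_iff_of_pos_left hm, mul_nonneg_iff_of_pos_left hm, mul_eq_zero,
    hm', false_or] at h
  exact h

theorem Prim.pos_or {v : IVec} (hp : v.Prim) (hi : v.Iso) : v.Pos ∨ (v.scale (-1)).Pos := by
  unfold Pos
  simp only [scale]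
  rcases lt_trichotomy v.a 0 with ha | ha | ha
  · right; left; linarith
  · have h1 : v.b * v.d = v.c ^ 2 := by
      have : v.a * v.e = v.b * v.d - v.c ^ 2 := hi
      rw [ha] at this; linarith
    by_cases hbd : v.b = 0 ∧ v.d = 0
    · obtain ⟨hb, hd⟩ := hbd
      have hc : v.c = 0 := by
        rw [hb, zero_mul] at h1
        simpa using h1.symm
      have he : v.e ≠ 0 := by
        intro he
        exact not_isUnit_zero (hp 0 (by simp [ha]) (by simp [hb]) (by simp [hc]) (by simp [hd])
          (by simp [he]))
      rcases lt_or_gt_of_ne he with he | he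
      · right; right; right; simp [ha, hb, hc, hd, he]
      · left; right; right; simp [ha, hb, hc, hd, he]
    · have h2 : 0 ≤ v.b * v.d := by rw [h1]; positivity
      rcases mul_nonneg_iff.1 h2 with ⟨hb, hd⟩ | ⟨hb, hd⟩
      · left; right; left
        refine ⟨ha, hb, hd, ?_⟩
        omega
      · right; right; left
        refine ⟨by simp [ha], by linarith, by linarith, ?_⟩
        omega
  · left; left; exact ha

end IVec

/-- The isotropic vectors of normalised sign. -/
abbrev PosVec : Type := {v : IVec // v.Iso ∧ v.Pos}

open Classical in
/-- The normalised vector of minors of a coset. -/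
def cosetVec (q : Cosets) : IVec :=
  if (minors q.out).Pos then minors q.out else (minors q.out).scale (-1)

theorem cosetVec_eq (q : Cosets) : cosetVec q = (minors q.out).scale 1 ∨
    cosetVec q = (minors q.out).scale (-1) := by
  unfold cosetVec
  split_ifs
  · left; rw [IVec.scale_one]
  · right; rfl

theorem cosetVec_pos (q : Cosets) : (cosetVec q).Pos := by
  unfold cosetVec
  split_ifs with h
  · exact h
  · exact ((minors_prim q.out).pos_or (minors_iso q.out)).resolve_left h

theorem cosetVec_iso (q : Cosets) : (cosetVec q).Iso := by
  rcases cosetVec_eq q with h | h <;> rw [h] <;> exact (minors_iso _).scale _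

theorem cosetVec_content (q : Cosets) : (cosetVec q).content = 1 := by
  rcases cosetVec_eq q with h | h <;> rw [h, IVec.content_scale, (IVec.prim_iff _).1 (minors_prim _)] <;>
  rfl

theorem eq_of_pos_of_scale {v w : IVec} (hv : v.Pos) (hw : w.Pos) {ε : ℤ} (hε : ε = 1 ∨ ε = -1)
    (h : v = w.scale ε) : v = w := by
  rcases hε with rfl | rfl
  · rw [h, IVec.scale_one]
  · exact absurd (h ▸ hv) hw.not_neg

theorem cosetVec_injective {q r : Cosets} (h : cosetVec q = cosetVec r) : q = r := by
  have h1 : ∃ ε : ℤ, ε ≠ 0 ∧ minors r.out = (minors q.out).scale ε := by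
    rcases cosetVec_eq q with hq | hq <;> rcases cosetVec_eq r with hr | hr <;> rw [hq, hr] at h
    · exact ⟨1, one_ne_zero, by rw [h, IVec.scale_one]⟩
    · exact ⟨-1, by norm_num, by rw [← IVec.scale_one (minors q.out), h, IVec.scale_scale]; simp [IVec.scale_one]⟩
    · exact ⟨-1, by norm_num, by rw [h, IVec.scale_one]⟩
    · exact ⟨1, one_ne_zero, by rw [IVec.scale_one]; exact (IVec.scale_injective (by norm_num) h).symm⟩
  obtain ⟨ε, hε, h2⟩ := h1
  have h3 := mem_gamInf_of_minors_eq h2 hε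
  rw [← q.out_eq, ← r.out_eq]
  exact Quotient.sound (QuotientGroup.rightRel_apply.2 h3)

theorem exists_cosetVec_eq {v : IVec} (hp : v.Prim) (hi : v.Iso) (hpos : v.Pos) :
    ∃ q, cosetVec q = v := by
  obtain ⟨γ, hγ⟩ := hp.reach hi
  refine ⟨Quotient.mk _ γ, ?_⟩
  set q : Cosets := Quotient.mk _ γ with hq
  have hγ' : ∃ ε : ℤ, (ε = 1 ∨ ε = -1) ∧ minors γ = v.scale ε := by
    rcases hγ with h | h
    · exact ⟨1, Or.inl rfl, by rw [h, IVec.scale_one]⟩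
    · exact ⟨-1, Or.inr rfl, h⟩
  obtain ⟨ε, hε, h1⟩ := hγ'
  have h2 : γ * q.out⁻¹ ∈ GamInf := by
    refine QuotientGroup.rightRel_apply.1 ?_
    exact Quotient.exact (q.out_eq.trans hq)
  have h3 : q.out = (γ * q.out⁻¹)⁻¹ * γ := by group
  have h4 : q.out * γ⁻¹ ∈ GamInf := by
    have := GamInf.inv_mem h2
    simpa using this
  have h5 : minors q.out = (minors γ).scale (blockD (q.out * γ⁻¹)).det := by
    rw [← minors_left _ _ h4]; simp
  have h6 : (blockD (q.out * γ⁻¹)).det = 1 ∨ (blockD (q.out * γ⁻¹)).det = -1 :=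
    sq_eq_one_iff.1 (det_blockD_sq _ h4)
  obtain ⟨δ, hδ, h7⟩ : ∃ δ : ℤ, (δ = 1 ∨ δ = -1) ∧ cosetVec q = v.scale δ := by
    rw [h1, IVec.scale_scale] at h5
    rcases cosetVec_eq q with h | h <;> rw [h, h5, IVec.scale_scale] <;>
      refine ⟨_, ?_, rfl⟩ <;> rcases hε with rfl | rfl <;> rcases h6 with h | h <;> simp [h]
  exact eq_of_pos_of_scale (cosetVec_pos q) hpos hδ h7

/-- Every isotropic vector of normalised sign is, uniquely, a positive multiple of the vector of a
coset. -/
def posVecEquiv : ℕ+ × Cosets ≃ PosVec :=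
  Equiv.ofBijective
    (fun x => ⟨(cosetVec x.2).scale x.1, (cosetVec_iso x.2).scale _,
      (cosetVec_pos x.2).scale (by exact_mod_cast x.1.pos)⟩) (by
    constructor
    · rintro ⟨m, q⟩ ⟨m', q'⟩ h
      have h1 : (cosetVec q).scale m = (cosetVec q').scale m' := congrArg Subtype.val h
      have h2 := congrArg IVec.content h1
      rw [IVec.content_scale, IVec.content_scale, cosetVec_content, cosetVec_content] at h2
      have h3 : m = m' := by
        apply PNat.eq
        simpa using h2
      subst h3
      rw [cosetVec_injective (IVec.scale_injective (by exact_mod_cast m.ne_zero) h1)]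
    · rintro ⟨v, hi, hpos⟩
      have hc : v.content ≠ 0 := by
        intro h
        have h0 : ∀ n : ℕ, n ∣ v.content := fun n => h ▸ dvd_zero n
        obtain ⟨h1, h2, h3, h4, h5⟩ := (IVec.dvd_content_iff _ v).1 (h0 0)
        simp only [Nat.cast_zero, zero_dvd_iff] at h1 h2 h3 h4 h5
        unfold IVec.Pos at hpos
        omega
      obtain ⟨h1, h2, h3, h4, h5⟩ := (IVec.dvd_content_iff _ v).1 dvd_rfl
      obtain ⟨a, ha⟩ := h1
      obtain ⟨b, hb⟩ := h2
      obtain ⟨c, hc'⟩ := h3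
      obtain ⟨d, hd⟩ := h4
      obtain ⟨e, he⟩ := h5
      set w : IVec := ⟨a, b, c, d, e⟩
      have hv : v = w.scale v.content := by ext <;> simpa [IVec.scale, w]
      have hcz : (0 : ℤ) < v.content := by positivity
      have hw1 : w.content = 1 := by
        have := congrArg IVec.content hv
        rw [IVec.content_scale, Int.natAbs_natCast] at this
        exact (Nat.eq_of_mul_eq_mul_left (Nat.pos_of_ne_zero hc) (by rw [mul_one]; exact this)).symm
      obtain ⟨q, hq⟩ := exists_cosetVec_eq ((IVec.prim_iff w).2 hw1)
        (IVec.Iso.of_scale hcz.ne' (hv ▸ hi)) (IVec.Pos.of_scale hcz (hv ▸ hpos))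
      refine ⟨(⟨v.content, Nat.pos_of_ne_zero hc⟩, q), Subtype.ext ?_⟩
      change (cosetVec q).scale v.content = v
      rw [hq]; exact hv.symm)

theorem posVecEquiv_jval (m : ℕ+) (q : Cosets) (τ z ω : ℂ) :
    (posVecEquiv (m, q)).1.jval τ z ω = m * (cosetVec q).jval τ z ω := by
  refine (IVec.jval_scale m (cosetVec q) τ z ω).trans ?_
  simp

theorem eisensteinTerm_eq (k : ℕ) (hk : Even k) {Z : Matrix (Fin 2) (Fin 2) ℂ} (hZ : Zᵀ = Z)
    (q : Cosets) : eisensteinTerm k hk Z q = (((cosetVec q).jval (Z 0 0) (Z 0 1) (Z 1 1)) ^ k)⁻¹ := by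
  have h1 : eisensteinTerm k hk Z q = 1 / autFactor q.out Z ^ k := by
    conv_lhs => rw [← q.out_eq]
    rfl
  rw [h1, autFactor_eq _ hZ, one_div]
  rcases cosetVec_eq q with h | h <;> rw [h, IVec.jval_scale]
  · simp
  · simp [hk.neg_pow]

theorem summable_eisensteinTerm {k : ℕ} (hk : Even k) {Z : Matrix (Fin 2) (Fin 2) ℂ}
    (hZ : Zᵀ = Z)
    (hs : Summable fun v : PosVec => ((v.1.jval (Z 0 0) (Z 0 1) (Z 1 1)) ^ k)⁻¹) :
    Summable (eisensteinTerm k hk Z) := by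
  have h1 := posVecEquiv.summable_iff.2 hs
  have h2 := h1.prod_factor 1
  refine h2.congr fun q => ?_
  rw [eisensteinTerm_eq k hk hZ]
  rw [Function.comp_apply, posVecEquiv_jval]
  simp

/-- Vectors of content m contribute m^(-k) times the primitive ones; the sum over m is ζ(k). -/
theorem zeta_mul_siegelE {k : ℕ} (hk : Even k) (hk2 : 2 ≤ k) {Z : Matrix (Fin 2) (Fin 2) ℂ}
    (hZ : Zᵀ = Z)
    (hs : Summable fun v : PosVec => ((v.1.jval (Z 0 0) (Z 0 1) (Z 1 1)) ^ k)⁻¹) :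
    riemannZeta k * siegelE k hk Z = ∑' v : PosVec, ((v.1.jval (Z 0 0) (Z 0 1) (Z 1 1)) ^ k)⁻¹ := by
  have h1 := posVecEquiv.summable_iff.2 hs
  have h3 := h1.tsum_prod
  simp only [Function.comp_apply] at h3
  rw [← posVecEquiv.tsum_eq, h3, zeta_nat_eq_tsum_of_gt_one (by omega)]
  have h2 : ∀ m : ℕ+, ∑' q : Cosets, (((posVecEquiv (m, q)).1.jval (Z 0 0) (Z 0 1) (Z 1 1)) ^ k)⁻¹
      = 1 / (m : ℂ) ^ k * siegelE k hk Z := by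
    intro m
    rw [siegelE, ← tsum_mul_left]
    congr 1; ext q
    rw [eisensteinTerm_eq k hk hZ]
    rw [posVecEquiv_jval, mul_pow, mul_inv, one_div]
  refine Eq.trans ?_ (tsum_congr fun m => (h2 m).symm)
  rw [tsum_mul_right]
  congr 1
  have h4 : Summable fun n : ℕ => 1 / (n : ℂ) ^ k := by
    refine Summable.of_norm ?_
    simpa using Real.summable_one_div_nat_pow.2 (by omega : 1 < k)
  rw [← tsum_zero_pnat_eq_tsum_nat h4]
  simp [show k ≠ 0 by omega]

end SiegelTwo
end

/-! ### Counting isotropic symmetric matrices modulo a -/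

noncomputable section
namespace SiegelTwo
open Complex

/-- Isotropic symmetric matrices modulo `a`. -/
def isoMod (a : ℕ) [NeZero a] : Finset (ZMod a × ZMod a × ZMod a) :=
  Finset.univ.filter fun s => s.1 * s.2.2 = s.2.1 ^ 2

theorem mem_isoMod {a : ℕ} [NeZero a] {s : ZMod a × ZMod a × ZMod a} :
    s ∈ isoMod a ↔ s.1 * s.2.2 = s.2.1 ^ 2 := by simp [isoMod]

theorem card_dvd_val_le {a g : ℕ} [NeZero a] (hg : g ∣ a) :
    (Finset.univ.filter fun b : ZMod a => g ∣ b.val).card ≤ a / g := by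
  have hg0 : 0 < g := Nat.pos_of_dvd_of_pos hg (NeZero.pos a)
  refine (Finset.card_le_card_of_injOn (fun b : ZMod a => b.val / g) (t := Finset.range (a / g))
    ?_ ?_).trans (Finset.card_range _).le
  · intro b hb
    simp only [Finset.coe_range, Set.mem_Iio]
    exact Nat.div_lt_div_of_lt_of_dvd hg b.val_lt
  · intro b hb c hc h
    simp only [Finset.coe_filter, Finset.mem_univ, true_and, Set.mem_ofPred_eq] at hb hc
    apply ZMod.val_injective
    rw [← Nat.div_mul_cancel hb, ← Nat.div_mul_cancel hc]
    exact congrArg (· * g) h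

/-- If bd = 0 and g = gcd(a, b), then g divides b and a/g divides d. For each divisor g there are at
most (a/g)·g = a such pairs. -/
theorem card_mul_eq_zero_le (a : ℕ) [NeZero a] :
    (Finset.univ.filter fun x : ZMod a × ZMod a => x.1 * x.2 = 0).card ≤ a * a.divisors.card := by
  have hsub : (Finset.univ.filter fun x : ZMod a × ZMod a => x.1 * x.2 = 0) ⊆
      a.divisors.biUnion fun g => (Finset.univ.filter fun b : ZMod a => g ∣ b.val) ×ˢ
        (Finset.univ.filter fun b : ZMod a => a / g ∣ b.val) := by
    rintro ⟨b, d⟩ h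
    simp only [Finset.mem_filter, Finset.mem_univ, true_and] at h
    simp only [Finset.mem_biUnion, Finset.mem_product, Finset.mem_filter, Finset.mem_univ, true_and,
      Nat.mem_divisors]
    have ha := NeZero.pos a
    refine ⟨a.gcd b.val, ⟨Nat.gcd_dvd_left _ _, ha.ne'⟩, Nat.gcd_dvd_right _ _, ?_⟩
    have h1 : a ∣ b.val * d.val := by
      rw [← ZMod.natCast_eq_zero_iff]
      simpa using h
    have hg : 0 < a.gcd b.val := Nat.gcd_pos_of_pos_left _ ha
    have h2 : a / a.gcd b.val ∣ (b.val / a.gcd b.val) * d.val := by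
      rw [Nat.div_mul_right_comm (Nat.gcd_dvd_right _ _)]
      exact Nat.div_dvd_div (Nat.gcd_dvd_left _ _) h1
    exact (Nat.coprime_div_gcd_div_gcd hg).dvd_of_dvd_mul_left h2
  refine (Finset.card_le_card hsub).trans (Finset.card_biUnion_le.trans ?_)
  rw [mul_comm, ← smul_eq_mul, ← Finset.sum_const]
  refine Finset.sum_le_sum fun g hg => ?_
  have hga := Nat.dvd_of_mem_divisors hg
  rw [Finset.card_product]
  calc _ ≤ a / g * (a / (a / g)) :=
        Nat.mul_le_mul (card_dvd_val_le hga) (card_dvd_val_le (Nat.div_dvd_of_dvd hga))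
    _ = a := Nat.mul_div_cancel' (Nat.div_dvd_of_dvd hga)

/-- For given b and c the solutions d of bd = c² are empty or a coset of the annihilator of b. So
each c contributes at most the number of pairs with bd = 0. -/
theorem card_isoMod_le (a : ℕ) [NeZero a] : (isoMod a).card ≤ a ^ 2 * a.divisors.card := by
  have h1 : (isoMod a).card = ∑ c : ZMod a, ∑ b : ZMod a,
      (Finset.univ.filter fun d : ZMod a => b * d = c ^ 2).card := by
    simp only [Finset.card_filter, isoMod]
    rw [Fintype.sum_prod_type]
    simp only [Fintype.sum_prod_type]
    rw [Finset.sum_comm]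
  have h2 : ∀ b x : ZMod a, (Finset.univ.filter fun d : ZMod a => b * d = x).card ≤
      (Finset.univ.filter fun d : ZMod a => b * d = 0).card := by
    intro b x
    rcases (Finset.univ.filter fun d : ZMod a => b * d = x).eq_empty_or_nonempty with h | ⟨d₀, h⟩
    · rw [h]; simp
    · refine Finset.card_le_card_of_injOn (fun d => d - d₀) ?_ fun _ _ _ _ h => sub_left_injective h
      intro d hd
      simp only [Finset.coe_filter, Finset.mem_univ, true_and, Set.mem_ofPred_eq,
        Finset.mem_filter] at *
      rw [mul_sub, hd, h, sub_self]
  have h3 : ∑ b : ZMod a, (Finset.univ.filter fun d : ZMod a => b * d = 0).card ≤ a * a.divisors.card := by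
    refine le_trans (le_of_eq ?_) (card_mul_eq_zero_le a)
    simp only [Finset.card_filter]
    rw [Fintype.sum_prod_type]
  rw [h1]
  calc _ ≤ ∑ c : ZMod a, a * a.divisors.card :=
        Finset.sum_le_sum fun c _ => (Finset.sum_le_sum fun b _ => h2 b _).trans h3
    _ = _ := by
        rw [Finset.sum_const, Finset.card_univ, ZMod.card, smul_eq_mul]; ring

/-- The terms are at most d(a)/a², with d(a) the number of divisors. Their sum is the square of ∑
n⁻², grouped by products. -/
theorem summable_card_isoMod {k : ℕ} (hk : 4 ≤ k) :
    Summable fun a : ℕ+ => ((isoMod (a : ℕ)).card : ℝ) * ((a : ℝ) ^ k)⁻¹ := by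
  have h1 : Summable fun n : ℕ+ => ((n : ℝ) ^ 2)⁻¹ :=
    (Real.summable_nat_pow_inv.2 (by norm_num : 1 < 2)).comp_injective PNat.coe_injective
  have h2 := h1.mul_of_nonneg h1 (fun _ => by positivity) (fun _ => by positivity)
  have h3 := (sigmaAntidiagonalEquivProd.summable_iff.2 h2).sigma
  refine Summable.of_nonneg_of_le (fun _ => by positivity) (fun a => ?_) h3
  have ha : (1 : ℝ) ≤ a := by exact_mod_cast PNat.pos a
  have h4 : ∑' c : Nat.divisorsAntidiagonal a, ((fun x : ℕ+ × ℕ+ => ((x.1 : ℝ) ^ 2)⁻¹ * ((x.2 : ℝ) ^ 2)⁻¹) ∘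
      sigmaAntidiagonalEquivProd) ⟨a, c⟩ = ((a : ℕ).divisors.card : ℝ) * ((a : ℝ) ^ 2)⁻¹ := by
    have : ∀ c : Nat.divisorsAntidiagonal a, ((fun x : ℕ+ × ℕ+ => ((x.1 : ℝ) ^ 2)⁻¹ * ((x.2 : ℝ) ^ 2)⁻¹) ∘
      sigmaAntidiagonalEquivProd) ⟨a, c⟩ = ((a : ℝ) ^ 2)⁻¹ := by
      intro c
      have hc := divisorsAntidiagonalFactors_eq c
      have hc' : ((divisorsAntidiagonalFactors a c).1 : ℝ) * ((divisorsAntidiagonalFactors a c).2 : ℝ) = a := by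
        have h := congrArg (Nat.cast (R := ℝ)) hc
        rwa [Nat.cast_mul] at h
      change (((divisorsAntidiagonalFactors a c).1 : ℝ) ^ 2)⁻¹ *
        (((divisorsAntidiagonalFactors a c).2 : ℝ) ^ 2)⁻¹ = _
      rw [← mul_inv, ← mul_pow, hc']
    rw [tsum_congr this, tsum_fintype, Finset.sum_const, nsmul_eq_mul]
    congr 2
    rw [Finset.card_univ, Fintype.card_coe]
    rw [← Nat.map_div_right_divisors, Finset.card_map]
  rw [h4]
  have h5 : ((isoMod (a : ℕ)).card : ℝ) ≤ (a : ℝ) ^ 2 * ((a : ℕ).divisors.card : ℝ) := by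
    exact_mod_cast card_isoMod_le a
  calc _ ≤ (a : ℝ) ^ 2 * ((a : ℕ).divisors.card : ℝ) * ((a : ℝ) ^ 4)⁻¹ := by
        gcongr
    _ = _ := by field_simp

end SiegelTwo
end

/-! ### Vectors with a > 0 and the singular series -/

noncomputable section
namespace SiegelTwo
open Complex

/-- Moduli `a` together with an isotropic symmetric matrix modulo `a`. -/
abbrev IsoIdx : Type := Σ a : ℕ+, {s : ZMod (a : ℕ) × ZMod (a : ℕ) × ZMod (a : ℕ) // s ∈ isoMod (a : ℕ)}

/-- The pairing of a half-integral form with an isotropic matrix modulo `a`. -/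
def IsoIdx.dot (p : IsoIdx) (T : ℤ × ℤ × ℤ) : ℤ :=
  T.1 * (p.2.1.1.val : ℤ) + T.2.1 * (p.2.1.2.1.val : ℤ) + T.2.2 * (p.2.1.2.2.val : ℤ)

theorem summable_isoIdx {k : ℕ} (hk : 4 ≤ k) :
    Summable fun p : IsoIdx => ((p.1 : ℝ) ^ k)⁻¹ := by
  refine (summable_sigma_of_nonneg fun p => by positivity).2 ⟨fun a => Summable.of_finite, ?_⟩
  refine (summable_card_isoMod hk).congr fun a => ?_
  rw [tsum_fintype]
  change _ = ∑ _ : {s // s ∈ isoMod (a : ℕ)}, ((a : ℝ) ^ k)⁻¹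
  rw [Finset.sum_const, nsmul_eq_mul, Finset.card_univ, Fintype.card_coe]

/-- The determinant `det (Z + a⁻¹ S + N)`. -/
def isoDet (τ z ω : ℂ) (x : IsoIdx × ℤ × ℤ × ℤ) : ℂ :=
  (τ + ((x.1.2.1.1.val / x.1.1 : ℝ) : ℂ) + x.2.1) * (ω + ((x.1.2.1.2.2.val / x.1.1 : ℝ) : ℂ) + x.2.2.2)
    - (z + ((x.1.2.1.2.1.val / x.1.1 : ℝ) : ℂ) + x.2.2.1) ^ 2

theorem abs_val_div_le {a : ℕ+} (s : ZMod (a : ℕ)) : |(s.val / a : ℝ)| ≤ 1 := by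
  have ha : (0 : ℝ) < a := by exact_mod_cast a.pos
  rw [abs_of_nonneg (by positivity), div_le_one ha]
  exact_mod_cast s.val_lt.le

theorem InH.summable_isoDet {τ z ω : ℂ} (h : InH τ z ω) {k : ℕ} (hk : 4 ≤ k) :
    Summable fun x : IsoIdx × ℤ × ℤ × ℤ => ((x.1.1 : ℂ) ^ k)⁻¹ * (isoDet τ z ω x ^ k)⁻¹ := by
  obtain ⟨C, hC, hb⟩ := h.inv_det_pow_le hk
  have h1 := (summable_isoIdx hk).mul_of_nonneg (summable_latticeBound.mul_left C)
    (fun _ => by positivity) (fun N => mul_nonneg hC.le (latticeBound_nonneg N))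
  refine Summable.of_norm_bounded h1 fun x => ?_
  rw [norm_mul]
  refine mul_le_mul (by simp) ?_ (norm_nonneg _) (by positivity)
  exact hb _ _ _ (abs_val_div_le _) (abs_val_div_le _) (abs_val_div_le _) x.2

theorem ee_trForm_add (T : ℤ × ℤ × ℤ) (τ z ω : ℂ) (p : IsoIdx) :
    ee (trForm T (τ + ((p.2.1.1.val / p.1 : ℝ) : ℂ)) (z + ((p.2.1.2.1.val / p.1 : ℝ) : ℂ))
      (ω + ((p.2.1.2.2.val / p.1 : ℝ) : ℂ))) =
    ee (trForm T τ z ω) * ee ((p.dot T : ℂ) / p.1) := by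
  rw [← ee_add]
  congr 1
  simp only [trForm, IsoIdx.dot]
  push_cast
  ring

theorem norm_ee_ofReal (x : ℝ) : ‖ee x‖ = 1 := by simp [norm_ee]

theorem norm_ee_dot (p : IsoIdx) (T : ℤ × ℤ × ℤ) : ‖ee ((p.dot T : ℂ) / p.1)‖ = 1 := by
  have := norm_ee_ofReal ((p.dot T : ℝ) / p.1)
  push_cast at this
  exact this

/-- The singular series `∑ a⁻ᵏ ∑_S e(tr(TS)/a)`. -/
def singularSeries (k : ℕ) (T : ℤ × ℤ × ℤ) : ℂ :=
  ∑' p : IsoIdx, ((p.1 : ℂ) ^ k)⁻¹ * ee ((p.dot T : ℂ) / p.1)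

/-- For fixed (a, S) this is Lipschitz' formula at Z + S/a. The shift only introduces the phase
e(tr(TS)/a), so the double sum over T and (a, S) converges absolutely and may be regrouped by T. -/
theorem InH.hasSum_isoDet {τ z ω : ℂ} (h : InH τ z ω) {k : ℕ} (hk : 4 ≤ k) :
    HasSum (fun T : ℤ × ℤ × ℤ => lipConst k * lipCoeff k T * singularSeries k T * ee (trForm T τ z ω))
      (∑' x : IsoIdx × ℤ × ℤ × ℤ, ((x.1.1 : ℂ) ^ k)⁻¹ * (isoDet τ z ω x ^ k)⁻¹) := by
  set F : (ℤ × ℤ × ℤ) × IsoIdx → ℂ := fun x => lipConst k * (lipCoeff k x.1 * ee (trForm x.1 τ z ω)) *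
    (((x.2.1 : ℂ) ^ k)⁻¹ * ee ((x.2.dot x.1 : ℂ) / x.2.1)) with hF
  have hs : Summable F := by
    have h1 := ((h.summable_lipCoeff k (by omega)).mul_left ‖(lipConst k : ℂ)‖).mul_of_nonneg
      (summable_isoIdx hk) (fun _ => by positivity) (fun _ => by positivity)
    refine Summable.of_norm_bounded h1 fun x => ?_
    rw [hF]
    simp only [norm_mul, norm_ee_dot, mul_one]
    simp
  have h2 : HasSum (fun T => lipConst k * lipCoeff k T * singularSeries k T * ee (trForm T τ z ω))
      (∑' x, F x) := by
    refine hs.hasSum.prod_fiberwise fun T => ?_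
    have h3 : Summable fun p : IsoIdx => ((p.1 : ℂ) ^ k)⁻¹ * ee ((p.dot T : ℂ) / p.1) := by
      refine Summable.of_norm_bounded (summable_isoIdx hk) fun p => ?_
      rw [norm_mul, norm_ee_dot, mul_one]
      simp
    have h4 := h3.hasSum.mul_left (lipConst k * (lipCoeff k T * ee (trForm T τ z ω)) : ℂ)
    rw [show lipConst k * (lipCoeff k T * ee (trForm T τ z ω)) *
      ∑' p : IsoIdx, ((p.1 : ℂ) ^ k)⁻¹ * ee ((p.dot T : ℂ) / p.1) =
      lipConst k * lipCoeff k T * singularSeries k T * ee (trForm T τ z ω) by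
        rw [singularSeries]; ring] at h4
    exact h4
  convert h2 using 1
  have h4 := ((Equiv.prodComm IsoIdx (ℤ × ℤ × ℤ)).summable_iff.2 hs).tsum_prod
  simp only [Function.comp_apply] at h4
  rw [(h.summable_isoDet hk).tsum_prod, ← (Equiv.prodComm IsoIdx (ℤ × ℤ × ℤ)).tsum_eq, h4]
  refine tsum_congr fun p => ?_
  simp only [isoDet]
  rw [tsum_mul_left]
  rw [(h.add_real (p.2.1.1.val / p.1) (p.2.1.2.1.val / p.1) (p.2.1.2.2.val / p.1)).lipschitz_two hk,
    ← tsum_mul_left, ← tsum_mul_left]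
  refine tsum_congr fun T => ?_
  simp only [hF, Equiv.prodComm_apply, Prod.swap, ee_trForm_add]
  ring

theorem IsoIdx.exists_div (x : IsoIdx × ℤ × ℤ × ℤ) :
    (x.1.1 : ℤ) ∣ (x.1.2.1.2.2.val + x.1.1 * x.2.2.2) * (x.1.2.1.1.val + x.1.1 * x.2.1) -
      (x.1.2.1.2.1.val + x.1.1 * x.2.2.1) ^ 2 := by
  have h := mem_isoMod.1 x.1.2.2
  have := (ZMod.intCast_zmod_eq_zero_iff_dvd ((x.1.2.1.2.2.val + x.1.1 * x.2.2.2) * (x.1.2.1.1.val + x.1.1 * x.2.1) -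
      (x.1.2.1.2.1.val + x.1.1 * x.2.2.1) ^ 2 : ℤ) (x.1.1 : ℕ)).1 (by
    push_cast
    simp [← h]
    ring)
  simpa using this

/-- The isotropic vector with positive first entry attached to `(a, S, N)`. -/
def isoVec (x : IsoIdx × ℤ × ℤ × ℤ) : PosVec :=
  ⟨⟨x.1.1, x.1.2.1.2.2.val + x.1.1 * x.2.2.2, -(x.1.2.1.2.1.val + x.1.1 * x.2.2.1),
    x.1.2.1.1.val + x.1.1 * x.2.1,
    ((x.1.2.1.2.2.val + x.1.1 * x.2.2.2) * (x.1.2.1.1.val + x.1.1 * x.2.1) -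
      (x.1.2.1.2.1.val + x.1.1 * x.2.2.1) ^ 2) / x.1.1⟩, by
    rw [IVec.Iso, neg_sq]
    exact Int.mul_ediv_cancel' (IsoIdx.exists_div x), Or.inl (by simp)⟩

/-- When a is nonzero, isotropy determines e, and this e is exactly the constant term that completes
the expression to a multiple of a determinant. -/
theorem jval_isoVec (τ z ω : ℂ) (x : IsoIdx × ℤ × ℤ × ℤ) :
    (isoVec x).1.jval τ z ω = x.1.1 * isoDet τ z ω x := by
  have ha : ((x.1.1 : ℕ) : ℂ) ≠ 0 := by exact_mod_cast x.1.1.ne_zero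
  have h := (isoVec x).2.1
  have h' : ((isoVec x).1.a : ℂ) * (isoVec x).1.e = (isoVec x).1.b * (isoVec x).1.d - (isoVec x).1.c ^ 2 := by
    exact_mod_cast h
  have he : ((isoVec x).1.e : ℂ) = ((isoVec x).1.b * (isoVec x).1.d - (isoVec x).1.c ^ 2) / x.1.1 := by
    rw [← h']
    simp only [isoVec]
    push_cast
    field_simp
  rw [IVec.jval, he, isoDet]
  simp only [isoVec]
  push_cast
  field_simp
  ring

theorem zmod_val_add_mul_inj {a : ℕ} [NeZero a] {s t : ZMod a} {m n : ℤ}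
    (h : (s.val : ℤ) + a * m = t.val + a * n) : s = t ∧ m = n := by
  have h1 : s = t := by
    have := congrArg (Int.cast : ℤ → ZMod a) h
    simpa using this
  subst h1
  have ha : (a : ℤ) ≠ 0 := by exact_mod_cast NeZero.ne a
  exact ⟨rfl, mul_left_cancel₀ ha (by linarith)⟩

theorem isoVec_injective : Function.Injective isoVec := by
  rintro ⟨⟨a, ⟨s1, s2, s3⟩, hs⟩, N1, N2, N3⟩ ⟨⟨a', ⟨t1, t2, t3⟩, ht⟩, M1, M2, M3⟩ h
  have h0 := congrArg Subtype.val h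
  simp only [isoVec, IVec.mk.injEq] at h0
  obtain ⟨ha, h3, h2, h1, -⟩ := h0
  have ha' : a = a' := by exact_mod_cast ha
  subst ha'
  obtain ⟨rfl, rfl⟩ := zmod_val_add_mul_inj h3
  obtain ⟨rfl, rfl⟩ := zmod_val_add_mul_inj h1
  obtain ⟨rfl, rfl⟩ := zmod_val_add_mul_inj (neg_injective h2)
  rfl

theorem exists_isoVec {v : PosVec} (hv : 0 < v.1.a) : ∃ x, isoVec x = v := by
  obtain ⟨⟨a, b, c, d, e⟩, hiso, hpos⟩ := v
  simp only at hv
  obtain ⟨a, rfl⟩ : ∃ a' : ℕ+, a = (a' : ℕ) := ⟨⟨a.toNat, by omega⟩, by simp; omega⟩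
  have key : ∀ n : ℤ, (((n : ZMod a).val : ℤ) + (a : ℕ) * (n / (a : ℕ))) = n := by
    intro n
    rw [ZMod.val_intCast]
    exact Int.emod_add_mul_ediv n (a : ℕ)
  refine ⟨⟨⟨a, ⟨((d : ZMod a), ((-c : ℤ) : ZMod a), (b : ZMod a)), ?_⟩⟩, d / (a : ℕ), (-c) / (a : ℕ),
    b / (a : ℕ)⟩, ?_⟩
  · refine mem_isoMod.2 ?_
    have := congrArg (Int.cast : ℤ → ZMod a) hiso
    simp only [Int.cast_mul, Int.cast_natCast, CharP.cast_eq_zero, zero_mul, Int.cast_sub,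
      Int.cast_pow] at this
    simp only [Int.cast_neg]
    linear_combination -this
  · apply Subtype.ext
    simp only [isoVec, key]
    ext <;> simp
    simp only [IVec.Iso] at hiso
    rw [← hiso]
    exact Int.mul_ediv_cancel_left _ (by omega)

end SiegelTwo
end

/-! ### Vectors with a = 0 and (b, c; c, d) of rank one -/

noncomputable section
namespace SiegelTwo
open Complex

/-- Nonzero positive semi-definite integral matrices `(b, c; c, d)` of determinant zero. -/
abbrev RankOne : Type :=
  {t : ℤ × ℤ × ℤ // t.1 * t.2.2 = t.2.1 ^ 2 ∧ 0 ≤ t.1 ∧ 0 ≤ t.2.2 ∧ 0 < t.1 + t.2.2}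

/-- The linear form `bτ + 2 c z + dω`. -/
def RankOne.lin (t : RankOne) (τ z ω : ℂ) : ℂ := t.1.1 * τ + 2 * t.1.2.1 * z + t.1.2.2 * ω

theorem RankOne.one_le_trace (t : RankOne) : (1 : ℝ) ≤ t.1.1 + t.1.2.2 := by
  exact_mod_cast t.2.2.2.2

theorem RankOne.fst_nonneg (t : RankOne) : (0 : ℝ) ≤ t.1.1 := by exact_mod_cast t.2.2.1
theorem RankOne.snd_nonneg (t : RankOne) : (0 : ℝ) ≤ t.1.2.2 := by exact_mod_cast t.2.2.2.1

theorem RankOne.mul_eq (t : RankOne) : (t.1.1 : ℝ) * t.1.2.2 = t.1.2.1 ^ 2 := by exact_mod_cast t.2.1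

/-- A rank one matrix is the square of the vector (√b, ±√d), so its pairing with Im Z is the value
of that form at this vector. -/
theorem InH.exists_le_im_lin {τ z ω : ℂ} (h : InH τ z ω) :
    ∃ ε, 0 < ε ∧ ∀ t : RankOne, ε * (t.1.1 + t.1.2.2) ≤ (t.lin τ z ω).im := by
  obtain ⟨ε, hε, -, -, hq⟩ := exists_le_quadratic h.im_pos h.det_pos
  refine ⟨ε, hε, fun t => ?_⟩
  have hb := t.fst_nonneg
  have hd := t.snd_nonneg
  have h1 := Real.sq_sqrt hb
  have h2 := Real.sq_sqrt hd
  have him : (t.lin τ z ω).im = τ.im * t.1.1 + 2 * z.im * t.1.2.1 + ω.im * t.1.2.2 := by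
    simp [RankOne.lin]
    ring
  rw [him]
  have h3 : (√(t.1.1 : ℝ) * √(t.1.2.2 : ℝ)) ^ 2 = (t.1.2.1 : ℝ) ^ 2 := by
    rw [mul_pow, h1, h2, t.mul_eq]
  rcases sq_eq_sq_iff_eq_or_eq_neg.1 h3 with h4 | h4
  · have := hq √(t.1.1 : ℝ) √(t.1.2.2 : ℝ)
    rw [h1, h2, mul_assoc, h4] at this
    exact this
  · have := hq √(t.1.1 : ℝ) (-√(t.1.2.2 : ℝ))
    rw [neg_sq, h1, h2, mul_assoc, mul_neg, h4, neg_neg] at this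
    exact this

/-- A rank one matrix is determined by its diagonal and a sign. -/
def RankOne.code (t : RankOne) : Bool × ℤ × ℤ := (decide (0 ≤ t.1.2.1), t.1.1, t.1.2.2)

theorem RankOne.code_injective : Function.Injective RankOne.code := by
  rintro ⟨⟨b, c, d⟩, h, hb, hd, hbd⟩ ⟨⟨b', c', d'⟩, h', hb', hd', hbd'⟩ he
  simp only [RankOne.code, Prod.mk.injEq, decide_eq_decide] at he h h'
  obtain ⟨hs, rfl, rfl⟩ := he
  have : c = c' := by
    rcases sq_eq_sq_iff_eq_or_eq_neg.1 (h.symm.trans h') with h1 | h1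
    · exact h1
    · omega
  subst this
  rfl

/-- The imaginary part controls b + d. The linear form is at most M(b + d) in absolute value, hence
also controlled, and e is the difference of two controlled quantities. -/
theorem InH.exists_le_norm_lin {τ z ω : ℂ} (h : InH τ z ω) :
    ∃ c, 0 < c ∧ ∀ (t : RankOne) (e : ℤ), c * (1 + |(t.1.1 : ℝ)|) ≤ ‖t.lin τ z ω + e‖ ∧
      c * (1 + |(t.1.2.2 : ℝ)|) ≤ ‖t.lin τ z ω + e‖ ∧ c * (1 + |(e : ℝ)|) ≤ ‖t.lin τ z ω + e‖ := by
  obtain ⟨ε, hε, hi⟩ := h.exists_le_im_lin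
  set M := ‖τ‖ + ‖z‖ + ‖ω‖ with hM
  have hM0 : 0 ≤ M := by positivity
  refine ⟨min (ε / 2) (ε / (1 + M + ε)), by positivity, fun t e => ?_⟩
  have hb := t.fst_nonneg
  have hd := t.snd_nonneg
  have h1 := t.one_le_trace
  have hw : ε * (t.1.1 + t.1.2.2) ≤ ‖t.lin τ z ω + e‖ := by
    refine (hi t).trans (le_trans (le_of_eq ?_) (Complex.abs_im_le_norm _ |> (le_abs_self _).trans))
    simp
  have hc : |2 * (t.1.2.1 : ℝ)| ≤ t.1.1 + t.1.2.2 := by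
    refine abs_le_of_sq_le_sq ?_ (by linarith)
    nlinarith [t.mul_eq, sq_nonneg ((t.1.1 : ℝ) - t.1.2.2)]
  have hn : ‖t.lin τ z ω‖ ≤ M * (t.1.1 + t.1.2.2) := by
    have n1 : ‖(t.1.1 : ℂ)‖ = t.1.1 := by rw [Complex.norm_intCast, abs_of_nonneg hb]
    have n3 : ‖(t.1.2.2 : ℂ)‖ = t.1.2.2 := by rw [Complex.norm_intCast, abs_of_nonneg hd]
    have n2 : ‖(2 * t.1.2.1 : ℂ)‖ ≤ t.1.1 + t.1.2.2 := by
      have : ((2 * t.1.2.1 : ℤ) : ℂ) = 2 * t.1.2.1 := by push_cast; rfl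
      rw [← this, Complex.norm_intCast]
      push_cast
      exact hc
    have := norm_add₃_le (a := (t.1.1 * τ : ℂ)) (b := 2 * t.1.2.1 * z) (c := t.1.2.2 * ω)
    rw [norm_mul, norm_mul _ z, norm_mul _ ω, n1, n3] at this
    refine this.trans ?_
    nlinarith [mul_le_mul_of_nonneg_right n2 (norm_nonneg z), mul_nonneg hd (norm_nonneg τ),
      mul_nonneg hb (norm_nonneg ω)]
  have he : |(e : ℝ)| ≤ ‖t.lin τ z ω + e‖ + ‖t.lin τ z ω‖ := by
    have := norm_sub_le (t.lin τ z ω + e) (t.lin τ z ω)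
    rwa [add_sub_cancel_left, Complex.norm_intCast] at this
  set W := ‖t.lin τ z ω + e‖
  have hmin := min_le_left (ε / 2) (ε / (1 + M + ε))
  have hmin' := min_le_right (ε / 2) (ε / (1 + M + ε))
  rw [abs_of_nonneg hb, abs_of_nonneg hd]
  refine ⟨?_, ?_, ?_⟩
  · refine (mul_le_mul_of_nonneg_right hmin (by positivity)).trans ?_
    nlinarith
  · refine (mul_le_mul_of_nonneg_right hmin (by positivity)).trans ?_
    nlinarith
  · refine (mul_le_mul_of_nonneg_right hmin' (by positivity)).trans ?_
    rw [div_mul_eq_mul_div, div_le_iff₀ (by positivity)]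
    nlinarith

theorem InH.summable_rankOne {τ z ω : ℂ} (h : InH τ z ω) {k : ℕ} (hk : 4 ≤ k) :
    Summable fun x : RankOne × ℤ => ((x.1.lin τ z ω + x.2) ^ k)⁻¹ := by
  obtain ⟨c, hc, hb⟩ := h.exists_le_norm_lin
  have h1 : Summable fun y : Bool × ℤ × ℤ × ℤ => latticeBound y.2 := by
    have : Summable fun _ : Bool => (1 : ℝ) := Summable.of_finite
    simpa using this.mul_of_nonneg summable_latticeBound (fun _ => by simp) latticeBound_nonneg
  have hinj : Function.Injective fun x : RankOne × ℤ => (x.1.code.1, x.1.code.2.1, x.1.code.2.2, x.2) := by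
    rintro ⟨t, e⟩ ⟨t', e'⟩ hx
    simp only [Prod.mk.injEq] at hx
    obtain ⟨h1, h2, h3, rfl⟩ := hx
    rw [RankOne.code_injective (Prod.ext h1 (Prod.ext h2 h3))]
  refine Summable.of_norm_bounded ((h1.comp_injective hinj).mul_left (c ^ k)⁻¹) fun x => ?_
  rw [norm_inv, norm_pow]
  obtain ⟨b1, b2, b3⟩ := hb x.1 x.2
  exact inv_pow_le_of_three hk hc (by simp) (by simp) (by simp) b1 b2 b3

/-- The form `T = m (b, c; c, d)`, recorded as `(n, r, m)`. -/
def rankOneForm (y : RankOne × ℕ+) : ℤ × ℤ × ℤ := (y.2 * y.1.1.1, y.2 * (2 * y.1.1.2.1), y.2 * y.1.1.2.2)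

theorem trForm_rankOneForm (y : RankOne × ℕ+) (τ z ω : ℂ) :
    trForm (rankOneForm y) τ z ω = y.2 * y.1.lin τ z ω := by
  simp only [trForm, rankOneForm, RankOne.lin]
  push_cast
  ring

theorem tsum_expRamp {k : ℕ} (hk : 2 ≤ k) (σ : ℂ) :
    ∑' m : ℤ, expRamp k (-I * σ) m = ∑' m : ℕ+, (m : ℂ) ^ (k - 1) * ee (m * σ) := by
  have hinj : Function.Injective fun m : ℕ+ => (m : ℤ) := fun a b h => by
    simpa using h
  rw [← hinj.tsum_eq]
  · refine tsum_congr fun m => ?_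
    rw [expRamp_neg_I_mul]
    have : max ((m : ℤ) : ℝ) 0 = (m : ℕ) := by simp
    rw [this, show (k : ℝ) - 1 = ((k - 1 : ℕ) : ℝ) by rw [Nat.cast_sub (by omega)]; simp, Real.rpow_natCast]
    push_cast
    rfl
  · intro m hm
    by_contra hr
    refine hm ?_
    have : m ≤ 0 := by
      by_contra hlt
      exact hr ⟨⟨m.toNat, by omega⟩, by simp; omega⟩
    exact expRamp_of_nonpos (by exact_mod_cast (by omega : 1 < k)) _ (by exact_mod_cast this)

theorem InH.summable_rankOneForm {τ z ω : ℂ} (h : InH τ z ω) (k : ℕ) :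
    Summable fun y : RankOne × ℕ+ => (y.2 : ℂ) ^ k * ee (trForm (rankOneForm y) τ z ω) := by
  obtain ⟨ε, hε, hi⟩ := h.exists_le_im_lin
  have hp : 0 < Real.pi * ε := by positivity
  have h1 : Summable fun y : (Bool × ℤ × ℤ) × ℤ => Real.exp (-(Real.pi * ε * |(y.1.2.1 : ℝ)|)) *
      Real.exp (-(Real.pi * ε * |(y.1.2.2 : ℝ)|)) * (|(y.2 : ℝ)| ^ k * Real.exp (-(Real.pi * ε * |(y.2 : ℝ)|))) := by
    have h2 : Summable fun _ : Bool => (1 : ℝ) := Summable.of_finite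
    have h3 := (summable_int_exp hp).mul_of_nonneg (summable_int_exp hp) (fun _ => by positivity)
      (fun _ => by positivity)
    have h4 := h2.mul_of_nonneg h3 (fun _ => by simp) (fun _ => by positivity)
    have h5 := h4.mul_of_nonneg (summable_int_pow_mul_exp k hp) (fun _ => by positivity)
      (fun _ => by positivity)
    simpa only [one_mul] using h5
  have hinj : Function.Injective fun x : RankOne × ℕ+ => (x.1.code, (x.2 : ℤ)) := by
    rintro ⟨t, e⟩ ⟨t', e'⟩ hx
    simp only [Prod.mk.injEq, Nat.cast_inj, PNat.coe_inj] at hx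
    obtain ⟨h1, rfl⟩ := hx
    rw [RankOne.code_injective h1]
  refine Summable.of_norm_bounded (h1.comp_injective hinj) fun y => ?_
  have hb := y.1.fst_nonneg
  have hd := y.1.snd_nonneg
  have ht := y.1.one_le_trace
  have hm : (1 : ℝ) ≤ (y.2 : ℝ) := by exact_mod_cast PNat.pos y.2
  have hi' := hi y.1
  have key : -(2 * Real.pi * (y.2 * y.1.lin τ z ω : ℂ).im) ≤
      -(Real.pi * ε * y.1.1.1) + -(Real.pi * ε * y.1.1.2.2) + -(Real.pi * ε * y.2) := by
    have e1 : (y.2 * y.1.lin τ z ω : ℂ).im = y.2 * (y.1.lin τ z ω).im := by simp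
    rw [e1]
    have e2 : ε * ((y.1.1.1 + y.1.1.2.2) + y.2) ≤ 2 * (y.2 * (y.1.lin τ z ω).im) := by
      have e3 : (y.2 : ℝ) * (ε * (y.1.1.1 + y.1.1.2.2)) ≤ y.2 * (y.1.lin τ z ω).im := by gcongr
      have e4 : ((y.1.1.1 + y.1.1.2.2) + y.2 : ℝ) ≤ 2 * (y.2 * (y.1.1.1 + y.1.1.2.2)) := by
        nlinarith [mul_nonneg (sub_nonneg.2 hm) (sub_nonneg.2 ht)]
      nlinarith [mul_le_mul_of_nonneg_left e4 hε.le]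
    nlinarith [mul_le_mul_of_nonneg_left e2 Real.pi_pos.le]
  rw [norm_mul, norm_ee, trForm_rankOneForm]
  simp only [Function.comp_apply, RankOne.code, Int.cast_natCast, Nat.abs_cast, abs_of_nonneg hb, abs_of_nonneg hd]
  rw [norm_pow, Complex.norm_natCast, mul_left_comm, ← Real.exp_add, ← Real.exp_add]
  exact mul_le_mul_of_nonneg_left (Real.exp_le_exp.2 key) (by positivity)

/-- The divisor-type sum `∑ mᵏ⁻¹` over the `m` dividing `T`, for `T` of rank one. -/
def rankOneCoeff (k : ℕ) (T : ℤ × ℤ × ℤ) : ℂ :=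
  ∑' y : {y : RankOne × ℕ+ // rankOneForm y = T}, (y.1.2 : ℂ) ^ (k - 1)

/-- The multiplier is at most the trace of T, and together with T it determines the matrix. -/
theorem finite_rankOneForm_fiber (T : ℤ × ℤ × ℤ) : Finite {y : RankOne × ℕ+ // rankOneForm y = T} := by
  refine Finite.of_injective (β := Fin ((T.1 + T.2.2).toNat + 1))
    (fun y => ⟨y.1.2, ?_⟩) ?_
  · obtain ⟨⟨t, m⟩, rfl⟩ := y
    simp only [rankOneForm]
    have h1 := t.2.2.2.2
    have h2 : (1 : ℤ) ≤ m := by exact_mod_cast PNat.pos m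
    have : (m : ℤ) ≤ m * t.1.1 + m * t.1.2.2 := by nlinarith
    omega
  · rintro ⟨⟨⟨⟨b, c, d⟩, h⟩, m⟩, rfl⟩ ⟨⟨⟨⟨b', c', d'⟩, h'⟩, m'⟩, hy⟩ he
    simp only [Fin.mk.injEq, PNat.coe_inj] at he
    subst he
    have hm : (m : ℤ) ≠ 0 := by exact_mod_cast PNat.ne_zero m
    simp only [rankOneForm, Prod.mk.injEq, mul_eq_mul_left_iff, hm, or_false, OfNat.ofNat_ne_zero] at hy
    obtain ⟨rfl, rfl, rfl⟩ := hy
    rfl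

theorem exists_int_rankOneCoeff (k : ℕ) (T : ℤ × ℤ × ℤ) : ∃ n : ℤ, rankOneCoeff k T = n := by
  have := finite_rankOneForm_fiber T
  have := Fintype.ofFinite {y : RankOne × ℕ+ // rankOneForm y = T}
  refine ⟨∑ y : {y : RankOne × ℕ+ // rankOneForm y = T}, (y.1.2 : ℤ) ^ (k - 1), ?_⟩
  rw [rankOneCoeff, tsum_fintype]
  push_cast
  rfl

/-- The sum over e is Lipschitz' formula in one variable at the point bτ + 2cz + dω. The resulting
exponentials are then collected according to T = m(b, c; c, d). -/
theorem InH.hasSum_rankOne {τ z ω : ℂ} (h : InH τ z ω) {k : ℕ} (hk : 4 ≤ k) :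
    HasSum (fun T => (I ^ k)⁻¹ * ((2 * Real.pi) ^ k / Real.Gamma k : ℝ) * rankOneCoeff k T *
      ee (trForm T τ z ω)) (∑' x : RankOne × ℤ, ((x.1.lin τ z ω + x.2) ^ k)⁻¹) := by
  have hs := h.summable_rankOneForm (k - 1)
  obtain ⟨ε, hε, hi⟩ := h.exists_le_im_lin
  have e1 : ∑' x : RankOne × ℤ, ((x.1.lin τ z ω + x.2) ^ k)⁻¹ =
      (I ^ k)⁻¹ * ((2 * Real.pi) ^ k / Real.Gamma k : ℝ) *
        ∑' y : RankOne × ℕ+, (y.2 : ℂ) ^ (k - 1) * ee (trForm (rankOneForm y) τ z ω) := by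
    rw [(h.summable_rankOne hk).tsum_prod, hs.tsum_prod, ← tsum_mul_left]
    refine tsum_congr fun t => ?_
    have him : 0 < (t.lin τ z ω).im :=
      lt_of_lt_of_le (mul_pos hε (by linarith [t.one_le_trace])) (hi t)
    simp only [trForm_rankOneForm]
    rw [lipschitz_inv_pow (by omega) him, tsum_expRamp (by omega)]
  rw [e1]
  simp only [mul_assoc]
  refine HasSum.mul_left _ (HasSum.mul_left _ ?_)
  have h2 := (Equiv.sigmaFiberEquiv rankOneForm).hasSum_iff.2 hs.hasSum
  refine h2.sigma fun T => ?_
  have := finite_rankOneForm_fiber T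
  have h3 : Summable fun y : {y : RankOne × ℕ+ // rankOneForm y = T} => (y.1.2 : ℂ) ^ (k - 1) :=
    Summable.of_finite
  have h4 := h3.hasSum.mul_right (ee (trForm T τ z ω))
  have h5 : (fun y : {y : RankOne × ℕ+ // rankOneForm y = T} => (y.1.2 : ℂ) ^ (k - 1) *
      ee (trForm T τ z ω)) = fun y => (y.1.2 : ℂ) ^ (k - 1) * ee (trForm (rankOneForm y.1) τ z ω) := by
    funext ⟨y, hy⟩
    rw [hy]
  rw [h5] at h4
  exact h4

end SiegelTwo
end

/-! ### The Fourier expansion of G_k -/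

noncomputable section
namespace SiegelTwo
open Complex Matrix

/-- The vector `(0, b, c, d, e)` with `(b, c; c, d)` of rank one. -/
def rankOneVec (x : RankOne × ℤ) : PosVec :=
  ⟨⟨0, x.1.1.1, x.1.1.2.1, x.1.1.2.2, x.2⟩, by simp [IVec.Iso, x.1.2.1],
    Or.inr (Or.inl ⟨rfl, x.1.2.2⟩)⟩

/-- The vector `(0, 0, 0, 0, e)`. -/
def lastVec (e : ℕ+) : PosVec :=
  ⟨⟨0, 0, 0, 0, e⟩, by simp [IVec.Iso], Or.inr (Or.inr ⟨rfl, rfl, rfl, rfl, by simp⟩)⟩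

theorem rankOneVec_injective : Function.Injective rankOneVec := by
  rintro ⟨⟨⟨b, c, d⟩, h⟩, e⟩ ⟨⟨⟨b', c', d'⟩, h'⟩, e'⟩ he
  have h0 := congrArg Subtype.val he
  simp only [rankOneVec, IVec.mk.injEq] at h0
  obtain ⟨-, rfl, rfl, rfl, rfl⟩ := h0
  rfl

theorem lastVec_injective : Function.Injective lastVec := by
  intro e e' he
  have h0 := congrArg Subtype.val he
  simpa only [lastVec, IVec.mk.injEq, true_and, Nat.cast_inj, PNat.coe_inj] using h0

/-- Isotropic vectors up to sign, by the rank of the associated block. -/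
def posVecSum : (IsoIdx × ℤ × ℤ × ℤ) ⊕ ((RankOne × ℤ) ⊕ ℕ+) ≃ PosVec :=
  Equiv.ofBijective (Sum.elim isoVec (Sum.elim rankOneVec lastVec)) (by
    constructor
    · refine isoVec_injective.sumElim (rankOneVec_injective.sumElim lastVec_injective ?_) ?_
      · intro x e he
        have h0 := congrArg (fun v : PosVec => v.1.b + v.1.d) he
        have := x.1.2.2.2.2
        simp only [rankOneVec, lastVec] at h0
        omega
      · rintro x (y | y) he
        all_goals
          have h0 := congrArg (fun v : PosVec => v.1.a) he
          have h1 := x.1.1.ne_zero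
          simp [isoVec, rankOneVec, lastVec] at h0
    · intro v
      rcases v.2.2 with h | ⟨h1, h2, h3, h4⟩ | ⟨h1, h2, h3, h4, h5⟩
      · obtain ⟨x, rfl⟩ := exists_isoVec h
        exact ⟨Sum.inl x, rfl⟩
      · refine ⟨Sum.inr (Sum.inl (⟨⟨v.1.b, v.1.c, v.1.d⟩, ?_, h2, h3, h4⟩, v.1.e)), ?_⟩
        · have := v.2.1
          rw [IVec.Iso, h1, zero_mul] at this
          linarith
        · apply Subtype.ext
          ext <;> simp [rankOneVec, h1]
      · refine ⟨Sum.inr (Sum.inr ⟨v.1.e.toNat, by omega⟩), ?_⟩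
        apply Subtype.ext
        change (lastVec _).1 = _
        ext <;> simp [lastVec, h1, h2, h3, h4, h5.le])

theorem hasSum_congr_fun {β : Type*} {f g : β → ℂ} {a : ℂ} (h : ∀ x, f x = g x) :
    HasSum f a ↔ HasSum g a := by rw [funext h]

theorem tsum_pnat_inv_pow {k : ℕ} (hk : 2 ≤ k) :
    HasSum (fun e : ℕ+ => ((e : ℂ) ^ k)⁻¹) (riemannZeta k) := by
  have h4 : Summable fun n : ℕ => 1 / (n : ℂ) ^ k := by
    refine Summable.of_norm ?_
    simpa using Real.summable_one_div_nat_pow.2 (by omega : 1 < k)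
  rw [zeta_nat_eq_tsum_of_gt_one (by omega), ← tsum_zero_pnat_eq_tsum_nat h4]
  have h5 := (h4.comp_injective PNat.coe_injective).hasSum
  simp only [Function.comp_def, one_div] at h5
  simpa [show k ≠ 0 by omega] using h5

/-- The Fourier coefficients of `ζ(k) E_k`. -/
def zetaCoeff (k : ℕ) (T : ℤ × ℤ × ℤ) : ℂ :=
  lipConst k * lipCoeff k T * singularSeries k T +
    ((I ^ k)⁻¹ * ((2 * Real.pi) ^ k / Real.Gamma k : ℝ) * rankOneCoeff k T +
    if T = 0 then riemannZeta k else 0)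

theorem InH.hasSum_posVec {τ z ω : ℂ} (h : InH τ z ω) {k : ℕ} (hk : 4 ≤ k) :
    ∃ s, HasSum (fun v : PosVec => (v.1.jval τ z ω ^ k)⁻¹) s ∧
      HasSum (fun T => zetaCoeff k T * ee (trForm T τ z ω)) s := by
  have hA := (h.summable_isoDet hk).hasSum
  have hB := (h.summable_rankOne hk).hasSum
  have hC := tsum_pnat_inv_pow (k := k) (by omega)
  have h1 : HasSum ((fun v : PosVec => (v.1.jval τ z ω ^ k)⁻¹) ∘ posVecSum)
      ((∑' x : IsoIdx × ℤ × ℤ × ℤ, ((x.1.1 : ℂ) ^ k)⁻¹ * (isoDet τ z ω x ^ k)⁻¹) +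
        ((∑' x : RankOne × ℤ, ((x.1.lin τ z ω + x.2) ^ k)⁻¹) + riemannZeta k)) := by
    refine HasSum.sum ?_ (HasSum.sum ?_ ?_)
    · refine (hasSum_congr_fun fun x => ?_).1 hA
      change _ = ((isoVec x).1.jval τ z ω ^ k)⁻¹
      rw [jval_isoVec, mul_pow, mul_inv]
    · refine (hasSum_congr_fun fun x => ?_).1 hB
      change _ = ((rankOneVec x).1.jval τ z ω ^ k)⁻¹
      simp [rankOneVec, IVec.jval, RankOne.lin]
    · refine (hasSum_congr_fun fun x => ?_).1 hC
      change _ = ((lastVec x).1.jval τ z ω ^ k)⁻¹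
      simp [lastVec, IVec.jval]
  refine ⟨_, posVecSum.hasSum_iff.1 h1, ?_⟩
  · simp only [zetaCoeff, add_mul]
    refine (h.hasSum_isoDet hk).add ((h.hasSum_rankOne hk).add ?_)
    refine (hasSum_congr_fun fun T => ?_).1 (hasSum_ite_eq (0 : ℤ × ℤ × ℤ) (riemannZeta k))
    split_ifs with hT
    · subst hT
      simp [trForm, ee_zero]
    · simp

theorem inH_of_mem {Z : Matrix (Fin 2) (Fin 2) ℂ} (hZ : Z ∈ upperHalfSpace) :
    InH (Z 0 0) (Z 0 1) (Z 1 1) := by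
  obtain ⟨hs, hp⟩ := hZ
  have h1 : Z 1 0 = Z 0 1 := congrFun (congrFun hs 0) 1
  refine ⟨by simpa using hp.diag_pos (i := 0), ?_⟩
  have := hp.det_pos
  rw [Matrix.det_fin_two] at this
  simp only [Matrix.map_apply, h1] at this
  nlinarith

/-- The entries `(n, r, m)` of `T = (n, r/2; r/2, m)`. -/
def entries (T : halfIntegral) : ℤ × ℤ × ℤ := (⌊T.1 0 0⌋, ⌊2 * T.1 0 1⌋, ⌊T.1 1 1⌋)

theorem entries_fst (T : halfIntegral) : ((entries T).1 : ℝ) = T.1 0 0 := by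
  obtain ⟨n, hn⟩ := T.2.2.1 0
  simp [entries, hn]

theorem entries_snd (T : halfIntegral) : ((entries T).2.1 : ℝ) = 2 * T.1 0 1 := by
  obtain ⟨n, hn⟩ := T.2.2.2 0 1
  simp [entries, hn]

theorem entries_last (T : halfIntegral) : ((entries T).2.2 : ℝ) = T.1 1 1 := by
  obtain ⟨n, hn⟩ := T.2.2.1 1
  simp [entries, hn]

theorem symm_halfIntegral (T : halfIntegral) : T.1 1 0 = T.1 0 1 := by
  have := T.2.1.1.apply 0 1
  simpa using this

theorem entries_injective : Function.Injective entries := by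
  intro T S h
  have h1 := entries_fst T
  have h2 := entries_snd T
  have h3 := entries_last T
  rw [h, entries_fst S] at h1
  rw [h, entries_snd S] at h2
  rw [h, entries_last S] at h3
  apply Subtype.ext
  ext i j
  fin_cases i <;> fin_cases j
  · exact h1.symm
  · change T.1 0 1 = S.1 0 1
    linarith
  · change T.1 1 0 = S.1 1 0
    rw [symm_halfIntegral T, symm_halfIntegral S]
    linarith
  · exact h3.symm

theorem exists_entries_eq {T : ℤ × ℤ × ℤ} (h1 : 0 ≤ T.1) (h2 : 0 ≤ T.2.2)
    (h3 : T.2.1 ^ 2 ≤ 4 * (T.1 * T.2.2)) : ∃ S : halfIntegral, (entries S) = T := by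
  obtain ⟨n, r, m⟩ := T
  simp only at h1 h2 h3
  refine ⟨⟨!![(n : ℝ), r / 2; r / 2, m], ?_, ?_, ?_⟩, ?_⟩
  · refine Matrix.PosSemidef.of_dotProduct_mulVec_nonneg ?_ fun x => ?_
    · ext i j
      fin_cases i <;> fin_cases j <;> simp
    · simp only [Matrix.mulVec, dotProduct, Fin.sum_univ_two, Pi.star_apply, star_trivial]
      simp
      have a1 : (0 : ℝ) ≤ n := by exact_mod_cast h1
      have a2 : (0 : ℝ) ≤ m := by exact_mod_cast h2
      have a3 : (r : ℝ) ^ 2 ≤ 4 * (n * m) := by exact_mod_cast h3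
      rcases a1.eq_or_lt with h | h
      · rw [← h] at a3 ⊢
        have : (r : ℝ) = 0 := by nlinarith
        rw [this]
        nlinarith [mul_nonneg a2 (sq_nonneg (x 1))]
      · have : 0 ≤ n * (x 0 * (n * x 0 + r / 2 * x 1) + x 1 * (r / 2 * x 0 + m * x 1)) := by
          nlinarith [sq_nonneg (n * x 0 + r / 2 * x 1), mul_nonneg (sub_nonneg.2 a3) (sq_nonneg (x 1))]
        exact nonneg_of_mul_nonneg_right this h
  · intro i
    fin_cases i
    · exact ⟨n, rfl⟩
    · exact ⟨m, rfl⟩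
  · intro i j
    fin_cases i <;> fin_cases j
    · exact ⟨2 * n, by simp⟩
    · exact ⟨r, by simp; ring⟩
    · exact ⟨r, by simp; ring⟩
    · exact ⟨2 * m, by simp⟩
  · simp [entries]
    rw [mul_div_cancel₀ _ (by norm_num : (2 : ℝ) ≠ 0)]
    simp

theorem qPow_eq (T : halfIntegral) {Z : Matrix (Fin 2) (Fin 2) ℂ} (hZ : Zᵀ = Z) :
    qPow T.1 Z = ee (trForm (entries T) (Z 0 0) (Z 0 1) (Z 1 1)) := by
  have h1 : Z 1 0 = Z 0 1 := congrFun (congrFun hZ 0) 1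
  have e1 : ((entries T).1 : ℂ) = (T.1 0 0 : ℝ) := by rw [← entries_fst T]; simp
  have e2 : ((entries T).2.1 : ℂ) = (2 * T.1 0 1 : ℝ) := by rw [← entries_snd T]; simp
  have e3 : ((entries T).2.2 : ℂ) = (T.1 1 1 : ℝ) := by rw [← entries_last T]; simp
  rw [qPow, ee, trForm, e1, e2, e3, Matrix.trace_fin_two]
  simp only [Matrix.mul_apply, Fin.sum_univ_two, Matrix.map_apply, symm_halfIntegral T, h1]
  congr 1
  push_cast
  ring

/-- The expansion over ℤ³ is supported on positive semi-definite forms, so it can be reindexed by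
`halfIntegral`. -/
theorem zetaCoeff_eq_zero {k : ℕ} (hk : 2 ≤ k) {T : ℤ × ℤ × ℤ}
    (hT : T ∉ Set.range entries) : zetaCoeff k T = 0 := by
  have h1 : lipCoeff k T = 0 := by
    by_contra hne
    rw [lipCoeff] at hne
    split_ifs at hne with h0
    · refine hT (exists_entries_eq h0.le ?_ ?_)
      all_goals
        by_contra hlt
        refine hne ?_
        rw [max_eq_right, Real.zero_rpow]
        · have : (2 : ℝ) ≤ k := by exact_mod_cast hk
          linarith
      · have h2 : (T.2.2 : ℝ) ≤ 0 := by exact_mod_cast (not_le.1 hlt).le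
        have h3 : (0 : ℝ) ≤ T.1 := by exact_mod_cast h0.le
        nlinarith [mul_nonneg h3 (neg_nonneg.2 h2), sq_nonneg (T.2.1 : ℝ)]
      · have h2 : (4 * (T.1 * T.2.2) : ℝ) ≤ T.2.1 ^ 2 := by exact_mod_cast (not_le.1 hlt).le
        linarith
    · exact hne rfl
  have h2 : rankOneCoeff k T = 0 := by
    have : IsEmpty {y : RankOne × ℕ+ // rankOneForm y = T} := by
      refine ⟨fun ⟨y, hy⟩ => hT ?_⟩
      have hm : (0 : ℤ) ≤ y.2 := by positivity
      obtain ⟨g1, g2, g3, -⟩ := y.1.2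
      subst hy
      refine exists_entries_eq (mul_nonneg hm g2) (mul_nonneg hm g3) (le_of_eq ?_)
      simp only [rankOneForm]
      linear_combination (-4 * (y.2 : ℤ) ^ 2) * g1
    rw [rankOneCoeff, tsum_empty]
  have h3 : T ≠ 0 := fun h => hT (exists_entries_eq (by simp [h]) (by simp [h]) (by simp [h]))
  simp [zetaCoeff, h1, h2, h3]

/-- The Fourier coefficients of `G_k`. -/
def siegelCoeff (k : ℕ) (T : ℤ × ℤ × ℤ) : ℂ :=
  1 / 2 * riemannZeta (1 - (k : ℂ)) * riemannZeta (3 - 2 * (k : ℂ)) / riemannZeta k * zetaCoeff k T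

theorem summable_eisensteinTerm_of_mem {k : ℕ} (hk : Even k) (hk4 : 4 ≤ k) {Z : Matrix (Fin 2) (Fin 2) ℂ}
    (hZ : Z ∈ upperHalfSpace) : Summable (eisensteinTerm k hk Z) := by
  obtain ⟨s, hs, -⟩ := (inH_of_mem hZ).hasSum_posVec hk4
  exact summable_eisensteinTerm hk hZ.1 hs.summable

theorem hasFourierExpansion_siegelG {k : ℕ} (hk : Even k) (hk4 : 4 ≤ k) :
    HasFourierExpansion (siegelG k hk) fun T => siegelCoeff k (entries T) := by
  intro Z hZ
  obtain ⟨s, hs, hf⟩ := (inH_of_mem hZ).hasSum_posVec hk4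
  have h1 := zeta_mul_siegelE hk (by omega) hZ.1 hs.summable
  rw [hs.tsum_eq] at h1
  have hz : riemannZeta k ≠ 0 := riemannZeta_ne_zero_of_one_lt_re (by
    rw [natCast_re]
    exact_mod_cast (by omega : 1 < k))
  have h2 := (entries_injective.hasSum_iff (fun T hT => by
    rw [zetaCoeff_eq_zero (by omega) hT, zero_mul])).2 hf
  have h3 := h2.mul_left (1 / 2 * riemannZeta (1 - (k : ℂ)) * riemannZeta (3 - 2 * (k : ℂ)) / riemannZeta k)
  have h4 : siegelG k hk Z =
      1 / 2 * riemannZeta (1 - (k : ℂ)) * riemannZeta (3 - 2 * (k : ℂ)) / riemannZeta k * s := by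
    rw [siegelG, ← h1]
    field_simp
  rw [h4]
  refine (hasSum_congr_fun fun T => ?_).1 h3
  simp only [Function.comp_apply, qPow_eq T hZ.1, siegelCoeff]
  ring

end SiegelTwo
end

/-! ### Uniqueness of Fourier coefficients -/

noncomputable section
namespace SiegelTwo
open Complex

theorem integral_ee_int (m : ℤ) : ∫ x in (0 : ℝ)..1, ee (m * x) = if m = 0 then 1 else 0 := by
  split_ifs with h
  · simp [h, ee_zero]
  · have hc : 2 * Real.pi * I * m ≠ 0 := by
      simp [Real.pi_ne_zero, h]
    have := integral_exp_mul_complex (a := 0) (b := 1) hc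
    rw [show (fun x : ℝ => ee (m * x)) = fun x : ℝ => cexp (2 * Real.pi * I * m * x) by
      funext x; rw [ee]; ring_nf, this]
    have h1 : cexp (2 * Real.pi * I * m * (1 : ℝ)) = 1 := by
      rw [Complex.exp_eq_one_iff]
      exact ⟨m, by push_cast; ring⟩
    rw [h1]
    simp

/-- Multiply by e(-n₀x) and integrate over a period term by term. -/
theorem eq_zero_of_hasSum_ee {c : ℤ → ℂ} (hc : Summable c)
    (h : ∀ x : ℝ, ∑' n, c n * ee (n * x) = 0) (n₀ : ℤ) : c n₀ = 0 := by
  have hcont : ∀ m : ℤ, Continuous fun x : ℝ => ee (m * x) := fun m => by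
    unfold ee
    fun_prop
  have hn : ∀ (m : ℤ) (x : ℝ), ‖ee (m * x)‖ = 1 := fun m x => by
    have := norm_ee_ofReal (m * x)
    push_cast at this
    exact this
  let F : ℤ → C(ℝ, ℂ) := fun n => ⟨fun x => c n * ee (((n - n₀ : ℤ) : ℂ) * x), (hcont (n - n₀)).const_mul _⟩
  have h1 := intervalIntegral.hasSum_intervalIntegral_of_summable_norm (a := 0) (b := 1) (f := F) (by
    refine Summable.of_nonneg_of_le (fun _ => norm_nonneg _) (fun n => ?_) hc.norm
    refine (ContinuousMap.norm_le _ (norm_nonneg _)).2 fun x => ?_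
    change ‖c n * ee (((n - n₀ : ℤ) : ℂ) * (x : ℝ))‖ ≤ _
    rw [norm_mul, hn, mul_one])
  have h2 : ∀ x : ℝ, ∑' n, F n x = 0 := by
    intro x
    have : ∀ n, F n x = c n * ee (n * x) * ee (-n₀ * x) := by
      intro n
      simp only [F, ContinuousMap.coe_mk]
      rw [mul_assoc, ← ee_add]
      push_cast
      ring_nf
    rw [tsum_congr this, tsum_mul_right, h x, zero_mul]
  simp only [h2, intervalIntegral.integral_zero] at h1
  have h3 : ∀ n, ∫ x in (0 : ℝ)..1, F n x = if n = n₀ then c n else 0 := by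
    intro n
    simp only [F, ContinuousMap.coe_mk]
    rw [intervalIntegral.integral_const_mul, integral_ee_int]
    simp [sub_eq_zero]
  simp only [h3] at h1
  have h4 := hasSum_single n₀ (f := fun n => if n = n₀ then c n else 0) (fun n hn => by simp [hn])
  simpa using h4.unique h1

/-- The one-variable statement is applied to x, y and w in turn, with the sums over the remaining
indices as coefficients. -/
theorem eq_zero_of_tsum_ee {c : ℤ × ℤ × ℤ → ℂ} (hc : Summable c)
    (h : ∀ x y w : ℝ, ∑' T, c T * ee (trForm T x y w) = 0) (T : ℤ × ℤ × ℤ) : c T = 0 := by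
  have hn : ∀ (m : ℤ) (x : ℝ), ‖ee (m * x)‖ = 1 := fun m x => by
    have := norm_ee_ofReal (m * x)
    push_cast at this
    exact this
  have hsum : ∀ (y w : ℝ), Summable fun T : ℤ × ℤ × ℤ => c T * (ee (T.2.1 * y) * ee (T.2.2 * w)) := by
    intro y w
    refine Summable.of_norm_bounded hc.norm fun T => ?_
    rw [norm_mul, norm_mul, hn, hn, mul_one, mul_one]
  have h1 : ∀ (n : ℤ) (y w : ℝ), ∑' p : ℤ × ℤ, c (n, p) * (ee (p.1 * y) * ee (p.2 * w)) = 0 := by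
    intro n y w
    refine eq_zero_of_hasSum_ee (c := fun n => ∑' p : ℤ × ℤ, c (n, p) * (ee (p.1 * y) * ee (p.2 * w)))
      (hsum y w).prod (fun x => ?_) n
    rw [← h x y w]
    have hs : Summable fun T : ℤ × ℤ × ℤ => c T * ee (trForm T x y w) := by
      refine Summable.of_norm_bounded hc.norm fun T => ?_
      rw [trForm, ee_add, ee_add, norm_mul, norm_mul, norm_mul, hn, hn, hn, mul_one, mul_one, mul_one]
    rw [hs.tsum_prod]
    refine tsum_congr fun n => ?_
    rw [← tsum_mul_right]
    refine tsum_congr fun p => ?_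
    rw [trForm, ee_add, ee_add]
    ring
  have h2 : ∀ (n r : ℤ) (w : ℝ), ∑' m : ℤ, c (n, r, m) * ee (m * w) = 0 := by
    intro n r w
    have hs : ∀ y : ℝ, Summable fun p : ℤ × ℤ => c (n, p) * (ee (p.1 * y) * ee (p.2 * w)) :=
      fun y => (hsum y w).prod_factor n
    refine eq_zero_of_hasSum_ee (c := fun r => ∑' m : ℤ, c (n, r, m) * ee (m * w)) ?_ (fun y => ?_) r
    · have := hs 0
      simp only [ofReal_zero, mul_zero, ee_zero, one_mul] at this
      exact this.prod
    · rw [← h1 n y w, (hs y).tsum_prod]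
      refine tsum_congr fun n => ?_
      rw [← tsum_mul_right]
      refine tsum_congr fun p => ?_
      ring
  obtain ⟨n, r, m⟩ := T
  exact eq_zero_of_hasSum_ee ((hc.prod_factor n).prod_factor r) (h2 n r) m

/-- On the points with imaginary part 1 the difference of two expansions is an absolutely convergent
Fourier series in three real variables. Its coefficients are the differences A - B, extended by
zero, times nonzero exponentials. -/
theorem fourierExpansion_unique {F : Matrix (Fin 2) (Fin 2) ℂ → ℂ} {A B : halfIntegral → ℂ}
    (hA : HasFourierExpansion F A) (hB : HasFourierExpansion F B) : A = B := by
  set D : ℤ × ℤ × ℤ → ℂ := Function.extend entries (fun T => A T - B T) 0 with hD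
  have hinj := entries_injective
  set c : ℤ × ℤ × ℤ → ℂ := fun T => D T * ee (trForm T I 0 I) with hcdef
  have key : ∀ x y w : ℝ, HasSum (fun T => c T * ee (trForm T x y w)) 0 := by
    intro x y w
    have hZ : !![(x : ℂ) + I, y; y, w + I] ∈ upperHalfSpace := by
      refine ⟨?_, ?_⟩
      · ext i j
        fin_cases i <;> fin_cases j <;> simp
      · rw [show Matrix.map !![(x : ℂ) + I, y; y, w + I] Complex.im = (1 : Matrix (Fin 2) (Fin 2) ℝ) from ?_]
        · exact Matrix.PosDef.one
        ext i j
        fin_cases i <;> fin_cases j <;> simp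
    have h1 := (hA _ hZ).sub (hB _ hZ)
    rw [sub_self] at h1
    refine (hinj.hasSum_iff (f := fun T => c T * ee (trForm T x y w)) ?_).1 ?_
    · intro T hT
      simp [hcdef, hD, Function.extend_apply' _ _ _ (fun h => hT h)]
    · refine (hasSum_congr_fun fun T => ?_).1 h1
      simp only [Function.comp_apply, hcdef, hD, hinj.extend_apply]
      rw [← sub_mul, qPow_eq T hZ.1, mul_assoc, ← ee_add]
      congr 2
      simp [trForm]
      ring
  have hc : Summable c := by
    have := (key 0 0 0).summable
    simpa [trForm, ee_zero] using this
  funext T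
  have h2 := eq_zero_of_tsum_ee hc (fun x y w => (key x y w).tsum_eq) (entries T)
  simp only [hcdef, hD, hinj.extend_apply, mul_eq_zero, ee_ne_zero, or_false] at h2
  exact sub_eq_zero.1 h2

end SiegelTwo
end

/-! ### Euler product of the singular series -/

noncomputable section
namespace SiegelTwo
open Complex

/-- The pairing of `T = (n, r, m)` with a symmetric matrix over a ring. -/
def pairing {R : Type*} [CommRing R] (T : ℤ × ℤ × ℤ) (s : R × R × R) : R :=
  T.1 * s.1 + T.2.1 * s.2.1 + T.2.2 * s.2.2

/-- The exponential sum `∑_S e(tr(TS)/a)` over isotropic `S` modulo `a`. -/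
def isoSum (a : ℕ) [NeZero a] (T : ℤ × ℤ × ℤ) : ℂ :=
  ∑ s ∈ isoMod a, ZMod.stdAddChar (pairing T s)

theorem norm_isoSum_le (a : ℕ) [NeZero a] (T : ℤ × ℤ × ℤ) : ‖isoSum a T‖ ≤ (isoMod a).card := by
  refine (norm_sum_le _ _).trans ?_
  simp

theorem ee_dot_eq (p : IsoIdx) (T : ℤ × ℤ × ℤ) :
    ee ((p.dot T : ℂ) / p.1) = ZMod.stdAddChar (pairing T p.2.1) := by
  have : pairing T p.2.1 = ((p.dot T : ℤ) : ZMod (p.1 : ℕ)) := by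
    simp [pairing, IsoIdx.dot]
  rw [this, ZMod.stdAddChar_coe, ee]
  congr 1
  ring

/-- From wa + ub = 1 one gets j/(ab) = uj/a + wj/b, so the character splits under the Chinese
remainder theorem. Scaling by the units u modulo a and w modulo b preserves isotropy and absorbs
these factors. -/
theorem isoSum_mul {a b : ℕ} [NeZero a] [NeZero b] (hab : a.Coprime b) (T : ℤ × ℤ × ℤ) :
    isoSum (a * b) T = isoSum a T * isoSum b T := by
  obtain ⟨w, u, hwu⟩ := hab.isCoprime
  set e := ZMod.chineseRemainder hab with he
  have hu : (u : ZMod a) * b = 1 := by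
    have := congrArg (Int.cast : ℤ → ZMod a) hwu
    simpa using this
  have hw : (w : ZMod b) * a = 1 := by
    have := congrArg (Int.cast : ℤ → ZMod b) hwu
    simpa using this
  have hchar : ∀ z : ZMod (a * b), ZMod.stdAddChar z =
      ZMod.stdAddChar ((u : ZMod a) * (e z).1) * ZMod.stdAddChar ((w : ZMod b) * (e z).2) := by
    intro z
    obtain ⟨j, rfl⟩ := ZMod.intCast_surjective z
    rw [map_intCast e, Prod.fst_intCast, Prod.snd_intCast, ← Int.cast_mul, ← Int.cast_mul,
      ZMod.stdAddChar_coe, ZMod.stdAddChar_coe, ZMod.stdAddChar_coe, ← Complex.exp_add]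
    congr 1
    have ha : (a : ℂ) ≠ 0 := by exact_mod_cast NeZero.ne a
    have hb : (b : ℂ) ≠ 0 := by exact_mod_cast NeZero.ne b
    have h1 : (w : ℂ) * a + u * b = 1 := by exact_mod_cast hwu
    push_cast
    field_simp
    linear_combination (-(j : ℂ)) * h1
  rw [isoSum, isoSum, isoSum, Finset.sum_mul_sum, ← Finset.sum_product']
  refine Finset.sum_nbij'
    (fun s => ((u * (e s.1).1, u * (e s.2.1).1, u * (e s.2.2).1),
      (w * (e s.1).2, w * (e s.2.1).2, w * (e s.2.2).2)))
    (fun t => (e.symm (b * t.1.1, a * t.2.1), e.symm (b * t.1.2.1, a * t.2.2.1),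
      e.symm (b * t.1.2.2, a * t.2.2.2))) ?_ ?_ ?_ ?_ ?_
  · intro s hs
    have h1 := congrArg e (mem_isoMod.1 hs)
    rw [map_mul, map_pow] at h1
    have h2 := congrArg Prod.fst h1
    have h3 := congrArg Prod.snd h1
    simp only [Prod.fst_mul, Prod.pow_fst, Prod.snd_mul, Prod.pow_snd] at h2 h3
    rw [Finset.mem_product, mem_isoMod, mem_isoMod]
    constructor
    · linear_combination (u : ZMod a) ^ 2 * h2
    · linear_combination (w : ZMod b) ^ 2 * h3
  · intro t ht
    rw [Finset.mem_product, mem_isoMod, mem_isoMod] at ht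
    rw [mem_isoMod, ← map_mul, ← map_pow]
    congr 1
    ext
    · simp only [Prod.fst_mul, Prod.pow_fst]
      linear_combination (b : ZMod a) ^ 2 * ht.1
    · simp only [Prod.snd_mul, Prod.pow_snd]
      linear_combination (a : ZMod b) ^ 2 * ht.2
  · intro s _
    have : ∀ z : ZMod (a * b), e.symm (b * (u * (e z).1), a * (w * (e z).2)) = z := by
      intro z
      rw [← mul_assoc, ← mul_assoc, mul_comm _ (u : ZMod a), mul_comm _ (w : ZMod b), hu, hw, one_mul, one_mul]
      exact e.symm_apply_apply z
    simp only [this]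
  · intro t _
    simp only [RingEquiv.apply_symm_apply, ← mul_assoc, hu, hw, one_mul]
  · intro s _
    rw [hchar]
    congr 2
    · simp only [pairing, map_add, map_mul, map_intCast, Prod.fst_add, Prod.fst_mul, Prod.fst_intCast]
      ring
    · simp only [pairing, map_add, map_mul, map_intCast, Prod.snd_add, Prod.snd_mul, Prod.snd_intCast]
      ring

/-- The terms `a⁻ᵏ ∑_S e(tr(TS)/a)` of the singular series. -/
def singularTerm (k : ℕ) (T : ℤ × ℤ × ℤ) (a : ℕ) : ℂ :=
  if h : a = 0 then 0 else haveI : NeZero a := ⟨h⟩; isoSum a T * ((a : ℂ) ^ k)⁻¹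

theorem singularTerm_zero (k : ℕ) (T : ℤ × ℤ × ℤ) : singularTerm k T 0 = 0 := by
  simp [singularTerm]

theorem singularTerm_of_ne (k : ℕ) (T : ℤ × ℤ × ℤ) (a : ℕ) [NeZero a] :
    singularTerm k T a = isoSum a T * ((a : ℂ) ^ k)⁻¹ := by
  simp [singularTerm, NeZero.ne a]

theorem isoSum_one (T : ℤ × ℤ × ℤ) : isoSum 1 T = 1 := by
  have : isoMod 1 = {0} := by decide
  rw [isoSum, this, Finset.sum_singleton]
  simp [pairing]

theorem summable_singularTerm {k : ℕ} (hk : 4 ≤ k) (T : ℤ × ℤ × ℤ) :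
    Summable fun a => ‖singularTerm k T a‖ := by
  have h1 : Summable ((fun a => ‖singularTerm k T a‖) ∘ ((↑) : ℕ+ → ℕ)) := by
    refine Summable.of_nonneg_of_le (fun _ => norm_nonneg _) (fun a => ?_) (summable_card_isoMod hk)
    rw [Function.comp_apply, singularTerm_of_ne, norm_mul]
    refine mul_le_mul (norm_isoSum_le _ _) (by simp) (norm_nonneg _) (by positivity)
  refine (PNat.coe_injective.summable_iff fun a ha => ?_).1 h1
  have : a = 0 := by
    by_contra h
    exact ha ⟨⟨a, Nat.pos_of_ne_zero h⟩, rfl⟩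
  rw [this, singularTerm_zero, norm_zero]

theorem singularSeries_eq {k : ℕ} (hk : 4 ≤ k) (T : ℤ × ℤ × ℤ) :
    singularSeries k T = ∑' a, singularTerm k T a := by
  have h3 : Summable fun p : IsoIdx => ((p.1 : ℂ) ^ k)⁻¹ * ee ((p.dot T : ℂ) / p.1) := by
    refine Summable.of_norm_bounded (summable_isoIdx hk) fun p => ?_
    rw [norm_mul, norm_ee_dot, mul_one]
    simp
  rw [singularSeries, h3.tsum_sigma, ← tsum_zero_pnat_eq_tsum_nat (summable_singularTerm hk T).of_norm,
    singularTerm_zero, zero_add]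
  refine tsum_congr fun a => ?_
  rw [tsum_fintype, singularTerm_of_ne, isoSum, mul_comm, Finset.mul_sum]
  rw [← Finset.sum_coe_sort (isoMod (a : ℕ))]
  refine Finset.sum_congr rfl fun s _ => ?_
  rw [ee_dot_eq]

theorem hasProd_singularSeries {k : ℕ} (hk : 4 ≤ k) (T : ℤ × ℤ × ℤ) :
    HasProd (fun q : Nat.Primes => ∑' e : ℕ, singularTerm k T ((q : ℕ) ^ e)) (singularSeries k T) := by
  rw [singularSeries_eq hk]
  refine EulerProduct.eulerProduct_hasProd ?_ ?_ (summable_singularTerm hk T) (singularTerm_zero k T)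
  · rw [singularTerm_of_ne, isoSum_one]
    simp
  · intro m n hmn
    rcases eq_or_ne m 0 with rfl | hm
    · rw [zero_mul, singularTerm_zero, zero_mul]
    rcases eq_or_ne n 0 with rfl | hn
    · rw [mul_zero, singularTerm_zero, mul_zero]
    have : NeZero m := ⟨hm⟩
    have : NeZero n := ⟨hn⟩
    rw [singularTerm_of_ne, singularTerm_of_ne, singularTerm_of_ne, isoSum_mul hmn]
    push_cast
    rw [mul_pow, mul_inv]
    ring

end SiegelTwo
end

/-! ### Residue rings modulo prime powers and Ramanujan sums -/

noncomputable section
namespace SiegelTwo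
open Complex

section PrimePower

variable (q : ℕ)

/-- Reduction from `ℤ/qʲ⁺¹` to `ℤ/qʲ`. -/
def redPow (j : ℕ) : ZMod (q ^ (j + 1)) →+* ZMod (q ^ j) :=
  ZMod.castHom (pow_dvd_pow q (Nat.le_succ j)) _

theorem redPow_surjective (j : ℕ) : Function.Surjective (redPow q j) :=
  ZMod.ringHom_surjective _

theorem natCast_pow_eq_zero (j : ℕ) : (q : ZMod (q ^ j)) ^ j = 0 := by
  rw [← Nat.cast_pow]
  exact ZMod.natCast_self _

variable [hq : Fact q.Prime]

theorem mul_eq_zero_iff_redPow (j : ℕ) (x : ZMod (q ^ (j + 1))) : q * x = 0 ↔ redPow q j x = 0 := by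
  obtain ⟨n, rfl⟩ := ZMod.intCast_surjective x
  have h0 : (q : ℤ) ≠ 0 := by exact_mod_cast hq.out.ne_zero
  have h1 : (q : ZMod (q ^ (j + 1))) * (n : ZMod (q ^ (j + 1))) = ((q * n : ℤ) : ZMod (q ^ (j + 1))) := by
    push_cast
    rfl
  rw [h1, map_intCast, ZMod.intCast_zmod_eq_zero_iff_dvd, ZMod.intCast_zmod_eq_zero_iff_dvd]
  push_cast
  rw [pow_succ', mul_dvd_mul_iff_left h0]

theorem stdAddChar_natCast_mul (j : ℕ) (x : ZMod (q ^ (j + 1))) :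
    ZMod.stdAddChar ((q : ZMod (q ^ (j + 1))) * x) = ZMod.stdAddChar (redPow q j x) := by
  obtain ⟨n, rfl⟩ := ZMod.intCast_surjective x
  have h0 : (q : ℂ) ≠ 0 := by exact_mod_cast hq.out.ne_zero
  have h1 : (q : ZMod (q ^ (j + 1))) * (n : ZMod (q ^ (j + 1))) = ((q * n : ℤ) : ZMod (q ^ (j + 1))) := by
    push_cast
    rfl
  rw [h1, map_intCast (redPow q j), ZMod.stdAddChar_coe, ZMod.stdAddChar_coe]
  congr 1
  push_cast
  field_simp
  ring

theorem not_isUnit_intCast_iff (j : ℕ) (n : ℤ) : ¬IsUnit (n : ZMod (q ^ (j + 1))) ↔ (q : ℤ) ∣ n := by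
  rw [ZMod.coe_int_isUnit_iff_isCoprime, Nat.cast_pow, IsCoprime.pow_left_iff (Nat.succ_pos j),
    (Nat.prime_iff_prime_int.1 hq.out).irreducible.coprime_iff_not_dvd, not_not]

theorem not_isUnit_iff (j : ℕ) (x : ZMod (q ^ (j + 1))) : ¬IsUnit x ↔ ∃ y, x = q * y := by
  constructor
  · intro h
    obtain ⟨n, rfl⟩ := ZMod.intCast_surjective x
    obtain ⟨m, rfl⟩ := (not_isUnit_intCast_iff q j n).1 h
    exact ⟨m, by push_cast; rfl⟩
  · rintro ⟨y, rfl⟩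
    obtain ⟨n, rfl⟩ := ZMod.intCast_surjective y
    have := (not_isUnit_intCast_iff q j (q * n)).2 (dvd_mul_right _ _)
    simpa using this

theorem isUnit_redPow_iff (j : ℕ) (x : ZMod (q ^ (j + 2))) : IsUnit (redPow q (j + 1) x) ↔ IsUnit x := by
  obtain ⟨n, rfl⟩ := ZMod.intCast_surjective x
  rw [← not_iff_not, map_intCast, not_isUnit_intCast_iff, not_isUnit_intCast_iff]

/-- Multiplication by `q` from `ℤ/qʲ` to `ℤ/qʲ⁺¹`. -/
def mulPow (j : ℕ) (x : ZMod (q ^ j)) : ZMod (q ^ (j + 1)) := q * (x.val : ZMod (q ^ (j + 1)))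

theorem mulPow_redPow (j : ℕ) (x : ZMod (q ^ (j + 1))) : mulPow q j (redPow q j x) = q * x := by
  rw [mulPow, ← sub_eq_zero, ← mul_sub, mul_eq_zero_iff_redPow, map_sub, map_natCast, ZMod.natCast_zmod_val,
    sub_self]

theorem mulPow_injective (j : ℕ) : Function.Injective (mulPow q j) := by
  intro x y h
  obtain ⟨x, rfl⟩ := redPow_surjective q j x
  obtain ⟨y, rfl⟩ := redPow_surjective q j y
  rw [mulPow_redPow, mulPow_redPow, ← sub_eq_zero, ← mul_sub, mul_eq_zero_iff_redPow, map_sub, sub_eq_zero] at h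
  exact h

theorem range_mulPow (j : ℕ) (x : ZMod (q ^ (j + 1))) : ¬IsUnit x ↔ x ∈ Set.range (mulPow q j) := by
  rw [not_isUnit_iff]
  constructor
  · rintro ⟨y, rfl⟩
    exact ⟨redPow q j y, mulPow_redPow q j y⟩
  · rintro ⟨y, rfl⟩
    exact ⟨_, rfl⟩

theorem sum_redPow {M : Type*} [AddCommMonoid M] (j : ℕ) (g : ZMod (q ^ j) → M) :
    ∑ x : ZMod (q ^ (j + 1)), g (redPow q j x) = q • ∑ y, g y := by
  have hc : ∀ y : ZMod (q ^ j), (Finset.univ.filter fun x => redPow q j x = y).card = q := by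
    have h1 : ∀ y z : ZMod (q ^ j), (Finset.univ.filter fun x => redPow q j x = y).card =
        (Finset.univ.filter fun x => redPow q j x = z).card := fun y z =>
      AddMonoidHom.card_fiber_eq_of_mem_range (redPow q j).toAddMonoidHom (redPow_surjective q j y)
        (redPow_surjective q j z)
    intro y
    have h2 := Finset.card_eq_sum_card_fiberwise (f := redPow q j) (s := Finset.univ) (t := Finset.univ)
      (fun _ _ => by simp)
    rw [Finset.sum_congr rfl (fun z _ => h1 z y), Finset.sum_const, Finset.card_univ, Finset.card_univ,
      ZMod.card, ZMod.card, smul_eq_mul] at h2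
    exact (Nat.eq_of_mul_eq_mul_left (pow_pos hq.out.pos j) ((pow_succ q j).symm.trans h2)).symm
  rw [← Finset.sum_fiberwise Finset.univ (redPow q j), Finset.smul_sum]
  refine Finset.sum_congr rfl fun y _ => ?_
  rw [Finset.sum_congr rfl (fun x hx => by rw [(Finset.mem_filter.1 hx).2]), Finset.sum_const, hc]

theorem sum_not_isUnit {M : Type*} [AddCommMonoid M] (j : ℕ) (g : ZMod (q ^ (j + 1)) → M) :
    ∑ x with ¬IsUnit x, g x = ∑ y, g (mulPow q j y) := by
  rw [← Finset.sum_image (f := g) (s := Finset.univ) (g := mulPow q j) (fun _ _ _ _ h => mulPow_injective q j h)]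
  refine Finset.sum_congr ?_ fun _ _ => rfl
  ext x
  simp [range_mulPow]

theorem sum_stdAddChar_mul (a : ℕ) [NeZero a] (t : ZMod a) :
    ∑ x, ZMod.stdAddChar (x * t) = if t = 0 then (a : ℂ) else 0 := by
  rw [AddChar.sum_mulShift _ (ZMod.isPrimitive_stdAddChar a), ZMod.card]
  split_ifs <;> simp

/-- Ramanujan sums for prime powers. -/
theorem sum_isUnit_stdAddChar (j : ℕ) (t : ZMod (q ^ (j + 1))) :
    ∑ x with IsUnit x, ZMod.stdAddChar (x * t) =
      (if t = 0 then (q : ℂ) ^ (j + 1) else 0) - if redPow q j t = 0 then (q : ℂ) ^ j else 0 := by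
  have h1 := Finset.sum_filter_add_sum_filter_not (Finset.univ : Finset (ZMod (q ^ (j + 1)))) (fun x => IsUnit x)
    (fun x => ZMod.stdAddChar (x * t))
  rw [sum_stdAddChar_mul, sum_not_isUnit] at h1
  have h2 : ∀ y, ZMod.stdAddChar (mulPow q j y * t) = ZMod.stdAddChar (y * redPow q j t) := by
    intro y
    obtain ⟨y, rfl⟩ := redPow_surjective q j y
    rw [mulPow_redPow, mul_assoc, stdAddChar_natCast_mul, map_mul]
  simp only [h2, sum_stdAddChar_mul] at h1
  push_cast at h1
  exact eq_sub_of_add_eq h1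

end PrimePower

end SiegelTwo
end

/-! ### Exponential sums at prime powers as counts of zeros of T -/

noncomputable section
namespace SiegelTwo
open Complex

theorem pairing_smul {R : Type*} [CommRing R] (T : ℤ × ℤ × ℤ) (l : R) (s : R × R × R) :
    pairing T (l * s.1, l * s.2.1, l * s.2.2) = l * pairing T s := by
  simp only [pairing]
  ring

/-- Reduction of a triple along a ring homomorphism. -/
def mapTriple {R S : Type*} (f : R → S) (s : R × R × R) : S × S × S := (f s.1, f s.2.1, f s.2.2)

theorem map_pairing {R S : Type*} [CommRing R] [CommRing S] (f : R →+* S) (T : ℤ × ℤ × ℤ)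
    (s : R × R × R) : f (pairing T s) = pairing T (mapTriple f s) := by
  simp [pairing, mapTriple]

theorem sum_ite_const {ι : Type*} (s : Finset ι) (P : ι → Prop) [DecidablePred P] (a : ℂ) :
    ∑ c ∈ s, (if P c then a else 0) = ((s.filter P).card : ℂ) * a := by
  rw [← Finset.sum_filter, Finset.sum_const, nsmul_eq_mul]

section PrimePower

variable (q : ℕ) [hq : Fact q.Prime]

/-- The number of zeros `(1 : c)` of the form `T` modulo `qʲ`. -/
def rootCount (j : ℕ) (T : ℤ × ℤ × ℤ) : ℕ :=
  (Finset.univ.filter fun c : ZMod (q ^ j) => pairing T (1, c, c ^ 2) = 0).card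

/-- The number of zeros `(c : 1)`, `q ∣ c`, of the form `T` modulo `qʲ`. -/
def rootCountInf (j : ℕ) (T : ℤ × ℤ × ℤ) : ℕ :=
  ((Finset.univ.filter fun c : ZMod (q ^ j) => ¬IsUnit c).filter fun c => pairing T (c ^ 2, c, 1) = 0).card

/-- The sum over isotropic matrices all of whose entries are divisible by `q`. -/
def isoSumRest (j : ℕ) (T : ℤ × ℤ × ℤ) : ℂ :=
  ∑ s ∈ ((isoMod (q ^ (j + 1))).filter fun s => ¬IsUnit s.1).filter fun s => ¬IsUnit s.2.2,
    ZMod.stdAddChar (pairing T s)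

/-- Isotropic matrices with unit first entry are l·(1, c, c²) with l a unit. The sum over l is a
Ramanujan sum, which detects zeros of T modulo q^(j+1) and modulo q^j; each zero modulo q^j has q
lifts. -/
theorem sum_isoMod_fst (j : ℕ) (T : ℤ × ℤ × ℤ) :
    ∑ s ∈ (isoMod (q ^ (j + 1))).filter fun s => IsUnit s.1, ZMod.stdAddChar (pairing T s) =
      (q : ℂ) ^ (j + 1) * (rootCount q (j + 1) T - rootCount q j T) := by
  have h1 : ∑ s ∈ (isoMod (q ^ (j + 1))).filter fun s => IsUnit s.1, ZMod.stdAddChar (pairing T s) =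
      ∑ x ∈ (Finset.univ : Finset (ZMod (q ^ (j + 1)))) ×ˢ
        (Finset.univ : Finset (ZMod (q ^ (j + 1)))).filter (fun l => IsUnit l),
        ZMod.stdAddChar (x.2 * pairing T (1, x.1, x.1 ^ 2)) := by
    symm
    refine Finset.sum_nbij (fun x => (x.2, x.2 * x.1, x.2 * x.1 ^ 2)) ?_ ?_ ?_ ?_
    · rintro ⟨c, l⟩ h
      simp only [Finset.mem_product, Finset.mem_univ, Finset.mem_filter, true_and] at h
      rw [Finset.mem_filter, mem_isoMod]
      exact ⟨by ring, h⟩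
    · rintro ⟨c, l⟩ h ⟨c', l'⟩ h' he
      simp only [Finset.coe_product, Finset.coe_univ, Finset.coe_filter, Finset.mem_univ, true_and,
        Set.mem_prod, Set.mem_univ, Set.mem_ofPred_eq] at h h'
      simp only [Prod.mk.injEq] at he
      obtain ⟨rfl, he, -⟩ := he
      rw [h.mul_left_cancel he]
    · rintro ⟨s1, s2, s3⟩ hs
      simp only [Finset.coe_filter, Set.mem_ofPred_eq, mem_isoMod] at hs
      obtain ⟨he, u, rfl⟩ := hs
      refine ⟨(u⁻¹.1 * s2, u), ?_, ?_⟩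
      · simp
      · simp only [Prod.mk.injEq, true_and, Units.mul_inv_cancel_left]
        rw [mul_pow, ← he]
        simp only [← mul_assoc]
        simp [pow_two]
    · rintro ⟨c, l⟩ _
      rw [← pairing_smul]
      simp
  rw [h1, Finset.sum_product]
  simp only [sum_isUnit_stdAddChar, Finset.sum_sub_distrib, sum_ite_const]
  have h2 : ((Finset.univ.filter fun c : ZMod (q ^ (j + 1)) => redPow q j (pairing T (1, c, c ^ 2)) = 0).card : ℂ)
      = q * rootCount q j T := by
    have := sum_redPow q j (fun y => if pairing T (1, y, y ^ 2) = 0 then 1 else 0)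
    rw [← Finset.card_filter, ← Finset.card_filter, smul_eq_mul] at this
    rw [rootCount, ← Nat.cast_mul, ← this]
    simp [map_pairing, mapTriple]
  rw [h2, show (Finset.univ.filter fun c : ZMod (q ^ (j + 1)) => pairing T (1, c, c ^ 2) = 0).card =
    rootCount q (j + 1) T from rfl]
  ring

/-- The same with the parametrization l·(c², c, 1), where c is a non-unit. -/
theorem sum_isoMod_last (j : ℕ) (T : ℤ × ℤ × ℤ) :
    ∑ s ∈ ((isoMod (q ^ (j + 1))).filter fun s => ¬IsUnit s.1).filter fun s => IsUnit s.2.2,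
        ZMod.stdAddChar (pairing T s) =
      (q : ℂ) ^ (j + 1) * rootCountInf q (j + 1) T - (q : ℂ) ^ j * ((Finset.univ.filter
        fun c : ZMod (q ^ (j + 1)) => ¬IsUnit c).filter fun c => redPow q j (pairing T (c ^ 2, c, 1)) = 0).card := by
  have h1 : ∑ s ∈ ((isoMod (q ^ (j + 1))).filter fun s => ¬IsUnit s.1).filter fun s => IsUnit s.2.2,
      ZMod.stdAddChar (pairing T s) =
      ∑ x ∈ (Finset.univ : Finset (ZMod (q ^ (j + 1)))).filter (fun c => ¬IsUnit c) ×ˢ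
        (Finset.univ : Finset (ZMod (q ^ (j + 1)))).filter (fun l => IsUnit l),
        ZMod.stdAddChar (x.2 * pairing T (x.1 ^ 2, x.1, 1)) := by
    symm
    refine Finset.sum_nbij (fun x => (x.2 * x.1 ^ 2, x.2 * x.1, x.2)) ?_ ?_ ?_ ?_
    · rintro ⟨c, l⟩ h
      simp only [Finset.mem_product, Finset.mem_univ, Finset.mem_filter, true_and] at h
      rw [Finset.mem_filter, Finset.mem_filter, mem_isoMod]
      refine ⟨⟨by ring, fun hu => h.1 ?_⟩, h.2⟩
      exact (isUnit_pow_iff two_ne_zero).1 (isUnit_of_mul_isUnit_right hu)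
    · rintro ⟨c, l⟩ h ⟨c', l'⟩ h' he
      simp only [Finset.coe_product, Finset.coe_filter, Finset.mem_univ, true_and,
        Set.mem_prod, Set.mem_ofPred_eq] at h h'
      simp only [Prod.mk.injEq] at he
      obtain ⟨-, he, rfl⟩ := he
      rw [h.2.mul_left_cancel he]
    · rintro ⟨s1, s2, s3⟩ hs
      simp only [Finset.coe_filter, Set.mem_ofPred_eq, mem_isoMod, Finset.mem_filter] at hs
      obtain ⟨⟨he, hn⟩, u, rfl⟩ := hs
      have h3 : s1 = u * (u⁻¹.1 * s2) ^ 2 := by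
        rw [mul_pow, ← he]
        simp only [← mul_assoc]
        rw [pow_two, ← mul_assoc]
        simp only [Units.mul_inv, one_mul]
        rw [mul_right_comm, Units.inv_mul, one_mul]
      refine ⟨(u⁻¹.1 * s2, u), ?_, ?_⟩
      · simp only [Finset.coe_product, Finset.coe_filter, Finset.mem_univ, true_and,
          Set.mem_prod, Set.mem_ofPred_eq, Units.isUnit, and_true]
        intro hu
        refine hn ?_
        rw [h3]
        exact u.isUnit.mul (hu.pow 2)
      · simp only [Prod.mk.injEq, Units.mul_inv_cancel_left, and_true]
        exact h3.symm
    · rintro ⟨c, l⟩ _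
      rw [← pairing_smul]
      simp
  rw [h1, Finset.sum_product]
  simp only [sum_isUnit_stdAddChar, Finset.sum_sub_distrib, sum_ite_const]
  rw [rootCountInf]
  ring

theorem isoSum_eq_add (j : ℕ) (T : ℤ × ℤ × ℤ) :
    isoSum (q ^ (j + 1)) T = (q : ℂ) ^ (j + 1) * (rootCount q (j + 1) T - rootCount q j T) +
      ((q : ℂ) ^ (j + 1) * rootCountInf q (j + 1) T - (q : ℂ) ^ j * ((Finset.univ.filter
        fun c : ZMod (q ^ (j + 1)) => ¬IsUnit c).filter fun c =>
          redPow q j (pairing T (c ^ 2, c, 1)) = 0).card + isoSumRest q j T) := by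
  rw [isoSum, ← Finset.sum_filter_add_sum_filter_not _ (fun s => IsUnit s.1),
    ← Finset.sum_filter_add_sum_filter_not ((isoMod (q ^ (j + 1))).filter fun s => ¬IsUnit s.1)
      (fun s => IsUnit s.2.2),
    sum_isoMod_fst, sum_isoMod_last, isoSumRest]

theorem not_isUnit_pow_one (x : ZMod (q ^ 1)) : ¬IsUnit x ↔ x = 0 := by
  have h0 : ∀ y : ZMod (q ^ 1), (q : ZMod (q ^ 1)) * y = 0 := fun y =>
    (mul_eq_zero_iff_redPow q 0 y).2 (Subsingleton.elim (α := ZMod 1) _ _)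
  rw [not_isUnit_iff q 0]
  constructor
  · rintro ⟨y, rfl⟩
    exact h0 y
  · rintro rfl
    exact ⟨0, by simp⟩

/-- The number of zeros of the form `T` on the projective line modulo `qʲ`. -/
def zeroCount (j : ℕ) (T : ℤ × ℤ × ℤ) : ℕ := rootCount q j T + rootCountInf q j T

theorem rootCount_zero (T : ℤ × ℤ × ℤ) : rootCount q 0 T = 1 := by
  have : ∀ c : ZMod 1, pairing T (1, c, c ^ 2) = 0 := fun c => Subsingleton.elim _ _
  change (Finset.univ.filter fun c : ZMod 1 => pairing T (1, c, c ^ 2) = 0).card = 1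
  simp [this]

theorem rootCountInf_zero (T : ℤ × ℤ × ℤ) : rootCountInf q 0 T = 0 := by
  have : ∀ c : ZMod 1, IsUnit c := fun c => isUnit_of_subsingleton c
  change ((Finset.univ.filter fun c : ZMod 1 => ¬IsUnit c).filter fun c => pairing T (c ^ 2, c, 1) = 0).card = 0
  rw [Finset.card_eq_zero, Finset.filter_eq_empty_iff]
  intro x hx
  exact absurd (this x) (Finset.mem_filter.1 hx).2

theorem zeroCount_zero (T : ℤ × ℤ × ℤ) : zeroCount q 0 T = 1 := by
  rw [zeroCount, rootCount_zero, rootCountInf_zero]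

theorem isoSum_prime (T : ℤ × ℤ × ℤ) : isoSum (q ^ 1) T = q * (zeroCount q 1 T - 1) := by
  have h1 : isoSumRest q 0 T = 1 := by
    rw [isoSumRest]
    have : ((isoMod (q ^ (0 + 1))).filter fun s => ¬IsUnit s.1).filter (fun s => ¬IsUnit s.2.2) = {0} := by
      ext ⟨s1, s2, s3⟩
      simp only [Finset.mem_filter, mem_isoMod, Finset.mem_singleton, Prod.mk_eq_zero]
      rw [not_isUnit_pow_one, not_isUnit_pow_one]
      constructor
      · rintro ⟨⟨h, rfl⟩, rfl⟩
        refine ⟨rfl, ?_, rfl⟩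
        rw [← not_isUnit_pow_one]
        intro hu
        have := hu.pow 2
        rw [← h, mul_zero] at this
        exact (not_isUnit_pow_one q 0).2 rfl this
      · rintro ⟨rfl, rfl, rfl⟩
        simp
    rw [this, Finset.sum_singleton]
    simp [pairing]
  have h2 : ((Finset.univ.filter fun c : ZMod (q ^ (0 + 1)) => ¬IsUnit c).filter fun c =>
      redPow q 0 (pairing T (c ^ 2, c, 1)) = 0).card = 1 := by
    have h3 : ∀ x : ZMod (q ^ 0), x = 0 := fun x => Subsingleton.elim (α := ZMod 1) _ _
    simp only [h3, Finset.filter_true]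
    rw [Finset.card_eq_one]
    refine ⟨0, ?_⟩
    ext x
    rw [Finset.mem_filter, not_isUnit_pow_one]
    simp
  rw [isoSum_eq_add q 0, h1, h2, rootCount_zero, zeroCount]
  push_cast
  ring

theorem card_not_isUnit_redPow (j : ℕ) (T : ℤ × ℤ × ℤ) :
    ((Finset.univ.filter fun c : ZMod (q ^ (j + 2)) => ¬IsUnit c).filter fun c =>
      redPow q (j + 1) (pairing T (c ^ 2, c, 1)) = 0).card = q * rootCountInf q (j + 1) T := by
  have := sum_redPow q (j + 1) (fun y => if ¬IsUnit y ∧ pairing T (y ^ 2, y, 1) = 0 then 1 else 0)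
  rw [← Finset.card_filter, ← Finset.card_filter, smul_eq_mul] at this
  rw [rootCountInf, Finset.filter_filter, Finset.filter_filter, ← this]
  simp only [isUnit_redPow_iff, map_pairing, mapTriple, map_pow, map_one]

theorem isotropic_mul_iff (j : ℕ) (X : ZMod (q ^ (j + 2)) × ZMod (q ^ (j + 2)) × ZMod (q ^ (j + 2))) :
    (q * X.1) * (q * X.2.2) = (q * X.2.1) ^ 2 ↔
      mapTriple (redPow q j) (mapTriple (redPow q (j + 1)) X) ∈ isoMod (q ^ j) := by
  have h1 : (q * X.1) * (q * X.2.2) - (q * X.2.1) ^ 2 = q * (q * (X.1 * X.2.2 - X.2.1 ^ 2)) := by ring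
  rw [← sub_eq_zero, h1, mul_eq_zero_iff_redPow, map_mul, map_natCast, mul_eq_zero_iff_redPow, mem_isoMod]
  simp only [mapTriple, map_sub, map_mul, map_pow, sub_eq_zero]

theorem mapTriple_surjective {R S : Type*} {f : R → S} (hf : Function.Surjective f) :
    Function.Surjective (mapTriple f) := by
  rintro ⟨a, b, c⟩
  obtain ⟨a, rfl⟩ := hf a
  obtain ⟨b, rfl⟩ := hf b
  obtain ⟨c, rfl⟩ := hf c
  exact ⟨(a, b, c), rfl⟩

theorem mapTriple_mulPow (j : ℕ) (X : ZMod (q ^ (j + 1)) × ZMod (q ^ (j + 1)) × ZMod (q ^ (j + 1))) :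
    mapTriple (mulPow q j) (mapTriple (redPow q j) X) = (q * X.1, q * X.2.1, q * X.2.2) := by
  simp only [mapTriple, mulPow_redPow]

/-- A matrix divisible by q modulo q^(j+2) is qX with X defined modulo q^(j+1), and its isotropy is
the isotropy of X modulo q^j. -/
theorem isoSumRest_succ (j : ℕ) (T : ℤ × ℤ × ℤ) :
    isoSumRest q (j + 1) T = ∑ t with mapTriple (redPow q j) t ∈ isoMod (q ^ j), ZMod.stdAddChar (pairing T t) := by
  symm
  refine Finset.sum_nbij (mapTriple (mulPow q (j + 1))) ?_ ?_ ?_ ?_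
  · intro t ht
    obtain ⟨X, rfl⟩ := mapTriple_surjective (redPow_surjective q (j + 1)) t
    rw [mapTriple_mulPow, Finset.mem_filter, Finset.mem_filter, mem_isoMod, isotropic_mul_iff]
    exact ⟨⟨(Finset.mem_filter.1 ht).2, (not_isUnit_iff q _ _).2 ⟨_, rfl⟩⟩, (not_isUnit_iff q _ _).2 ⟨_, rfl⟩⟩
  · rintro ⟨t1, t2, t3⟩ _ ⟨u1, u2, u3⟩ _ h
    simp only [mapTriple, Prod.mk.injEq] at h
    rw [mulPow_injective _ _ h.1, mulPow_injective _ _ h.2.1, mulPow_injective _ _ h.2.2]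
  · rintro ⟨s1, s2, s3⟩ hs
    simp only [Finset.coe_filter, Finset.mem_filter, Set.mem_ofPred_eq, mem_isoMod] at hs
    obtain ⟨⟨h, h1⟩, h3⟩ := hs
    have h2 : ¬IsUnit s2 := fun hu => h1 (isUnit_of_mul_isUnit_left (h ▸ hu.pow 2))
    obtain ⟨x1, rfl⟩ := (not_isUnit_iff q _ _).1 h1
    obtain ⟨x2, rfl⟩ := (not_isUnit_iff q _ _).1 h2
    obtain ⟨x3, rfl⟩ := (not_isUnit_iff q _ _).1 h3
    refine ⟨mapTriple (redPow q (j + 1)) (x1, x2, x3), ?_, mapTriple_mulPow q _ _⟩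
    rw [Finset.mem_coe, Finset.mem_filter]
    exact ⟨Finset.mem_univ _, (isotropic_mul_iff q j (x1, x2, x3)).1 h⟩
  · intro t _
    obtain ⟨X, rfl⟩ := mapTriple_surjective (redPow_surjective q (j + 1)) t
    rw [mapTriple_mulPow, pairing_smul, stdAddChar_natCast_mul, map_pairing]

theorem sum_mapTriple_redPow (j : ℕ) (g : ZMod (q ^ j) × ZMod (q ^ j) × ZMod (q ^ j) → ℂ) :
    ∑ t, g (mapTriple (redPow q j) t) = (q : ℂ) ^ 3 * ∑ s, g s := by
  simp only [Fintype.sum_prod_type, mapTriple]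
  have h1 := fun x y => sum_redPow q j (fun z => g (x, y, z))
  simp only [h1]
  have h2 := fun x => sum_redPow q j (fun y => q • ∑ z, g (x, y, z))
  simp only [h2]
  have h3 := sum_redPow q j (fun x => q • ∑ y, q • ∑ z, g (x, y, z))
  rw [h3]
  simp only [nsmul_eq_mul, ← Finset.mul_sum]
  ring

/-- Divisibility of a binary form by an integer. -/
def DvdForm (d : ℤ) (T : ℤ × ℤ × ℤ) : Prop := d ∣ T.1 ∧ d ∣ T.2.1 ∧ d ∣ T.2.2

/-- The factor q in the form makes the summand depend on the matrix modulo q^j only, and each triple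
has q³ lifts. -/
theorem isoSumRest_of_dvd (j : ℕ) (T : ℤ × ℤ × ℤ) :
    isoSumRest q (j + 1) (q * T.1, q * T.2.1, q * T.2.2) = (q : ℂ) ^ 3 * isoSum (q ^ j) T := by
  have h := sum_mapTriple_redPow q j (fun s => if s ∈ isoMod (q ^ j) then ZMod.stdAddChar (pairing T s) else 0)
  rw [← Finset.sum_filter, ← Finset.sum_filter, Finset.filter_univ_mem] at h
  rw [isoSumRest_succ, isoSum, ← h]
  refine Finset.sum_congr rfl fun t _ => ?_
  rw [← map_pairing, ← stdAddChar_natCast_mul]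
  congr 1
  simp only [pairing]
  push_cast
  ring

/-- The range of summation is stable under translation by triples vanishing modulo q^j. Some such
triple d pairs nontrivially with T, so the sum equals itself times a number different from 1. -/
theorem isoSumRest_of_not_dvd (j : ℕ) {T : ℤ × ℤ × ℤ} (hT : ¬DvdForm q T) :
    isoSumRest q (j + 1) T = 0 := by
  have key : ∀ n : ℤ, ¬(q : ℤ) ∣ n → (n : ZMod (q ^ (j + 1))) * q ^ j ≠ 0 := by
    intro n hn h
    have h1 : ((n * q ^ j : ℤ) : ZMod (q ^ (j + 1))) = 0 := by
      push_cast
      exact h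
    rw [ZMod.intCast_zmod_eq_zero_iff_dvd] at h1
    push_cast at h1
    rw [pow_succ', mul_dvd_mul_iff_right (pow_ne_zero _ (by exact_mod_cast hq.out.ne_zero))] at h1
    exact hn h1
  have hred : redPow q j (q ^ j) = 0 := by
    rw [map_pow, map_natCast, natCast_pow_eq_zero]
  obtain ⟨d, hd0, hd⟩ : ∃ d : ZMod (q ^ (j + 1)) × ZMod (q ^ (j + 1)) × ZMod (q ^ (j + 1)),
      mapTriple (redPow q j) d = 0 ∧ pairing T d ≠ 0 := by
    rw [DvdForm, not_and_or, not_and_or] at hT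
    rcases hT with h | h | h
    · exact ⟨(q ^ j, 0, 0), by simp [mapTriple, hred], by simpa [pairing] using key _ h⟩
    · exact ⟨(0, q ^ j, 0), by simp [mapTriple, hred], by simpa [pairing] using key _ h⟩
    · exact ⟨(0, 0, q ^ j), by simp [mapTriple, hred], by simpa [pairing] using key _ h⟩
  have hadd : ∀ t, mapTriple (redPow q j) (t + d) = mapTriple (redPow q j) t := by
    intro t
    simp only [mapTriple, Prod.mk_eq_zero] at hd0
    simp [mapTriple, hd0]
  have hp : ∀ t, pairing T (t + d) = pairing T t + pairing T d := by
    intro t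
    simp only [pairing, Prod.fst_add, Prod.snd_add]
    ring
  have h1 : isoSumRest q (j + 1) T = isoSumRest q (j + 1) T * ZMod.stdAddChar (pairing T d) := by
    rw [isoSumRest_succ, Finset.sum_mul]
    refine (Finset.sum_nbij' (fun t => t + d) (fun t => t - d) ?_ ?_ ?_ ?_ ?_).symm
    · intro t ht
      simpa [hadd] using ht
    · intro t ht
      simp only [Finset.mem_filter, Finset.mem_univ, true_and] at ht ⊢
      rwa [← hadd, sub_add_cancel]
    · intro t _
      simp
    · intro t _
      simp
    · intro t _
      rw [hp, AddChar.map_add_eq_mul]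
  have h2 : ZMod.stdAddChar (pairing T d) ≠ 1 := by
    intro h
    rw [← AddChar.map_zero_eq_one (ZMod.stdAddChar (N := q ^ (j + 1)))] at h
    exact hd (ZMod.injective_stdAddChar h)
  have h3 : isoSumRest q (j + 1) T * (ZMod.stdAddChar (pairing T d) - 1) = 0 := by
    rw [mul_sub, ← h1, mul_one, sub_self]
  exact (mul_eq_zero.1 h3).resolve_right (sub_ne_zero.2 h2)

theorem isoSum_pow (j : ℕ) (T : ℤ × ℤ × ℤ) :
    isoSum (q ^ (j + 2)) T = (q : ℂ) ^ (j + 2) * (zeroCount q (j + 2) T - zeroCount q (j + 1) T) +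
      isoSumRest q (j + 1) T := by
  rw [isoSum_eq_add q (j + 1), card_not_isUnit_redPow, zeroCount, zeroCount]
  push_cast
  ring

end PrimePower

end SiegelTwo
end

/-! ### Generating series of zero counts and their recursions -/

noncomputable section
namespace SiegelTwo
open Complex

/-- The change of variables of a binary form by `(1, c; 0, 1)`. -/
def shearForm (c : ℤ) (T : ℤ × ℤ × ℤ) : ℤ × ℤ × ℤ :=
  (T.1 + T.2.1 * c + T.2.2 * c ^ 2, T.2.1 + 2 * T.2.2 * c, T.2.2)

/-- Exchange of the two variables of a binary form. -/
def swapForm (T : ℤ × ℤ × ℤ) : ℤ × ℤ × ℤ := (T.2.2, T.2.1, T.1)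

/-- Multiplication of a binary form by an integer. -/
def smulForm (d : ℤ) (T : ℤ × ℤ × ℤ) : ℤ × ℤ × ℤ := (d * T.1, d * T.2.1, d * T.2.2)

/-- The discriminant of a binary form. -/
def discForm (T : ℤ × ℤ × ℤ) : ℤ := T.2.1 ^ 2 - 4 * T.1 * T.2.2

theorem discForm_shearForm (c : ℤ) (T : ℤ × ℤ × ℤ) : discForm (shearForm c T) = discForm T := by
  simp only [discForm, shearForm]
  ring

theorem discForm_swapForm (T : ℤ × ℤ × ℤ) : discForm (swapForm T) = discForm T := by
  simp only [discForm, swapForm]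
  ring

theorem discForm_smulForm (d : ℤ) (T : ℤ × ℤ × ℤ) : discForm (smulForm d T) = d ^ 2 * discForm T := by
  simp only [discForm, smulForm]
  ring

theorem discForm_emod_four (T : ℤ × ℤ × ℤ) : discForm T % 4 = 0 ∨ discForm T % 4 = 1 := by
  have h : discForm T % 4 = T.2.1 ^ 2 % 4 := by
    rw [discForm]
    have : T.2.1 ^ 2 - 4 * T.1 * T.2.2 = T.2.1 ^ 2 + 4 * (-(T.1 * T.2.2)) := by ring
    rw [this, Int.add_mul_emod_self_left]
  rw [h]
  rcases Int.even_or_odd' T.2.1 with ⟨c, hc | hc⟩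
  · left
    rw [hc]
    ring_nf
    omega
  · right
    rw [hc]
    ring_nf
    omega

theorem isoSum_swapForm (a : ℕ) [NeZero a] (T : ℤ × ℤ × ℤ) : isoSum a (swapForm T) = isoSum a T := by
  refine Finset.sum_nbij' (fun s => (s.2.2, s.2.1, s.1)) (fun s => (s.2.2, s.2.1, s.1)) ?_ ?_ ?_ ?_ ?_
  · intro s hs
    rw [mem_isoMod] at hs ⊢
    rw [← hs]; ring
  · intro s hs
    rw [mem_isoMod] at hs ⊢
    rw [← hs]; ring
  · intro s _; rfl
  · intro s _; rfl
  · intro s _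
    congr 1
    simp only [pairing, swapForm]
    ring

theorem isoSum_shearForm (a : ℕ) [NeZero a] (c : ℤ) (T : ℤ × ℤ × ℤ) :
    isoSum a (shearForm c T) = isoSum a T := by
  refine Finset.sum_nbij' (fun s => (s.1, s.2.1 + c * s.1, s.2.2 + 2 * c * s.2.1 + c ^ 2 * s.1))
    (fun s => (s.1, s.2.1 - c * s.1, s.2.2 - 2 * c * s.2.1 + c ^ 2 * s.1)) ?_ ?_ ?_ ?_ ?_
  · intro s hs
    rw [mem_isoMod] at hs ⊢
    linear_combination hs
  · intro s hs
    rw [mem_isoMod] at hs ⊢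
    linear_combination hs
  · intro s _
    ext
    · rfl
    · simp
    · simp; ring
  · intro s _
    ext
    · rfl
    · simp
    · simp; ring
  · intro s _
    congr 1
    simp only [pairing, shearForm]
    push_cast
    ring

section PrimePower

variable (q : ℕ)

/-- The form `q² n x² + q r x y + m y²`. -/
def raiseForm (T : ℤ × ℤ × ℤ) : ℤ × ℤ × ℤ := (q ^ 2 * T.1, q * T.2.1, T.2.2)

theorem discForm_raiseForm (T : ℤ × ℤ × ℤ) : discForm (raiseForm q T) = q ^ 2 * discForm T := by
  simp only [discForm, raiseForm]
  ring

theorem dvdForm_iff (T : ℤ × ℤ × ℤ) : DvdForm q T ↔ ∃ S, T = smulForm q S := by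
  constructor
  · rintro ⟨⟨a, ha⟩, ⟨b, hb⟩, ⟨c, hc⟩⟩
    exact ⟨(a, b, c), by ext <;> simp [smulForm, ha, hb, hc]⟩
  · rintro ⟨S, rfl⟩
    exact ⟨dvd_mul_right _ _, dvd_mul_right _ _, dvd_mul_right _ _⟩

variable [hq : Fact q.Prime]

/-- The local factor of the singular series. -/
def localSum (k : ℕ) (T : ℤ × ℤ × ℤ) : ℂ := ∑' e : ℕ, singularTerm k T (q ^ e)

/-- `q¹⁻ᵏ`. -/
def localParam (k : ℕ) : ℂ := q * ((q : ℂ) ^ k)⁻¹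

/-- The generating series of the numbers of zeros modulo `qʲ`. -/
def zeroSeries (k : ℕ) (T : ℤ × ℤ × ℤ) : ℂ := ∑' j : ℕ, (zeroCount q j T : ℂ) * localParam q k ^ j

theorem localSum_congr {T S : ℤ × ℤ × ℤ} (h : ∀ (a : ℕ) [NeZero a], isoSum a T = isoSum a S) (k : ℕ) :
    localSum q k T = localSum q k S := by
  refine tsum_congr fun e => ?_
  rw [singularTerm_of_ne, singularTerm_of_ne, h]

theorem prime_ne_zero : (q : ℂ) ≠ 0 := by exact_mod_cast hq.out.ne_zero

/-- Zero counts grow at most like 2q^j, so this is the ratio that governs convergence of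
`zeroSeries`. -/
theorem norm_localParam {k : ℕ} (hk : 4 ≤ k) : q * ‖localParam q k‖ ≤ 1 / 4 := by
  have h2 : (2 : ℝ) ≤ q := by exact_mod_cast hq.out.two_le
  have h0 : (q : ℝ) ≠ 0 := by positivity
  obtain ⟨m, rfl⟩ := Nat.exists_eq_add_of_le hk
  rw [localParam, norm_mul, norm_inv, norm_pow, Complex.norm_natCast]
  have h1 : (q : ℝ) * (q * ((q : ℝ) ^ (4 + m))⁻¹) = ((q : ℝ) ^ (2 + m))⁻¹ := by
    field_simp
    ring
  rw [h1, one_div]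
  refine inv_anti₀ (by norm_num) ?_
  calc (4 : ℝ) = 2 ^ 2 * 1 := by norm_num
    _ ≤ q ^ 2 * q ^ m := mul_le_mul (by gcongr) (one_le_pow₀ (by linarith)) (by norm_num) (by positivity)
    _ = q ^ (2 + m) := (pow_add _ _ _).symm

theorem zeroCount_le (j : ℕ) (T : ℤ × ℤ × ℤ) : zeroCount q j T ≤ 2 * q ^ j := by
  have h1 : rootCount q j T ≤ q ^ j := (Finset.card_le_univ _).trans (by rw [ZMod.card])
  have h2 : rootCountInf q j T ≤ q ^ j := (Finset.card_le_univ _).trans (by rw [ZMod.card])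
  rw [zeroCount]
  omega

theorem summable_zeroSeries {k : ℕ} (hk : 4 ≤ k) (T : ℤ × ℤ × ℤ) :
    Summable fun j : ℕ => (zeroCount q j T : ℂ) * localParam q k ^ j := by
  have h := norm_localParam q hk
  have h1 : Summable fun j : ℕ => 2 * (q * ‖localParam q k‖) ^ j :=
    (summable_geometric_of_lt_one (by positivity) (by linarith)).mul_left 2
  refine Summable.of_norm_bounded h1 fun j => ?_
  rw [norm_mul, norm_pow, mul_pow, ← mul_assoc, Complex.norm_natCast]
  gcongr
  exact_mod_cast zeroCount_le q j T

theorem singularTerm_pow (k : ℕ) (T : ℤ × ℤ × ℤ) (e : ℕ) :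
    singularTerm k T (q ^ e) = isoSum (q ^ e) T * (((q : ℂ) ^ k)⁻¹) ^ e := by
  rw [singularTerm_of_ne]
  push_cast
  rw [inv_pow, ← pow_mul, ← pow_mul, mul_comm e k]

theorem summable_localSum {k : ℕ} (hk : 4 ≤ k) (T : ℤ × ℤ × ℤ) :
    Summable fun e : ℕ => singularTerm k T (q ^ e) :=
  (summable_singularTerm hk T).of_norm.comp_injective (Nat.pow_right_injective hq.out.two_le)

theorem zeroSeries_eq {k : ℕ} (hk : 4 ≤ k) (T : ℤ × ℤ × ℤ) : zeroSeries q k T =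
    1 + ∑' j : ℕ, (zeroCount q (j + 1) T : ℂ) * localParam q k ^ (j + 1) := by
  rw [zeroSeries, (summable_zeroSeries q hk T).tsum_eq_zero_add, zeroCount_zero]
  simp

theorem zeroSeries_eq' {k : ℕ} (hk : 4 ≤ k) (T : ℤ × ℤ × ℤ) : zeroSeries q k T =
    1 + zeroCount q 1 T * localParam q k +
      ∑' j : ℕ, (zeroCount q (j + 2) T : ℂ) * localParam q k ^ (j + 2) := by
  rw [zeroSeries_eq q hk, ((summable_nat_add_iff 1).2 (summable_zeroSeries q hk T)).tsum_eq_zero_add, add_assoc]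
  simp

/-- In `isoSum_pow` the difference of consecutive zero counts, weighted by q^(-k) per step, becomes
z_e Y^e - Y·(z_{e-1} Y^{e-1}) with Y = `localParam`. Summation yields the factor 1 - Y. -/
theorem localSum_eq {k : ℕ} (hk : 4 ≤ k) (T : ℤ × ℤ × ℤ) :
    localSum q k T = (1 - localParam q k) * zeroSeries q k T +
      ∑' j : ℕ, isoSumRest q (j + 1) T * (((q : ℂ) ^ k)⁻¹) ^ (j + 2) := by
  have hs := summable_localSum q hk T
  have hz := summable_zeroSeries q hk T
  have hz1 := (summable_nat_add_iff 1).2 hz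
  have hz2 := (summable_nat_add_iff 2).2 hz
  have hs2 := (summable_nat_add_iff 2).2 hs
  set Y := localParam q k with hY
  have h2 : ∀ j, isoSumRest q (j + 1) T * (((q : ℂ) ^ k)⁻¹) ^ (j + 2) = singularTerm k T (q ^ (j + 2)) -
      (zeroCount q (j + 2) T * Y ^ (j + 2) - Y * (zeroCount q (j + 1) T * Y ^ (j + 1))) := by
    intro j
    rw [singularTerm_pow, isoSum_pow, hY, localParam]
    ring
  have h3 : ∑' j : ℕ, isoSumRest q (j + 1) T * (((q : ℂ) ^ k)⁻¹) ^ (j + 2) =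
      ∑' j : ℕ, singularTerm k T (q ^ (j + 2)) - (∑' j : ℕ, zeroCount q (j + 2) T * Y ^ (j + 2) -
        Y * ∑' j : ℕ, zeroCount q (j + 1) T * Y ^ (j + 1)) := by
    rw [tsum_congr h2, (hs2.tsum_sub (hz2.sub (hz1.mul_left Y))), hz2.tsum_sub (hz1.mul_left Y), tsum_mul_left]
  have h4 : localSum q k T = 1 + Y * (zeroCount q 1 T - 1) + ∑' j : ℕ, singularTerm k T (q ^ (j + 2)) := by
    rw [localSum, ← hs.sum_add_tsum_nat_add 2, Finset.sum_range_succ, Finset.sum_range_one, singularTerm_pow,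
      singularTerm_pow, isoSum_prime]
    have : isoSum (q ^ 0) T = 1 := isoSum_one T
    rw [this, hY, localParam]
    ring
  have h5 : (1 - Y) * zeroSeries q k T = zeroSeries q k T - Y * zeroSeries q k T := by ring
  rw [h5]
  nth_rewrite 1 [zeroSeries_eq' q hk]
  rw [zeroSeries_eq q hk, h4, h3]
  ring

theorem localSum_of_not_dvd {k : ℕ} (hk : 4 ≤ k) {T : ℤ × ℤ × ℤ} (hT : ¬DvdForm q T) :
    localSum q k T = (1 - localParam q k) * zeroSeries q k T := by
  rw [localSum_eq q hk]
  simp [isoSumRest_of_not_dvd q _ hT]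

theorem localSum_smulForm {k : ℕ} (hk : 4 ≤ k) (T : ℤ × ℤ × ℤ) :
    localSum q k (smulForm q T) = (1 - localParam q k) * zeroSeries q k (smulForm q T) +
      q * localParam q k ^ 2 * localSum q k T := by
  rw [localSum_eq q hk, localSum, ← tsum_mul_left]
  congr 1
  refine tsum_congr fun j => ?_
  rw [smulForm, isoSumRest_of_dvd, singularTerm_pow, localParam]
  ring

theorem rootCount_smulForm (j : ℕ) (T : ℤ × ℤ × ℤ) :
    rootCount q (j + 1) (smulForm q T) = q * rootCount q j T := by
  have := sum_redPow q j (fun y => if pairing T (1, y, y ^ 2) = 0 then 1 else 0)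
  rw [← Finset.card_filter, ← Finset.card_filter, smul_eq_mul] at this
  rw [rootCount, rootCount, ← this]
  congr 2
  ext c
  have h1 : pairing (smulForm q T) (1, c, c ^ 2) = q * pairing T (1, c, c ^ 2) := by
    simp only [pairing, smulForm]
    push_cast
    ring
  rw [h1, mul_eq_zero_iff_redPow, map_pairing]
  simp [mapTriple]

theorem rootCountInf_smulForm (j : ℕ) (T : ℤ × ℤ × ℤ) :
    rootCountInf q (j + 2) (smulForm q T) = q * rootCountInf q (j + 1) T := by
  rw [← card_not_isUnit_redPow, rootCountInf]
  congr 2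
  ext c
  have h1 : pairing (smulForm q T) (c ^ 2, c, 1) = q * pairing T (c ^ 2, c, 1) := by
    simp only [pairing, smulForm]
    push_cast
    ring
  rw [h1, mul_eq_zero_iff_redPow]

theorem rootCountInf_one_smulForm (T : ℤ × ℤ × ℤ) : rootCountInf q 1 (smulForm q T) = 1 := by
  rw [rootCountInf, Finset.card_eq_one]
  refine ⟨0, ?_⟩
  ext x
  rw [Finset.mem_filter, Finset.mem_filter, not_isUnit_pow_one, Finset.mem_singleton]
  constructor
  · exact fun h => h.1.2
  · rintro rfl
    refine ⟨⟨Finset.mem_univ _, rfl⟩, ?_⟩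
    rw [← not_isUnit_pow_one, not_isUnit_iff q 0]
    exact ⟨T.2.2, by simp [pairing, smulForm]⟩

/-- All q + 1 points of the projective line are zeros of qT modulo q. At higher levels the zeros of
qT are the lifts of zeros of T one level down, q for each. -/
theorem zeroSeries_smulForm {k : ℕ} (hk : 4 ≤ k) (T : ℤ × ℤ × ℤ) : zeroSeries q k (smulForm q T) =
    1 + localParam q k + q * localParam q k * zeroSeries q k T := by
  rw [zeroSeries_eq' q hk, zeroSeries_eq q hk T, mul_add, ← tsum_mul_left, zeroCount, rootCount_smulForm,
    rootCountInf_one_smulForm, rootCount_zero]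
  have : ∀ j : ℕ, (zeroCount q (j + 2) (smulForm q T) : ℂ) * localParam q k ^ (j + 2) =
      q * localParam q k * ((zeroCount q (j + 1) T : ℂ) * localParam q k ^ (j + 1)) := by
    intro j
    rw [zeroCount, rootCount_smulForm, rootCountInf_smulForm, zeroCount]
    push_cast
    ring
  rw [tsum_congr this]
  push_cast
  ring

theorem rootCountInf_eq_zero (j : ℕ) {T : ℤ × ℤ × ℤ} (hT : ¬(q : ℤ) ∣ T.2.2) : rootCountInf q j T = 0 := by
  rcases j with _ | j
  · exact rootCountInf_zero q T
  rw [rootCountInf, Finset.card_eq_zero, Finset.filter_eq_empty_iff]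
  intro c hc h
  refine hT ?_
  rw [← not_isUnit_intCast_iff q j, not_isUnit_iff]
  obtain ⟨y, rfl⟩ := (not_isUnit_iff q j c).1 (Finset.mem_filter.1 hc).2
  refine ⟨-(T.1 * q * y ^ 2 + T.2.1 * y), ?_⟩
  rw [pairing] at h
  linear_combination h

theorem zeroCount_eq (j : ℕ) {T : ℤ × ℤ × ℤ} (hT : ¬(q : ℤ) ∣ T.2.2) : zeroCount q j T = rootCount q j T := by
  rw [zeroCount, rootCountInf_eq_zero q j hT, add_zero]

theorem not_isUnit_of_raiseForm (j : ℕ) {T : ℤ × ℤ × ℤ} (hT : ¬(q : ℤ) ∣ T.2.2) {c : ZMod (q ^ (j + 1))}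
    (hc : pairing (raiseForm q T) (1, c, c ^ 2) = 0) : ¬IsUnit c := by
  intro hu
  refine hT ?_
  rw [← not_isUnit_intCast_iff q j]
  have h1 : ¬IsUnit ((T.2.2 : ZMod (q ^ (j + 1))) * c ^ 2) := by
    rw [not_isUnit_iff]
    refine ⟨-(q * T.1 + T.2.1 * c), ?_⟩
    simp only [pairing, raiseForm] at hc
    push_cast at hc
    linear_combination hc
  exact fun h => h1 (h.mul (hu.pow 2))

theorem rootCount_one_raiseForm {T : ℤ × ℤ × ℤ} (hT : ¬(q : ℤ) ∣ T.2.2) : rootCount q 1 (raiseForm q T) = 1 := by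
  rw [rootCount, Finset.card_eq_one]
  refine ⟨0, ?_⟩
  ext x
  rw [Finset.mem_filter, Finset.mem_singleton]
  constructor
  · exact fun h => (not_isUnit_pow_one q x).1 (not_isUnit_of_raiseForm q 0 hT h.2)
  · rintro rfl
    refine ⟨Finset.mem_univ _, ?_⟩
    rw [← not_isUnit_pow_one, not_isUnit_iff q 0]
    exact ⟨q * T.1, by simp [pairing, raiseForm]; ring⟩

theorem rootCount_raiseForm (j : ℕ) {T : ℤ × ℤ × ℤ} (hT : ¬(q : ℤ) ∣ T.2.2) :
    rootCount q (j + 2) (raiseForm q T) = q * rootCount q j T := by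
  have h := sum_redPow q j (fun y => if pairing T (1, y, y ^ 2) = 0 then 1 else 0)
  rw [← Finset.card_filter, ← Finset.card_filter, smul_eq_mul] at h
  rw [rootCount, rootCount, ← h]
  symm
  have key : ∀ X : ZMod (q ^ (j + 2)), pairing (raiseForm q T) (1, (q * X), (q * X) ^ 2) = 0 ↔
      pairing T (1, redPow q j (redPow q (j + 1) X), redPow q j (redPow q (j + 1) X) ^ 2) = 0 := by
    intro X
    have h1 : pairing (raiseForm q T) (1, (q * X), (q * X) ^ 2) = q * (q * pairing T (1, X, X ^ 2)) := by
      simp only [pairing, raiseForm]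
      push_cast
      ring
    rw [h1, mul_eq_zero_iff_redPow, map_mul, map_natCast, mul_eq_zero_iff_redPow, map_pairing, map_pairing]
    simp [mapTriple]
  refine Finset.card_nbij (mulPow q (j + 1)) ?_ ?_ ?_
  · intro y hy
    obtain ⟨X, rfl⟩ := redPow_surjective q (j + 1) y
    rw [Finset.mem_coe, Finset.mem_filter] at hy
    rw [mulPow_redPow, Finset.mem_coe, Finset.mem_filter]
    exact ⟨Finset.mem_univ _, (key X).2 hy.2⟩
  · exact fun _ _ _ _ h => mulPow_injective q _ h
  · intro c hc
    simp only [Finset.coe_filter, Finset.mem_univ, true_and, Set.mem_ofPred_eq] at hc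
    obtain ⟨X, rfl⟩ := (not_isUnit_iff q _ c).1 (not_isUnit_of_raiseForm q _ hT hc)
    refine ⟨redPow q (j + 1) X, ?_, mulPow_redPow q _ X⟩
    simp only [Finset.coe_filter, Finset.mem_univ, true_and, Set.mem_ofPred_eq]
    exact (key X).1 hc

/-- With unit last coefficient every zero c is divisible by q. Writing c = qx turns the condition
modulo q^(j+2) into T(1, x) = 0 modulo q^j, and x matters modulo q^(j+1), which gives q lifts. -/
theorem zeroSeries_raiseForm {k : ℕ} (hk : 4 ≤ k) {T : ℤ × ℤ × ℤ} (hT : ¬(q : ℤ) ∣ T.2.2) :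
    zeroSeries q k (raiseForm q T) = 1 + localParam q k + q * localParam q k ^ 2 * zeroSeries q k T := by
  have hT' : ¬(q : ℤ) ∣ (raiseForm q T).2.2 := hT
  rw [zeroSeries_eq' q hk, zeroSeries, ← tsum_mul_left, zeroCount_eq q 1 hT', rootCount_one_raiseForm q hT]
  have : ∀ j : ℕ, (zeroCount q (j + 2) (raiseForm q T) : ℂ) * localParam q k ^ (j + 2) =
      q * localParam q k ^ 2 * ((zeroCount q j T : ℂ) * localParam q k ^ j) := by
    intro j
    rw [zeroCount_eq q _ hT', rootCount_raiseForm q j hT, zeroCount_eq q j hT]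
    push_cast
    ring
  rw [tsum_congr this]
  push_cast
  ring

end PrimePower

end SiegelTwo
end

/-! ### Zero counts for discriminants minimal at q -/

noncomputable section
namespace SiegelTwo
open Complex

section PrimePower

variable (q : ℕ) [hq : Fact q.Prime]

theorem one_sub_localParam_ne_zero {k : ℕ} (hk : 4 ≤ k) : 1 - localParam q k ≠ 0 := by
  intro h
  have h1 : localParam q k = 1 := (sub_eq_zero.1 h).symm
  have h2 := norm_localParam q hk
  rw [h1, norm_one, mul_one] at h2
  have h3 : (2 : ℝ) ≤ q := by exact_mod_cast hq.out.two_le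
  linarith

/-- For χ = ±1 the geometric series 1 + (1 + χ)Y/(1 - Y) equals (1 + Y)/(1 - χY). -/
theorem zeroSeries_of_rootCount_eq {k : ℕ} (hk : 4 ≤ k) {T : ℤ × ℤ × ℤ} (hT : ¬(q : ℤ) ∣ T.2.2) {χ : ℤ}
    (hχ : χ ^ 2 = 1) (h : ∀ j, (rootCount q (j + 1) T : ℤ) = 1 + χ) :
    zeroSeries q k T * (1 - χ * localParam q k) = 1 + localParam q k := by
  set Y := localParam q k with hY
  have hY1 : 1 - Y ≠ 0 := one_sub_localParam_ne_zero q hk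
  have hYn : ‖Y‖ < 1 := by
    have h2 := norm_localParam q hk
    have h3 : (2 : ℝ) ≤ q := by exact_mod_cast hq.out.two_le
    nlinarith [norm_nonneg (localParam q k)]
  have h1 : zeroSeries q k T = 1 + (1 + χ) * (Y * (1 - Y)⁻¹) := by
    rw [zeroSeries_eq q hk, ← tsum_geometric_of_norm_lt_one hYn, ← tsum_mul_left, ← tsum_mul_left]
    congr 1
    refine tsum_congr fun j => ?_
    rw [zeroCount_eq q _ hT]
    have : (rootCount q (j + 1) T : ℂ) = 1 + χ := by exact_mod_cast h j
    rw [this]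
    ring
  have hχ' : (χ : ℂ) ^ 2 = 1 := by exact_mod_cast hχ
  rw [h1]
  field_simp
  linear_combination (-Y ^ 2) * hχ'

theorem zeroSeries_of_ramified {k : ℕ} (hk : 4 ≤ k) {T : ℤ × ℤ × ℤ} (hT : ¬(q : ℤ) ∣ T.2.2)
    (h1 : rootCount q 1 T = 1) (h : ∀ j, rootCount q (j + 2) T = 0) :
    zeroSeries q k T = 1 + localParam q k := by
  rw [zeroSeries_eq' q hk, zeroCount_eq q _ hT, h1]
  have : ∀ j : ℕ, (zeroCount q (j + 2) T : ℂ) * localParam q k ^ (j + 2) = 0 := by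
    intro j
    rw [zeroCount_eq q _ hT, h]
    simp
  rw [tsum_congr this, tsum_zero]
  simp

/-- Hensel's lemma for the zeros of a form of discriminant prime to `q`. -/
theorem rootCount_succ (j : ℕ) {T : ℤ × ℤ × ℤ} (hT : ¬(q : ℤ) ∣ discForm T) :
    rootCount q (j + 2) T = rootCount q (j + 1) T := by
  have hu : ∀ x : ZMod (q ^ (j + 1)), pairing T (1, x, x ^ 2) = 0 → IsUnit (T.2.1 + 2 * T.2.2 * x : ZMod (q ^ (j + 1))) := by
    intro x hx
    have h1 : IsUnit ((discForm T : ℤ) : ZMod (q ^ (j + 1))) := by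
      by_contra h
      exact hT ((not_isUnit_intCast_iff q j _).1 h)
    have h2 : ((discForm T : ℤ) : ZMod (q ^ (j + 1))) = (T.2.1 + 2 * T.2.2 * x) ^ 2 := by
      simp only [pairing] at hx
      simp only [discForm]
      push_cast
      linear_combination (-4 * (T.2.2 : ZMod (q ^ (j + 1)))) * hx
    rw [h2] at h1
    exact (isUnit_pow_iff two_ne_zero).1 h1
  have hred : ∀ c : ZMod (q ^ (j + 2)), redPow q (j + 1) (pairing T (1, c, c ^ 2)) =
      pairing T (1, redPow q (j + 1) c, redPow q (j + 1) c ^ 2) := by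
    intro c
    rw [map_pairing]
    simp [mapTriple]
  refine Finset.card_nbij (redPow q (j + 1)) ?_ ?_ ?_
  · intro c hc
    simp only [Finset.coe_filter, Finset.mem_univ, true_and, Set.mem_ofPred_eq] at hc ⊢
    rw [← hred, hc, map_zero]
  · intro c hc d hd h
    simp only [Finset.coe_filter, Finset.mem_univ, true_and, Set.mem_ofPred_eq] at hc hd
    have h1 : (c - d) * (T.2.1 + T.2.2 * (c + d)) = 0 := by
      simp only [pairing] at hc hd
      linear_combination hc - hd
    have h2 : IsUnit (T.2.1 + T.2.2 * (c + d) : ZMod (q ^ (j + 2))) := by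
      rw [← isUnit_redPow_iff]
      have h3 := hu (redPow q (j + 1) c) (by rw [← hred, hc, map_zero])
      convert h3 using 1
      simp only [map_add, map_mul, map_intCast, h]
      ring
    exact sub_eq_zero.1 ((IsUnit.mul_left_eq_zero h2).1 h1)
  · intro x hx
    simp only [Finset.coe_filter, Finset.mem_univ, true_and, Set.mem_ofPred_eq] at hx
    obtain ⟨X, rfl⟩ := redPow_surjective q (j + 1) x
    have h3 : IsUnit (T.2.1 + 2 * T.2.2 * X : ZMod (q ^ (j + 2))) := by
      rw [← isUnit_redPow_iff]
      convert hu _ hx using 1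
      simp only [map_add, map_mul, map_intCast, two_mul]
    obtain ⟨w, hw⟩ := h3.exists_right_inv
    set F := pairing T (1, X, X ^ 2) with hF
    have h4 : redPow q (j + 1) F = 0 := by rw [hF, hred, hx]
    have h5 : F ^ 2 = 0 := by
      have : ¬IsUnit F := by
        rw [← isUnit_redPow_iff, h4]
        exact (not_isUnit_iff q j _).2 ⟨0, by simp⟩
      obtain ⟨y, hy⟩ := (not_isUnit_iff q _ _).1 this
      have h6 := (mul_eq_zero_iff_redPow q (j + 1) F).2 h4
      calc F ^ 2 = (q * F) * y := by nth_rewrite 1 [pow_two, hy]; rw [mul_right_comm]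
        _ = 0 := by rw [h6, zero_mul]
    -- One Newton step: w inverts the derivative at X, and the quadratic error vanishes because F² =
    -- 0.
    refine ⟨X - F * w, ?_, by rw [map_sub, map_mul, h4, zero_mul, sub_zero]⟩
    simp only [Finset.coe_filter, Finset.mem_univ, true_and, Set.mem_ofPred_eq]
    have h7 : pairing T (1, X - F * w, (X - F * w) ^ 2) = F - F * ((T.2.1 + 2 * T.2.2 * X) * w) + T.2.2 * w ^ 2 * F ^ 2 := by
      rw [hF]
      simp only [pairing]
      ring
    rw [h7, hw, h5]
    ring

theorem rootCount_one (T : ℤ × ℤ × ℤ) : rootCount q 1 T =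
    (Finset.univ.filter fun c : ZMod q => pairing T (1, c, c ^ 2) = 0).card := by
  have : ∀ (a : ℕ) [NeZero a], a = q → (Finset.univ.filter fun c : ZMod a => pairing T (1, c, c ^ 2) = 0).card =
      (Finset.univ.filter fun c : ZMod q => pairing T (1, c, c ^ 2) = 0).card := by
    rintro a _ rfl
    rfl
  exact this (q ^ 1) (pow_one q)

/-- Completing the square, y = 2mc + r, identifies zeros with square roots of the discriminant. -/
theorem rootCount_one_of_odd (h2 : q ≠ 2) {T : ℤ × ℤ × ℤ} (hT : ¬(q : ℤ) ∣ T.2.2) :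
    (rootCount q 1 T : ℤ) = 1 + legendreSym q (discForm T) := by
  rw [rootCount_one, add_comm, ← legendreSym.card_sqrts q h2]
  have hm : (T.2.2 : ZMod q) ≠ 0 := by
    rwa [Ne, ZMod.intCast_zmod_eq_zero_iff_dvd]
  have h20 : (2 : ZMod q) ≠ 0 := by
    have : ((2 : ℕ) : ZMod q) ≠ 0 := by
      rw [Ne, ZMod.natCast_eq_zero_iff]
      exact fun h => h2 ((Nat.prime_dvd_prime_iff_eq hq.out Nat.prime_two).1 h)
    exact_mod_cast this
  norm_cast
  refine Finset.card_nbij' (fun c => 2 * T.2.2 * c + T.2.1) (fun y => (y - T.2.1) / (2 * T.2.2)) ?_ ?_ ?_ ?_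
  · intro c hc
    have hc := (Finset.mem_filter.1 (Finset.mem_coe.1 hc)).2
    rw [Finset.mem_coe, Set.mem_toFinset]
    change (2 * T.2.2 * c + T.2.1) ^ 2 = ((discForm T : ℤ) : ZMod q)
    simp only [pairing, discForm] at hc ⊢
    push_cast
    linear_combination (4 * (T.2.2 : ZMod q)) * hc
  · intro y hy
    rw [Finset.mem_coe, Set.mem_toFinset] at hy
    change y ^ 2 = ((discForm T : ℤ) : ZMod q) at hy
    rw [Finset.mem_coe, Finset.mem_filter]
    refine ⟨Finset.mem_univ _, ?_⟩
    simp only [pairing, discForm] at hy ⊢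
    push_cast at hy
    have h4 : (4 : ZMod q) ≠ 0 := by
      have : (4 : ZMod q) = 2 * 2 := by norm_num
      rw [this]
      exact mul_ne_zero h20 h20
    field_simp
    linear_combination hy
  · intro c _
    field_simp
    ring
  · intro y _
    field_simp
    ring

theorem exists_int_of_rootCount_ne_zero {j : ℕ} {T : ℤ × ℤ × ℤ} (h : rootCount q (j + 2) T ≠ 0) :
    ∃ c : ℤ, (q : ℤ) ^ 2 ∣ T.1 + T.2.1 * c + T.2.2 * c ^ 2 := by
  obtain ⟨c, hc⟩ := Finset.card_ne_zero.1 h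
  obtain ⟨c, rfl⟩ := ZMod.intCast_surjective c
  refine ⟨c, ?_⟩
  have h1 : ((T.1 + T.2.1 * c + T.2.2 * c ^ 2 : ℤ) : ZMod (q ^ (j + 2))) = 0 := by
    have := (Finset.mem_filter.1 hc).2
    simp only [pairing, mul_one] at this
    push_cast
    exact this
  rw [ZMod.intCast_zmod_eq_zero_iff_dvd] at h1
  push_cast at h1
  exact (pow_dvd_pow _ (by omega)).trans h1

/-- If q divides the discriminant, it divides 2mc + r at any zero c. A zero modulo q² would then
make q² divide the discriminant, so the unique zero modulo q does not lift. Otherwise Hensel's lemma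
keeps the count constant. -/
theorem zeroSeries_of_odd {k : ℕ} (hk : 4 ≤ k) (h2 : q ≠ 2) {T : ℤ × ℤ × ℤ} (hT : ¬(q : ℤ) ∣ T.2.2)
    (hD : ¬(q : ℤ) ^ 2 ∣ discForm T) :
    zeroSeries q k T * (1 - legendreSym q (discForm T) * localParam q k) = 1 + localParam q k := by
  by_cases h : (q : ℤ) ∣ discForm T
  · have h0 : legendreSym q (discForm T) = 0 := by
      rw [legendreSym.eq_zero_iff, ZMod.intCast_zmod_eq_zero_iff_dvd]
      exact h
    rw [h0, zeroSeries_of_ramified q hk hT]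
    · simp
    · have := rootCount_one_of_odd q h2 hT
      rw [h0] at this
      exact_mod_cast this
    · intro j
      by_contra hne
      obtain ⟨c, hc⟩ := exists_int_of_rootCount_ne_zero q hne
      have e1 : discForm T = (2 * T.2.2 * c + T.2.1) ^ 2 - 4 * T.2.2 * (T.1 + T.2.1 * c + T.2.2 * c ^ 2) := by
        rw [discForm]
        ring
      have hp := Nat.prime_iff_prime_int.1 hq.out
      have e2 : (q : ℤ) ∣ (2 * T.2.2 * c + T.2.1) ^ 2 := by
        have : (2 * T.2.2 * c + T.2.1) ^ 2 = discForm T + 4 * T.2.2 * (T.1 + T.2.1 * c + T.2.2 * c ^ 2) := by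
          rw [e1]; ring
        rw [this]
        exact dvd_add h (((dvd_pow_self _ two_ne_zero).trans hc).mul_left _)
      refine hD ?_
      rw [e1]
      exact dvd_sub (pow_dvd_pow_of_dvd (hp.dvd_of_dvd_pow e2) 2) (hc.mul_left _)
  · refine zeroSeries_of_rootCount_eq q hk hT ?_ ?_
    · refine legendreSym.sq_one q ?_
      rwa [Ne, ZMod.intCast_zmod_eq_zero_iff_dvd]
    · intro j
      rw [← rootCount_one_of_odd q h2 hT]
      induction j with
      | zero => rfl
      | succ j ih => rw [rootCount_succ q j h, ih]

end PrimePower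

/-- Modulo 2 the form is n + c + c², with two zeros if n is even and none if n is odd. These cases
are discriminant 1 and 5 modulo 8. -/
theorem zeroSeries_two_of_odd {k : ℕ} (hk : 4 ≤ k) {T : ℤ × ℤ × ℤ} (hT : ¬(2 : ℤ) ∣ T.2.2)
    (hD : ¬(2 : ℤ) ∣ discForm T) :
    zeroSeries 2 k T * (1 - (if discForm T % 8 = 1 then 1 else -1 : ℤ) * localParam 2 k) = 1 + localParam 2 k := by
  refine zeroSeries_of_rootCount_eq 2 hk hT (by split_ifs <;> rfl) ?_
  intro j
  have h1 : rootCount 2 (j + 1) T = rootCount 2 1 T := by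
    induction j with
    | zero => rfl
    | succ j ih => rw [rootCount_succ 2 j hD, ih]
  rw [h1, rootCount_one]
  have hr : T.2.1 % 2 = 1 := by
    by_contra h
    refine hD ?_
    rw [discForm, pow_two]
    exact dvd_sub (Dvd.dvd.mul_right (by omega) _) (Dvd.intro (2 * T.1 * T.2.2) (by ring))
  have hr' : ((T.2.1 : ℤ) : ZMod 2) = 1 := by
    rw [← ZMod.intCast_mod, Nat.cast_ofNat, hr]; rfl
  have hm' : ((T.2.2 : ℤ) : ZMod 2) = 1 := by
    rw [← ZMod.intCast_mod, Nat.cast_ofNat, show T.2.2 % 2 = 1 by omega]; rfl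
  simp only [pairing, hr', hm']
  have hd : discForm T % 8 = 1 ↔ T.1 % 2 = 0 := by
    obtain ⟨r, hr2⟩ : ∃ r, T.2.1 = 2 * r + 1 := ⟨T.2.1 / 2, by omega⟩
    obtain ⟨m, hm2⟩ : ∃ m, T.2.2 = 2 * m + 1 := ⟨T.2.2 / 2, by omega⟩
    obtain ⟨s, hs⟩ : ∃ s, r * (r + 1) = 2 * s := by
      obtain ⟨s, hs⟩ := Int.even_mul_succ_self r
      exact ⟨s, by rw [hs]; ring⟩
    have : discForm T = 8 * (s - T.1 * m) + 1 - 4 * T.1 := by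
      rw [discForm, hr2, hm2]
      linear_combination 4 * hs
    rw [this]
    omega
  rcases Int.emod_two_eq_zero_or_one T.1 with h | h
  · have : ((T.1 : ℤ) : ZMod 2) = 0 := by
      rw [← ZMod.intCast_mod, Nat.cast_ofNat, h]; rfl
    rw [this, if_pos (hd.2 h)]
    decide
  · have : ((T.1 : ℤ) : ZMod 2) = 1 := by
      rw [← ZMod.intCast_mod, Nat.cast_ofNat, h]; rfl
    rw [this, if_neg (fun h' => by rw [hd] at h'; omega)]
    decide

/-- Here r is even and m·T(1, c) = (mc + r/2)² - E. A zero modulo 4 would make E a square modulo 4,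
that is 0 or 1. -/
theorem zeroSeries_two_of_even {k : ℕ} (hk : 4 ≤ k) {T : ℤ × ℤ × ℤ} (hT : ¬(2 : ℤ) ∣ T.2.2) {E : ℤ}
    (hE : discForm T = 4 * E) (hE' : E % 4 = 2 ∨ E % 4 = 3) :
    zeroSeries 2 k T = 1 + localParam 2 k := by
  have hr : T.2.1 % 2 = 0 := by
    by_contra h
    obtain ⟨r, hr2⟩ : ∃ r, T.2.1 = 2 * r + 1 := ⟨T.2.1 / 2, by omega⟩
    have : discForm T = 4 * (r ^ 2 + r - T.1 * T.2.2) + 1 := by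
      rw [discForm, hr2]
      ring
    omega
  refine zeroSeries_of_ramified 2 hk hT ?_ ?_
  · rw [rootCount_one]
    have hr' : ((T.2.1 : ℤ) : ZMod 2) = 0 := by
      rw [← ZMod.intCast_mod, Nat.cast_ofNat, hr]; rfl
    have hm' : ((T.2.2 : ℤ) : ZMod 2) = 1 := by
      rw [← ZMod.intCast_mod, Nat.cast_ofNat, show T.2.2 % 2 = 1 by omega]; rfl
    simp only [pairing, hr', hm']
    generalize ((T.1 : ℤ) : ZMod 2) = n
    revert n
    decide
  · intro j
    by_contra hne
    obtain ⟨c, d, hc⟩ := exists_int_of_rootCount_ne_zero 2 hne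
    obtain ⟨r, hr2⟩ : ∃ r, T.2.1 = 2 * r := ⟨T.2.1 / 2, by omega⟩
    have h1 : E = r ^ 2 - T.1 * T.2.2 := by
      rw [discForm, hr2] at hE
      linarith
    have h2 : E = (T.2.2 * c + r) ^ 2 - 4 * (T.2.2 * d) := by
      rw [hr2] at hc
      push_cast at hc
      linear_combination h1 - T.2.2 * hc
    obtain ⟨x, hx | hx⟩ := Int.even_or_odd' (T.2.2 * c + r)
    · rw [hx] at h2
      have : E = 4 * (x ^ 2 - T.2.2 * d) := by rw [h2]; ring
      omega
    · rw [hx] at h2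
      have : E = 4 * (x ^ 2 + x - T.2.2 * d) + 1 := by rw [h2]; ring
      omega

end SiegelTwo
end

/-! ### Fundamental discriminants and the local factors -/

noncomputable section
namespace SiegelTwo
open Complex

/-- Fundamental discriminants (including `1`). -/
def IsFundamental (D : ℤ) : Prop :=
  (D % 4 = 0 ∨ D % 4 = 1) ∧ ∀ q : ℕ, q.Prime → ∀ E, D = q ^ 2 * E → ¬(E % 4 = 0 ∨ E % 4 = 1)

/-- The Kronecker symbol `(D/q)` at a prime `q`, for a fundamental discriminant `D`. -/
def kronecker (D : ℤ) (q : ℕ) [Fact q.Prime] : ℤ :=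
  if q = 2 then (if D % 2 = 0 then 0 else if D % 8 = 1 then 1 else -1) else legendreSym q D

section PrimePower

variable (q : ℕ) [hq : Fact q.Prime]

theorem int_prime : Prime (q : ℤ) := Nat.prime_iff_prime_int.1 hq.out

theorem sq_emod_four_of_odd {x : ℤ} (h : x % 2 = 1) : x ^ 2 % 8 = 1 := by
  obtain ⟨y, hy⟩ : ∃ y, x = 2 * y + 1 := ⟨x / 2, by omega⟩
  obtain ⟨s, hs⟩ := Int.even_mul_succ_self y
  have : x ^ 2 = 8 * s + 1 := by
    rw [hy]
    linear_combination 4 * hs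
  omega

theorem emod_four_of_mul {D E s : ℤ} (hs : s % 8 = 1) (h : D = s * E) : D % 8 = E % 8 := by
  obtain ⟨t, ht⟩ : ∃ t, s = 8 * t + 1 := ⟨s / 8, by omega⟩
  have : D = 8 * (t * E) + E := by
    rw [h, ht]
    ring
  omega

theorem odd_prime_emod (h2 : q ≠ 2) : (q : ℤ) % 2 = 1 := by
  have := hq.out.odd_of_ne_two h2
  have := Nat.odd_iff.1 this
  omega

/-- If q did not divide f, then q² would divide D with a quotient that is again 0 or 1 modulo 4. -/
theorem IsFundamental.dvd {D : ℤ} (hD : IsFundamental D) {f E : ℤ} (h : D * f ^ 2 = q ^ 2 * E)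
    (hE : E % 4 = 0 ∨ E % 4 = 1) : (q : ℤ) ∣ f := by
  by_contra hf
  have hqp := int_prime q
  have h1 : (q : ℤ) ^ 2 ∣ D := by
    have hc : IsCoprime ((q : ℤ) ^ 2) (f ^ 2) :=
      IsCoprime.pow (hqp.irreducible.coprime_iff_not_dvd.2 hf)
    exact hc.dvd_of_dvd_mul_right ⟨E, h⟩
  obtain ⟨E', hE'⟩ := h1
  have hq0 : (q : ℤ) ^ 2 ≠ 0 := pow_ne_zero _ hqp.ne_zero
  have h2 : E = f ^ 2 * E' := by
    refine mul_left_cancel₀ hq0 ?_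
    rw [← h, hE']
    ring
  refine hD.2 q hq.out E' hE' ?_
  by_cases hq2 : q = 2
  · subst hq2
    have := emod_four_of_mul (sq_emod_four_of_odd (x := f) (by omega)) h2
    omega
  · have := emod_four_of_mul (sq_emod_four_of_odd (odd_prime_emod q hq2)) hE'
    have := hD.1
    omega

theorem zeroSeries_kronecker {k : ℕ} (hk : 4 ≤ k) {D : ℤ} (hD : IsFundamental D) {T : ℤ × ℤ × ℤ}
    (hT : ¬(q : ℤ) ∣ T.2.2) {f : ℤ} (hf : ¬(q : ℤ) ∣ f) (h : discForm T = D * f ^ 2) :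
    zeroSeries q k T * (1 - kronecker D q * localParam q k) = 1 + localParam q k := by
  have hqp := int_prime q
  by_cases hq2 : q = 2
  · subst hq2
    have hf8 : f ^ 2 % 8 = 1 := sq_emod_four_of_odd (x := f) (by omega)
    have hm := emod_four_of_mul hf8 (h.trans (mul_comm _ _))
    rw [kronecker, if_pos rfl]
    split_ifs with h0 h1
    · have hD1 := hD.1
      obtain ⟨E, hE⟩ : ∃ E, D = 4 * E := ⟨D / 4, by omega⟩
      have hE' := hD.2 2 Nat.prime_two E (by rw [hE]; norm_num)
      have e1 := emod_four_of_mul hf8 (rfl : f ^ 2 * E = f ^ 2 * E)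
      rw [zeroSeries_two_of_even hk hT (E := f ^ 2 * E) (by rw [h, hE]; ring) (by omega)]
      simp
    · have := zeroSeries_two_of_odd hk hT (by omega)
      rwa [if_pos (by omega)] at this
    · have := zeroSeries_two_of_odd hk hT (by omega)
      rwa [if_neg (by omega)] at this
  · rw [kronecker, if_neg hq2]
    have h1 : legendreSym q (discForm T) = legendreSym q D := by
      rw [h, legendreSym.mul, legendreSym.sq_one', mul_one]
      rwa [Ne, ZMod.intCast_zmod_eq_zero_iff_dvd]
    rw [← h1]
    refine zeroSeries_of_odd q hk hq2 hT ?_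
    rintro ⟨E, hE⟩
    refine hf (hD.dvd q (h.symm.trans hE) ?_)
    have := emod_four_of_mul (sq_emod_four_of_odd (odd_prime_emod q hq2)) hE
    have := discForm_emod_four T
    omega

theorem localSum_swapForm (k : ℕ) (T : ℤ × ℤ × ℤ) : localSum q k (swapForm T) = localSum q k T :=
  localSum_congr q (fun a _ => isoSum_swapForm a T) k

theorem localSum_shearForm (k : ℕ) (c : ℤ) (T : ℤ × ℤ × ℤ) : localSum q k (shearForm c T) = localSum q k T :=
  localSum_congr q (fun a _ => isoSum_shearForm a c T) k

/-- A form not divisible by q takes a value prime to q at (1, 0), (0, 1) or (1, 1), and a unimodular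
substitution makes that value the last coefficient. -/
theorem exists_last_unit {T : ℤ × ℤ × ℤ} (hT : ¬DvdForm q T) (k : ℕ) : ∃ S : ℤ × ℤ × ℤ,
    ¬(q : ℤ) ∣ S.2.2 ∧ discForm S = discForm T ∧ localSum q k S = localSum q k T := by
  by_cases h3 : (q : ℤ) ∣ T.2.2
  · by_cases h1 : (q : ℤ) ∣ T.1
    · refine ⟨swapForm (shearForm 1 T), ?_, ?_, ?_⟩
      · intro h
        refine hT ⟨h1, ?_, h3⟩
        have : T.2.1 = (swapForm (shearForm 1 T)).2.2 - T.1 - T.2.2 := by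
          simp only [swapForm, shearForm]
          ring
        rw [this]
        exact dvd_sub (dvd_sub h h1) h3
      · rw [discForm_swapForm, discForm_shearForm]
      · rw [localSum_swapForm, localSum_shearForm]
    · exact ⟨swapForm T, h1, discForm_swapForm T, localSum_swapForm q k T⟩
  · exact ⟨T, h3, rfl, rfl⟩

/-- The shear moves the double root modulo q to 0. For odd q, once q divides the middle coefficient
r', the identity 4mn' = r'² - disc shows that q² divides the first coefficient n'. -/
theorem exists_shearForm_eq_raiseForm {T : ℤ × ℤ × ℤ} (hT : ¬(q : ℤ) ∣ T.2.2) {E : ℤ}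
    (h : discForm T = q ^ 2 * E) (hE : E % 4 = 0 ∨ E % 4 = 1) :
    ∃ c S, shearForm c T = raiseForm q S ∧ S.2.2 = T.2.2 := by
  have hqp := int_prime q
  suffices hs : ∃ c, (q : ℤ) ^ 2 ∣ (shearForm c T).1 ∧ (q : ℤ) ∣ (shearForm c T).2.1 by
    obtain ⟨c, ⟨n, hn⟩, ⟨r, hr⟩⟩ := hs
    exact ⟨c, (n, r, T.2.2), Prod.ext hn (Prod.ext hr rfl), rfl⟩
  by_cases hq2 : q = 2
  · subst hq2
    obtain ⟨r, hr⟩ : ∃ r, T.2.1 = 2 * r := by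
      refine ⟨T.2.1 / 2, ?_⟩
      by_contra hne
      have := sq_emod_four_of_odd (x := T.2.1) (by omega)
      have e : T.2.1 ^ 2 = 4 * (E + T.1 * T.2.2) := by
        rw [discForm] at h
        push_cast at h
        linear_combination h
      omega
    have hE2 : r ^ 2 - T.1 * T.2.2 = E := by
      rw [discForm, hr] at h
      push_cast at h
      linarith
    -- Here m·T(1, c) = (r + mc)² - E with m odd. For c = E - r the base is congruent to E modulo 2,
    -- so the value is E(E - 1) modulo 4, which vanishes exactly because E is 0 or 1 modulo 4.
    refine ⟨E - r, ?_, ?_⟩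
    · have hc : IsCoprime ((2 : ℕ) ^ 2 : ℤ) T.2.2 :=
        IsCoprime.pow_left (hqp.irreducible.coprime_iff_not_dvd.2 hT)
      refine hc.dvd_of_dvd_mul_left ?_
      have e1 : T.2.2 * (shearForm (E - r) T).1 = (r + T.2.2 * (E - r)) ^ 2 - E := by
        simp only [shearForm]
        rw [hr]
        linear_combination (-1 : ℤ) * hE2
      rw [e1]
      obtain ⟨m, hm⟩ : ∃ m, T.2.2 = 2 * m + 1 := ⟨T.2.2 / 2, by push_cast at hT; omega⟩
      have e2 : r + T.2.2 * (E - r) = E + 2 * (m * (E - r)) := by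
        rw [hm]; ring
      rw [e2]
      have e3 : (E + 2 * (m * (E - r))) ^ 2 - E = E * (E - 1) + 4 * (E * (m * (E - r)) + (m * (E - r)) ^ 2) := by
        ring
      rw [e3]
      refine dvd_add ?_ (Dvd.intro _ (by norm_num; rfl))
      push_cast
      rcases hE with hE | hE
      · exact Dvd.dvd.mul_right (by omega) _
      · exact Dvd.dvd.mul_left (by omega) _
    · simp only [shearForm, hr]
      exact ⟨r + T.2.2 * (E - r), by push_cast; ring⟩
  · have hodd := odd_prime_emod q hq2
    have h2 : ¬(q : ℤ) ∣ 2 * T.2.2 := by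
      intro hd
      rcases hqp.dvd_or_dvd hd with hd | hd
      · have := Int.le_of_dvd (by norm_num) hd
        have := hq.out.two_le
        omega
      · exact hT hd
    obtain ⟨u, w, huw⟩ := hqp.irreducible.coprime_iff_not_dvd.2 h2
    -- The integer w inverts 2m modulo q.
    refine ⟨-w * T.2.1, ?_⟩
    have h3 : (q : ℤ) ∣ (shearForm (-w * T.2.1) T).2.1 := by
      simp only [shearForm]
      exact ⟨u * T.2.1, by linear_combination (-T.2.1) * huw⟩
    refine ⟨?_, h3⟩
    have hc : IsCoprime ((q : ℤ) ^ 2) (2 * (2 * T.2.2)) := by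
      refine IsCoprime.pow_left (IsCoprime.mul_right ?_ (hqp.irreducible.coprime_iff_not_dvd.2 h2))
      refine hqp.irreducible.coprime_iff_not_dvd.2 fun hd => h2 (hd.mul_right _)
    refine hc.dvd_of_dvd_mul_left ?_
    have e1 : 2 * (2 * T.2.2) * (shearForm (-w * T.2.1) T).1 =
        (shearForm (-w * T.2.1) T).2.1 ^ 2 - discForm (shearForm (-w * T.2.1) T) := by
      rw [discForm]
      simp only [shearForm]
      ring
    rw [e1, discForm_shearForm, h]
    exact dvd_sub (pow_dvd_pow_of_dvd h3 2) (dvd_mul_right _ _)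

theorem localSum_of_last_unit {k : ℕ} (hk : 4 ≤ k) {T : ℤ × ℤ × ℤ} (hT : ¬(q : ℤ) ∣ T.2.2) :
    localSum q k T = (1 - localParam q k) * zeroSeries q k T :=
  localSum_of_not_dvd q hk fun h => hT h.2.2

theorem pow_mul_localParam {k : ℕ} (hk : 4 ≤ k) :
    (q : ℂ) ^ (2 * k - 3) * localParam q k = (q : ℂ) ^ (k - 2) := by
  have := prime_ne_zero q
  rw [localParam, show 2 * k - 3 = k + (k - 3) by omega, show k - 2 = (k - 3) + 1 by omega]
  field_simp
  ring

theorem pow_mul_localParam_sq {k : ℕ} (hk : 4 ≤ k) :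
    (q : ℂ) ^ (2 * k - 3) * (q * localParam q k ^ 2) = 1 := by
  have := prime_ne_zero q
  obtain ⟨m, rfl⟩ := Nat.exists_eq_add_of_le hk
  rw [localParam, show 2 * (4 + m) - 3 = 2 * m + 5 by omega]
  field_simp
  ring

/-- The local factor of the singular series at `q`, up to the Euler factors of `ζ` and `L`, is a
rational number with controlled denominator. -/
theorem exists_localFactor {k : ℕ} (hk : 4 ≤ k) {D : ℤ} (hD : IsFundamental D) (v : ℕ) :
    ∀ (T : ℤ × ℤ × ℤ) (f : ℤ), ¬(q : ℤ) ∣ f → discForm T = D * (q ^ v * f) ^ 2 →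
    ∃ Φ : ℂ, localSum q k T * (1 - kronecker D q * localParam q k) = (1 - localParam q k ^ 2) * Φ ∧
      (∃ n : ℤ, ((q : ℂ) ^ (2 * k - 3)) ^ v * Φ = n) ∧ (v = 0 → Φ = 1) := by
  induction v using Nat.strong_induction_on with
  | _ v ih =>
  intro T f hf h
  have hqp := int_prime q
  set Y := localParam q k with hY
  -- One factor W per power of q in the conductor clears denominators: WY is a power of q and W·qY²
  -- = 1.
  set W := (q : ℂ) ^ (2 * k - 3) with hW
  have hWY : W * Y = (q : ℂ) ^ (k - 2) := pow_mul_localParam q hk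
  have hWY2 : W * (q * Y ^ 2) = 1 := pow_mul_localParam_sq q hk
  rcases v with _ | v
  · have hT : ¬DvdForm q T := by
      intro hd
      obtain ⟨S, rfl⟩ := (dvdForm_iff q T).1 hd
      rw [discForm_smulForm] at h
      refine hf (hD.dvd q (E := discForm S) ?_ (discForm_emod_four S))
      rw [h]
      ring
    obtain ⟨S, hS, hd, hl⟩ := exists_last_unit q hT k
    refine ⟨1, ?_, ⟨1, by simp⟩, fun _ => rfl⟩
    rw [← hl, localSum_of_last_unit q hk hS, mul_assoc,
      zeroSeries_kronecker q hk hD hS hf (by rw [hd, h]; ring)]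
    ring
  have hq0 : (q : ℤ) ^ 2 ≠ 0 := pow_ne_zero _ hqp.ne_zero
  -- For T = qS both recursions apply and leave the unknown (1 - Y)·`zeroSeries` of S. It is the
  -- local sum of S if q does not divide S; if S = qR, it is that local sum minus qY² times the
  -- local sum of R.
  by_cases hT : DvdForm q T
  · obtain ⟨S, rfl⟩ := (dvdForm_iff q T).1 hT
    have hS : discForm S = D * (q ^ v * f) ^ 2 := by
      rw [discForm_smulForm] at h
      refine mul_left_cancel₀ hq0 ?_
      rw [h]
      ring
    obtain ⟨Φ, h1, ⟨a, ha⟩, -⟩ := ih v (by omega) S f hf hS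
    have hL : localSum q k (smulForm q S) = (1 - Y) * (1 + Y + q * Y * zeroSeries q k S) +
        q * Y ^ 2 * localSum q k S := by
      rw [localSum_smulForm q hk, zeroSeries_smulForm q hk]
    by_cases hS' : DvdForm q S
    · obtain ⟨R, rfl⟩ := (dvdForm_iff q S).1 hS'
      rcases v with _ | v
      · exfalso
        rw [discForm_smulForm] at hS
        refine hf (hD.dvd q (E := discForm R) ?_ (discForm_emod_four R))
        rw [hS]
        ring
      have hR : discForm R = D * (q ^ v * f) ^ 2 := by
        rw [discForm_smulForm] at hS
        refine mul_left_cancel₀ hq0 ?_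
        rw [hS]
        ring
      obtain ⟨Ψ, h2, ⟨b, hb⟩, -⟩ := ih v (by omega) R f hf hR
      have hL2 := localSum_smulForm q hk R
      refine ⟨(1 - kronecker D q * Y) + (q * Y + q * Y ^ 2) * Φ - q ^ 2 * Y ^ 3 * Ψ, ?_,
        ⟨(q ^ (2 * k - 3)) ^ (v + 2) - kronecker D q * q ^ (k - 2) * (q ^ (2 * k - 3)) ^ (v + 1) +
          (q ^ (k - 1) + 1) * a - q * q ^ (k - 2) * b, ?_⟩, by omega⟩
      · rw [hL]
        linear_combination (q * Y + q * Y ^ 2) * h1 - (q ^ 2 * Y ^ 3) * h2 -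
          (q * Y) * (1 - kronecker D q * Y) * hL2
      · push_cast
        rw [← ha, ← hb, show k - 1 = (k - 2) + 1 by omega, pow_succ _ (k - 2), ← hWY]
        linear_combination (W ^ (v + 1) * Φ - q * Y * W ^ (v + 1) * Ψ) * hWY2
    · have hL2 := localSum_of_not_dvd q hk hS'
      refine ⟨(1 - kronecker D q * Y) + (q * Y + q * Y ^ 2) * Φ, ?_,
        ⟨(q ^ (2 * k - 3)) ^ (v + 1) - kronecker D q * q ^ (k - 2) * (q ^ (2 * k - 3)) ^ v +
          (q ^ (k - 1) + 1) * a, ?_⟩, by omega⟩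
      · rw [hL]
        linear_combination (q * Y + q * Y ^ 2) * h1 - (q * Y) * (1 - kronecker D q * Y) * hL2
      · push_cast
        rw [← ha, show k - 1 = (k - 2) + 1 by omega, pow_succ _ (k - 2), ← hWY]
        linear_combination (W ^ v * Φ) * hWY2
  -- If q does not divide T, the form is equivalent to some `raiseForm q R`, and R has discriminant
  -- smaller by q².
  · obtain ⟨S, hS, hd, hl⟩ := exists_last_unit q hT k
    have hd2 : discForm S = q ^ 2 * (D * (q ^ v * f) ^ 2) := by
      rw [hd, h]
      ring
    obtain ⟨c, R, hR, hRS⟩ : ∃ c R, shearForm c S = raiseForm q R ∧ R.2.2 = S.2.2 := by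
      refine exists_shearForm_eq_raiseForm q hS hd2 ?_
      rcases Int.even_or_odd' ((q : ℤ) ^ v * f) with ⟨x, hx | hx⟩
      · left
        rw [hx]
        have : D * (2 * x) ^ 2 = 4 * (D * x ^ 2) := by ring
        omega
      · have h8 := sq_emod_four_of_odd (x := (q : ℤ) ^ v * f) (by omega)
        have := emod_four_of_mul h8 (mul_comm D _)
        have := hD.1
        omega
    have hRu : ¬(q : ℤ) ∣ R.2.2 := hRS ▸ hS
    have hdR : discForm R = D * (q ^ v * f) ^ 2 := by
      refine mul_left_cancel₀ hq0 ?_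
      rw [← hd2, ← discForm_raiseForm, ← hR, discForm_shearForm]
    obtain ⟨Φ, h1, ⟨a, ha⟩, -⟩ := ih v (by omega) R f hf hdR
    have hL : localSum q k T = (1 - Y) * (1 + Y + q * Y ^ 2 * zeroSeries q k R) := by
      rw [← hl, ← localSum_shearForm q k c, hR,
        localSum_of_last_unit q hk (T := raiseForm q R) hRu, zeroSeries_raiseForm q hk hRu]
    have hL2 := localSum_of_last_unit q hk hRu
    refine ⟨(1 - kronecker D q * Y) + q * Y ^ 2 * Φ, ?_,
      ⟨(q ^ (2 * k - 3)) ^ (v + 1) - kronecker D q * q ^ (k - 2) * (q ^ (2 * k - 3)) ^ v + a, ?_⟩, by omega⟩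
    · rw [hL]
      linear_combination (q * Y ^ 2) * h1 - (q * Y ^ 2) * (1 - kronecker D q * Y) * hL2
    · push_cast
      rw [← ha, ← hWY]
      linear_combination (W ^ v * Φ) * hWY2

end PrimePower

end SiegelTwo
end

/-! ### The singular series as a multiple of an L-value -/

noncomputable section
namespace SiegelTwo
open Complex

theorem cpow_neg_eq_localParam (q : ℕ) [hq : Fact q.Prime] (k : ℕ) :
    (q : ℂ) ^ (-((k : ℂ) - 1)) = localParam q k := by
  have h0 := prime_ne_zero q
  rw [show -((k : ℂ) - 1) = ((1 : ℕ) : ℂ) - (k : ℕ) by push_cast; ring, Complex.cpow_sub _ _ h0,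
    Complex.cpow_natCast, Complex.cpow_natCast, pow_one, div_eq_mul_inv, localParam]

theorem one_sub_mul_localParam_ne_zero (q : ℕ) [hq : Fact q.Prime] {k : ℕ} (hk : 4 ≤ k) {a : ℂ} (ha : ‖a‖ ≤ 1) :
    1 - a * localParam q k ≠ 0 := by
  intro h
  have h2 := norm_localParam q hk
  have h3 : (2 : ℝ) ≤ q := by exact_mod_cast hq.out.two_le
  have h4 : ‖a * localParam q k‖ = 1 := by rw [← sub_eq_zero.1 h, norm_one]
  rw [norm_mul] at h4
  nlinarith [norm_nonneg (localParam q k), norm_nonneg a]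

/-- Euler products are compared prime by prime: the factor 1 - Y² of `exists_localFactor` is
cancelled by ζ(2k-2), the factor 1 - χ(q)Y belongs to L(k-1, χ). The remaining Φ is 1 away from f,
and f^(2k-3) clears its denominators at the primes dividing f. -/
theorem exists_int_singularSeries {k : ℕ} (hk : 4 ≤ k) {D : ℤ} (hD : IsFundamental D) {N : ℕ}
    (χ : DirichletCharacter ℂ N)
    (hχ : ∀ (q : ℕ) [Fact q.Prime], χ (q : ZMod N) = kronecker D q) {T : ℤ × ℤ × ℤ} {f : ℕ} (hf : f ≠ 0)
    (hT : discForm T = D * f ^ 2) :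
    ∃ n : ℤ, (f : ℂ) ^ (2 * k - 3) * (riemannZeta (2 * (k : ℂ) - 2) * singularSeries k T) =
      n * LSeries (fun n => χ n) ((k : ℂ) - 1) := by
  have hk' : (4 : ℝ) ≤ k := by exact_mod_cast hk
  have hex : ∀ q : Nat.Primes, ∃ Φ : ℂ, localSum q k T * (1 - χ ((q : ℕ) : ZMod N) * localParam q k) =
      (1 - localParam q k ^ 2) * Φ ∧
      (∃ n : ℤ, ((q : ℂ) ^ (2 * k - 3)) ^ (f.factorization q) * Φ = n) ∧ (f.factorization q = 0 → Φ = 1) := by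
    intro q
    have : Fact (q : ℕ).Prime := ⟨q.2⟩
    rw [hχ]
    refine exists_localFactor q hk hD (f.factorization q) T ((f / (q : ℕ) ^ f.factorization q : ℕ) : ℤ) ?_ ?_
    · rw [Int.natCast_dvd_natCast]
      exact Nat.not_dvd_ordCompl q.2 hf
    · rw [hT]
      congr 2
      exact_mod_cast (Nat.ordProj_mul_ordCompl_eq_self f q).symm
  choose Φ h1 h2 h3 using hex
  set s : Finset Nat.Primes := f.primeFactors.subtype Nat.Prime with hs
  have hΦ : HasProd Φ (∏ q ∈ s, Φ q) := by
    refine hasProd_prod_of_ne_finset_one fun q hq => h3 q ?_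
    rw [← Finsupp.notMem_support_iff, Nat.support_factorization]
    exact fun h => hq (Finset.mem_subtype.2 h)
  have hL := DirichletCharacter.LSeries_eulerProduct_hasProd χ (s := (k : ℂ) - 1) (by
    simp; linarith)
  have hZ := riemannZeta_eulerProduct_hasProd (s := 2 * (k : ℂ) - 2) (by
    simp; linarith)
  have hS := hasProd_singularSeries hk T
  have e1 := hS.mul hZ
  have e2 := hL.mul hΦ
  have e3 : (fun q : Nat.Primes => (∑' e : ℕ, singularTerm k T ((q : ℕ) ^ e)) *
      (1 - (q : ℂ) ^ (-(2 * (k : ℂ) - 2)))⁻¹) =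
      fun q : Nat.Primes => (1 - χ ((q : ℕ) : ZMod N) * ((q : ℕ) : ℂ) ^ (-((k : ℂ) - 1)))⁻¹ * Φ q := by
    funext q
    have : Fact (q : ℕ).Prime := ⟨q.2⟩
    have hn : -(2 * (k : ℂ) - 2) = ((2 : ℕ) : ℂ) * (-((k : ℂ) - 1)) := by push_cast; ring
    rw [hn, Complex.cpow_nat_mul, cpow_neg_eq_localParam]
    have n1 := one_sub_mul_localParam_ne_zero q hk (χ.norm_le_one ((q : ℕ) : ZMod N))
    have n2 : 1 - localParam q k ^ 2 ≠ 0 := by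
      have m1 := one_sub_mul_localParam_ne_zero q hk (a := 1) (by simp)
      have m2 := one_sub_mul_localParam_ne_zero q hk (a := -1) (by simp)
      have : 1 - localParam q k ^ 2 = (1 - 1 * localParam q k) * (1 - -1 * localParam q k) := by ring
      rw [this]
      exact mul_ne_zero m1 m2
    have := h1 q
    rw [localSum] at this
    rw [← div_eq_mul_inv, inv_mul_eq_div, div_eq_div_iff n2 n1]
    linear_combination this
  rw [e3] at e1
  have e4 := e1.unique e2
  have h_integral : ∃ n : ℤ, (f : ℂ) ^ (2 * k - 3) * ∏ q ∈ s, Φ q = n := by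
    choose n hn using h2
    refine ⟨∏ q ∈ s, n q, ?_⟩
    have hfp : (f : ℂ) = ∏ q ∈ s, ((q : ℕ) : ℂ) ^ f.factorization q := by
      refine Eq.trans ?_ (Finset.prod_subtype_of_mem (p := Nat.Prime) (s := f.primeFactors)
        (fun q : ℕ => (q : ℂ) ^ f.factorization q) (fun q hq => Nat.prime_of_mem_primeFactors hq)).symm
      nth_rewrite 1 [← Nat.prod_factorization_pow_eq_self hf]
      rw [Finsupp.prod, Nat.support_factorization]
      push_cast
      rfl
    rw [hfp, ← Finset.prod_pow, ← Finset.prod_mul_distrib]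
    push_cast
    refine Finset.prod_congr rfl fun q _ => ?_
    rw [← hn q, ← pow_mul, ← pow_mul, mul_comm (f.factorization q)]
  obtain ⟨n, hn⟩ := h_integral
  refine ⟨n, ?_⟩
  rw [← hn]
  linear_combination (f : ℂ) ^ (2 * k - 3) * e4

end SiegelTwo
end

/-! ### The quadratic character of a negative fundamental discriminant -/

noncomputable section
namespace SiegelTwo
open Complex

/-- The values on natural numbers of the primitive odd quadratic character attached to `D`. -/
structure IsOddQuadraticSymbol (D : ℤ) (ψ : ℕ → ℤ) : Prop where
  neg : D < 0
  one : ψ 1 = 1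
  mul : ∀ a b, ψ (a * b) = ψ a * ψ b
  mod : ∀ a, ψ (a % D.natAbs) = ψ a
  eq_zero : ∀ a, ¬ a.Coprime D.natAbs → ψ a = 0
  trichotomy : ∀ a, ψ a = 0 ∨ ψ a = 1 ∨ ψ a = -1
  prime : ∀ (q : ℕ) [Fact q.Prime], ψ q = kronecker D q
  neg_one : ψ (D.natAbs - 1) = -1
  primitive : ∀ q m : ℕ, q.Prime → D.natAbs = q * m → ∃ u, u % m = 1 % m ∧ ψ u = -1

theorem exists_jacobiSym_eq_neg_one {q : ℕ} (hq : q.Prime) (h2 : q ≠ 2) : ∃ r : ℕ, jacobiSym r q = -1 := by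
  have : Fact q.Prime := ⟨hq⟩
  obtain ⟨a, ha⟩ := FiniteField.exists_nonsquare (F := ZMod q) (by rwa [ZMod.ringChar_zmod_n])
  refine ⟨a.val, ?_⟩
  rw [← jacobiSym.legendreSym.to_jacobiSym, legendreSym.eq_neg_one_iff]
  simpa using ha

theorem exists_modEq_jacobiSym {q m : ℕ} (hq : q.Prime) (h2 : q ≠ 2) (hm : ¬ q ∣ m) :
    ∃ u : ℕ, u % m = 1 % m ∧ jacobiSym u q = -1 := by
  obtain ⟨r, hr⟩ := exists_jacobiSym_eq_neg_one hq h2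
  obtain ⟨u, h1, h3⟩ := Nat.chineseRemainder ((Nat.Prime.coprime_iff_not_dvd hq).2 hm) r 1
  refine ⟨u, h3, ?_⟩
  rw [← hr, jacobiSym.mod_left, jacobiSym.mod_left r]
  congr 1
  exact_mod_cast h1

/-- With N = -D ≡ 3 modulo 4, the symbol (a/N) is periodic by construction, and reciprocity gives
(q/N) = (D/q). For primitivity, N is squarefree, so q is prime to m = N/q and some u ≡ 1 modulo m is
a non-residue modulo q. -/
theorem isOddQuadraticSymbol_of_emod_one {D : ℤ} (hD : IsFundamental D) (hneg : D < 0) (h4 : D % 4 = 1) :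
    IsOddQuadraticSymbol D (fun a => jacobiSym a D.natAbs) := by
  obtain ⟨N, hN⟩ : ∃ N, N = D.natAbs := ⟨_, rfl⟩
  have hDN : D = -(N : ℤ) := by omega
  have hN4 : N % 4 = 3 := by omega
  have hodd : Odd N := Nat.odd_iff.2 (by omega)
  have : NeZero N := ⟨by omega⟩
  rw [← hN]
  constructor
  · exact hneg
  · simp
  · intro a b; push_cast; exact jacobiSym.mul_left _ _ _
  · intro a; rw [← hN]; push_cast; exact (jacobiSym.mod_left _ _).symm
  · intro a ha
    rw [← hN] at ha
    exact jacobiSym.eq_zero_iff_not_coprime.2 ha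
  · intro a; exact jacobiSym.trichotomy _ _
  · intro q hq
    rw [kronecker]
    split_ifs with c1 c2 c3
    · omega
    · subst c1
      push_cast
      rw [jacobiSym.at_two hodd, ZMod.χ₈_nat_eq_if_mod_eight, if_neg (by omega), if_pos (by omega)]
    · subst c1
      push_cast
      rw [jacobiSym.at_two hodd, ZMod.χ₈_nat_eq_if_mod_eight, if_neg (by omega), if_neg (by omega)]
    · have hqo : q % 2 = 1 := hq.out.mod_two_eq_one_iff_ne_two.2 c1
      have hqo' : Odd q := Nat.odd_iff.2 hqo
      rw [jacobiSym.legendreSym.to_jacobiSym, hDN, neg_eq_neg_one_mul, jacobiSym.mul_left,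
        jacobiSym.at_neg_one hqo']
      rcases Nat.odd_mod_four_iff.1 hqo with h | h
      · rw [ZMod.χ₄_nat_one_mod_four h, one_mul, jacobiSym.quadratic_reciprocity_one_mod_four h hodd]
      · rw [ZMod.χ₄_nat_three_mod_four h, jacobiSym.quadratic_reciprocity_three_mod_four h hN4]; ring
  · rw [← hN, jacobiSym.mod_left' (a₂ := -1), jacobiSym.at_neg_one hodd, ZMod.χ₄_nat_three_mod_four hN4]
    rw [Nat.cast_sub (by omega)]
    exact Int.emod_emod_of_dvd _ (dvd_refl _) ▸ (Int.emod_emod_of_dvd _ (dvd_refl _) ▸ by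
      simp [sub_eq_add_neg])
  · intro q m hq hqm
    rw [← hN] at hqm
    have h2 : q ≠ 2 := by rintro rfl; omega
    have hm : ¬ q ∣ m := by
      rintro ⟨e, rfl⟩
      have hqo : q % 2 = 1 := hq.mod_two_eq_one_iff_ne_two.2 h2
      refine hD.2 q hq (-(e : ℤ)) (by rw [hDN, hqm]; push_cast; ring) (Or.inr ?_)
      have := emod_four_of_mul (s := (q : ℤ) ^ 2) (D := D) (E := -(e : ℤ))
        (sq_emod_four_of_odd (by omega)) (by rw [hDN, hqm]; push_cast; ring)
      omega
    obtain ⟨u, hu, hu'⟩ := exists_modEq_jacobiSym hq h2 hm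
    refine ⟨u, hu, ?_⟩
    have : NeZero q := ⟨hq.ne_zero⟩
    have : NeZero m := ⟨by rintro rfl; omega⟩
    rw [hqm, jacobiSym.mul_right, hu', jacobiSym.mod_left' (a₂ := 1) (by exact_mod_cast hu),
      jacobiSym.one_left]
    rfl

theorem jacobiSym_eq_one_of_emod {m : ℤ} (hm : m ≠ 0) {u : ℕ} (hu : u % (4 * m.natAbs) = 1 % (4 * m.natAbs)) :
    jacobiSym m u = 1 := by
  have h1 : 1 % (4 * m.natAbs) = 1 := Nat.mod_eq_of_lt (by omega)
  have : Odd u := by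
    rw [Nat.odd_iff]
    have := Nat.mod_mod_of_dvd u (⟨2 * m.natAbs, by ring⟩ : 2 ∣ 4 * m.natAbs)
    rw [hu, h1] at this
    omega
  rw [jacobiSym.mod_right m this, hu, h1, jacobiSym.one_right]

/-- Fundamentality at 2 means n ≡ 1 or 2 modulo 4. Here the symbol (-n/a) has the right values at
primes by definition, and periodicity modulo 4n comes from reciprocity. -/
theorem isOddQuadraticSymbol_of_four_mul {D : ℤ} {n : ℕ} (hD : IsFundamental D) (hn : 0 < n) (h4 : D = -(4 * n)) :
    IsOddQuadraticSymbol D (fun a => if Odd a then jacobiSym (-(n : ℤ)) a else 0) := by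
  have hN : D.natAbs = 4 * n := by omega
  have hn4 : n % 4 = 1 ∨ n % 4 = 2 := by
    have := hD.2 2 Nat.prime_two (-(n : ℤ)) (by rw [h4]; push_cast; ring)
    omega
  constructor
  · omega
  · simp
  · intro a b
    by_cases ha : Odd a <;> by_cases hb : Odd b <;> simp only [Nat.odd_mul, ha, hb, and_self, and_true, and_false,
      if_true, if_false, zero_mul, mul_zero]
    have : NeZero a := ⟨ha.pos.ne'⟩
    have : NeZero b := ⟨hb.pos.ne'⟩
    exact jacobiSym.mul_right _ _ _
  · intro a
    rw [hN]
    have hpar : Odd (a % (4 * n)) ↔ Odd a := by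
      rw [Nat.odd_iff, Nat.odd_iff, Nat.mod_mod_of_dvd a (⟨2 * n, by ring⟩ : 2 ∣ 4 * n)]
    by_cases ha : Odd a
    · simp only [hpar, ha, if_true]
      rw [jacobiSym.mod_right (-(n : ℤ)) ha]
      simp
    · simp only [hpar, ha, if_false]
  · intro a ha
    rw [hN] at ha
    by_cases hao : Odd a
    · simp only [hao, if_true]
      have : NeZero a := ⟨hao.pos.ne'⟩
      rw [jacobiSym.eq_zero_iff_not_coprime]
      intro h
      apply ha
      rw [Int.neg_gcd, Int.gcd_natCast_natCast] at h
      have h2 : Nat.Coprime a 4 := (Nat.coprime_pow_right_iff (n := 2) (by norm_num) a 2).2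
        (Nat.coprime_two_right.2 hao)
      exact Nat.Coprime.mul_right h2 (Nat.Coprime.symm h)
    · simp only [hao, if_false]
  · intro a
    split_ifs
    · exact jacobiSym.trichotomy _ _
    · exact Or.inl rfl
  · intro q hq
    rw [kronecker]
    by_cases c1 : q = 2
    · subst c1
      rw [if_neg (by decide), if_pos rfl, if_pos (by omega)]
    · have hqo : Odd q := hq.out.odd_of_ne_two c1
      rw [if_pos hqo, if_neg c1, h4, show -(4 * (n : ℤ)) = 2 ^ 2 * -(n : ℤ) by ring, legendreSym.mul,
        legendreSym.sq_one' q, one_mul, jacobiSym.legendreSym.to_jacobiSym]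
      intro h
      have : q ∣ 2 := (ZMod.natCast_eq_zero_iff 2 q).1 (by exact_mod_cast h)
      exact c1 ((Nat.prime_dvd_prime_iff_eq hq.out Nat.prime_two).1 this)
  · rw [hN]
    have ho : Odd (4 * n - 1) := Nat.odd_iff.2 (by omega)
    -- As 4n ≡ 1 modulo 4n - 1 and 4 is a square, (n/(4n-1)) = 1. The sign then comes from
    -- (-1/(4n-1)) = -1.
    have hco : jacobiSym ((4 * n : ℕ) : ℤ) (4 * n - 1) = 1 := by
      rw [jacobiSym.mod_left' (a₂ := 1), jacobiSym.one_left]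
      have : (4 * n) % (4 * n - 1) = 1 % (4 * n - 1) := by
        conv_lhs => rw [show 4 * n = 1 + (4 * n - 1) by omega]
        simp
      exact_mod_cast this
    have h2 : jacobiSym 2 (4 * n - 1) * jacobiSym 2 (4 * n - 1) = 1 := by
      rcases jacobiSym.trichotomy 2 (4 * n - 1) with h | h | h
      · have : ((4 * n : ℕ) : ℤ) = 2 * (2 * n) := by push_cast; ring
        rw [this, jacobiSym.mul_left, h, zero_mul] at hco
        exact absurd hco (by decide)
      · rw [h]; rfl
      · rw [h]; rfl
    have e : ((4 * n : ℕ) : ℤ) = 2 * 2 * n := by push_cast; ring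
    rw [e, jacobiSym.mul_left, jacobiSym.mul_left, h2, one_mul] at hco
    rw [if_pos ho, neg_eq_neg_one_mul, jacobiSym.mul_left, hco, jacobiSym.at_neg_one ho,
      ZMod.χ₄_nat_three_mod_four (by omega)]
    rfl
  · intro q m hq hqm
    rw [hN] at hqm
    by_cases h2 : q = 2
    · subst h2
      -- If n ≡ 1 modulo 4, this number is 3 modulo 4 and (-1/u) = -1. If n = 2e with e odd, it is 5
      -- modulo 8 and (2/u) = -1. The other factors are 1.
      refine ⟨2 * n + 1, ?_, ?_⟩
      · rw [show m = 2 * n by omega]; simp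
      · have ho : Odd (2 * n + 1) := ⟨n, rfl⟩
        rw [if_pos ho]
        rcases hn4 with h | h
        · have hn' : Odd n := Nat.odd_iff.2 (by omega)
          rw [neg_eq_neg_one_mul, jacobiSym.mul_left, jacobiSym.at_neg_one ho,
            ZMod.χ₄_nat_three_mod_four (by omega), jacobiSym.quadratic_reciprocity_one_mod_four h ho,
            jacobiSym.mod_left' (a₂ := 1), jacobiSym.one_left]
          · rfl
          · push_cast; simp
        · obtain ⟨e, rfl⟩ : ∃ e, n = 2 * e := ⟨n / 2, by omega⟩
          rw [show -((2 * e : ℕ) : ℤ) = 2 * -(e : ℤ) by push_cast; ring, jacobiSym.mul_left,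
            jacobiSym.at_two ho, jacobiSym_eq_one_of_emod (by omega), mul_one,
            ZMod.χ₈_nat_eq_if_mod_eight, if_neg (by omega), if_neg (by omega)]
          rw [Int.natAbs_neg, Int.natAbs_natCast, show 2 * (2 * e) = 4 * e by ring]
          simp
    · have hqo : Odd q := hq.odd_of_ne_two h2
      have hqn : q ∣ n := by
        have : q ∣ 4 * n := ⟨m, hqm⟩
        refine Nat.Coprime.dvd_of_dvd_mul_left ?_ this
        exact (Nat.coprime_pow_right_iff (n := 2) (by norm_num) q 2).2 (Nat.coprime_two_right.2 hqo)
      obtain ⟨e, rfl⟩ := hqn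
      have hm : m = 4 * e := by
        apply Nat.eq_of_mul_eq_mul_left hq.pos
        rw [← hqm]; ring
      have hqm' : ¬ q ∣ m := by
        rintro ⟨e', he'⟩
        refine hD.2 q hq (-(e' : ℤ)) ?_ (Or.inl ?_)
        · have : (4 * (q * e) : ℕ) = q * (q * e') := by rw [hqm, he']
          have : (4 * (q * e) : ℤ) = q * (q * e') := by exact_mod_cast this
          rw [h4]; push_cast; rw [this]; ring
        · have : 4 ∣ q * e' := ⟨e, by rw [← he', hm]⟩
          have : 4 ∣ e' := Nat.Coprime.dvd_of_dvd_mul_left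
            ((Nat.coprime_pow_left_iff (n := 2) (by norm_num) 2 q).2 (Nat.coprime_two_left.2 hqo)) this
          omega
      obtain ⟨u, hu, hu'⟩ := exists_modEq_jacobiSym hq h2 hqm'
      have he : e ≠ 0 := by rintro rfl; simp at hn
      have hu4 : u % 4 = 1 := by
        have := Nat.mod_mod_of_dvd u (⟨e, hm⟩ : 4 ∣ m)
        rw [hu, Nat.mod_eq_of_lt (a := 1) (b := m) (by omega)] at this
        exact this.symm
      have huo : Odd u := Nat.odd_iff.2 (by omega)
      refine ⟨u, hu, ?_⟩
      rw [if_pos huo, show -((q * e : ℕ) : ℤ) = q * -(e : ℤ) by push_cast; ring, jacobiSym.mul_left,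
        ← jacobiSym.quadratic_reciprocity_one_mod_four hu4 hqo, hu', jacobiSym_eq_one_of_emod (by omega)]
      · rfl
      · rw [Int.natAbs_neg, Int.natAbs_natCast, ← hm, hu]

theorem exists_isOddQuadraticSymbol {D : ℤ} (hD : IsFundamental D) (hneg : D < 0) :
    ∃ ψ, IsOddQuadraticSymbol D ψ := by
  rcases hD.1 with h | h
  · exact ⟨_, isOddQuadraticSymbol_of_four_mul (n := (-D / 4).toNat) hD (by omega) (by omega)⟩
  · exact ⟨_, isOddQuadraticSymbol_of_emod_one hD hneg h⟩

theorem exists_eq_fundamental_mul_sq {Δ : ℤ} (hΔ : Δ ≠ 0) (h4 : Δ % 4 = 0 ∨ Δ % 4 = 1) :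
    ∃ (D : ℤ) (f : ℕ), IsFundamental D ∧ f ≠ 0 ∧ Δ = D * f ^ 2 := by
  induction hn : Δ.natAbs using Nat.strong_induction_on generalizing Δ with
  | _ n ih =>
    by_cases hF : IsFundamental Δ
    · exact ⟨Δ, 1, hF, one_ne_zero, by simp⟩
    · simp only [IsFundamental, h4, true_and, not_forall, not_not] at hF
      obtain ⟨q, hq, E, hE, hE4⟩ := hF
      have hE0 : E ≠ 0 := by rintro rfl; simp at hE; exact hΔ hE
      have hlt : E.natAbs < n := by
        rw [← hn, hE, Int.natAbs_mul, Int.natAbs_pow, Int.natAbs_natCast]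
        have := Int.natAbs_pos.2 hE0
        have := Nat.pow_le_pow_left hq.two_le 2
        nlinarith
      obtain ⟨D, f, hD, hf, h⟩ := ih _ hlt hE0 hE4 rfl
      refine ⟨D, q * f, hD, mul_ne_zero hq.ne_zero hf, ?_⟩
      rw [hE, h]; push_cast; ring

end SiegelTwo
end

/-! ### L-values at odd integers through Bernoulli polynomials -/

noncomputable section
namespace SiegelTwo
open Complex

namespace IsOddQuadraticSymbol

variable {D : ℤ} {ψ : ℕ → ℤ}

theorem neZero (hψ : IsOddQuadraticSymbol D ψ) : NeZero D.natAbs := ⟨by have := hψ.neg; omega⟩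

theorem val_mul (hψ : IsOddQuadraticSymbol D ψ) (a b : ZMod D.natAbs) :
    ψ (a * b).val = ψ a.val * ψ b.val := by
  rw [ZMod.val_mul, hψ.mod, hψ.mul]

theorem val_natCast (hψ : IsOddQuadraticSymbol D ψ) (a : ℕ) : ψ (a : ZMod D.natAbs).val = ψ a := by
  rw [ZMod.val_natCast, hψ.mod]

/-- The Dirichlet character with the values `ψ`. -/
def character (hψ : IsOddQuadraticSymbol D ψ) : DirichletCharacter ℂ D.natAbs where
  toFun a := ψ a.val
  map_one' := by
    have := hψ.val_natCast 1
    rw [Nat.cast_one, hψ.one] at this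
    rw [this]; simp
  map_mul' a b := by rw [hψ.val_mul]; push_cast; rfl
  map_nonunit' a ha := by
    have := hψ.neZero
    have := hψ.eq_zero a.val (by rwa [← ZMod.isUnit_iff_coprime, ZMod.natCast_val, ZMod.cast_id])
    simp [this]

theorem character_apply (hψ : IsOddQuadraticSymbol D ψ) (a : ZMod D.natAbs) : hψ.character a = ψ a.val := rfl

theorem character_natCast (hψ : IsOddQuadraticSymbol D ψ) (a : ℕ) : hψ.character (a : ZMod D.natAbs) = ψ a := by
  rw [character_apply, val_natCast hψ]

theorem odd_character (hψ : IsOddQuadraticSymbol D ψ) : hψ.character.Odd := by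
  have : (-1 : ZMod D.natAbs) = ((D.natAbs - 1 : ℕ) : ZMod D.natAbs) := by
    have := hψ.neg
    rw [Nat.cast_sub (by omega)]; simp
  rw [DirichletCharacter.Odd, this, character_natCast, hψ.neg_one]
  simp

theorem inv_character (hψ : IsOddQuadraticSymbol D ψ) : hψ.character⁻¹ = hψ.character := by
  refine MulChar.IsQuadratic.inv fun a => ?_
  rw [character_apply]
  rcases hψ.trichotomy a.val with h | h | h <;> simp [h]

/-- A conductor smaller than |D| divides |D|/q for some prime q, but the field `primitive` provides
u ≡ 1 modulo |D|/q with value -1. -/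
theorem isPrimitive_character (hψ : IsOddQuadraticSymbol D ψ) : hψ.character.IsPrimitive := by
  have := hψ.neZero
  by_contra hne
  rw [DirichletCharacter.IsPrimitive] at hne
  obtain ⟨e, he⟩ := hψ.character.conductor_dvd_level
  have he1 : e ≠ 1 := by rintro rfl; rw [mul_one] at he; exact hne he.symm
  obtain ⟨q, hq, e', rfl⟩ := Nat.exists_prime_and_dvd he1
  have hqm : D.natAbs = q * (hψ.character.conductor * e') := he.trans (by ring)
  generalize hm : hψ.character.conductor * e' = m at hqm
  have hmN : m ∣ D.natAbs := ⟨q, by rw [hqm]; ring⟩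
  have hF := hψ.character.factorsThrough_conductor.mono hψ.character ⟨e', hm.symm⟩ hmN
  rw [DirichletCharacter.factorsThrough_iff_ker_unitsMap hmN] at hF
  obtain ⟨u, hu, hu'⟩ := hψ.primitive q m hq hqm
  have hco : u.Coprime D.natAbs := by
    by_contra h
    rw [hψ.eq_zero u h] at hu'
    exact absurd hu' (by decide)
  have hk : ZMod.unitOfCoprime u hco ∈ (ZMod.unitsMap hmN).ker := by
    rw [MonoidHom.mem_ker]
    ext
    rw [ZMod.unitsMap_val, ZMod.coe_unitOfCoprime, ZMod.cast_natCast hmN, Units.val_one, ← Nat.cast_one]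
    exact (ZMod.natCast_eq_natCast_iff' _ _ _).2 hu
  have h1 := hF hk
  rw [MonoidHom.mem_ker] at h1
  have h2 := congrArg Units.val h1
  rw [MulChar.coe_toUnitHom, ZMod.coe_unitOfCoprime, character_natCast, hu', Units.val_one] at h2
  norm_num at h2

end IsOddQuadraticSymbol

section LValue

variable {N : ℕ} [NeZero N] {χ : DirichletCharacter ℂ N}

theorem sum_stdAddChar_mul_character (hp : χ.IsPrimitive) (hi : χ⁻¹ = χ) (n : ZMod N) :
    ∑ j, ZMod.stdAddChar (j * n) * χ j = χ n * gaussSum χ ZMod.stdAddChar := by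
  have := hp.fourierTransform_eq_inv_mul_gaussSum (-n)
  rw [ZMod.dft_apply, hi, neg_neg] at this
  rw [← this]
  simp

/-- The discrete Fourier transform sends χ to -Gχ, with G the Gauss sum. Applied twice it gives G²χ
on one side and N·χ(-x) = -Nχ(x) on the other. -/
theorem gaussSum_sq_eq_neg (hp : χ.IsPrimitive) (hi : χ⁻¹ = χ) (ho : χ.Odd) :
    gaussSum χ ZMod.stdAddChar ^ 2 = -(N : ℂ) := by
  have h1 : ZMod.dft (χ : ZMod N → ℂ) = -gaussSum χ ZMod.stdAddChar • (χ : ZMod N → ℂ) := by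
    funext k
    rw [hp.fourierTransform_eq_inv_mul_gaussSum, hi, neg_eq_neg_one_mul k, map_mul, ho]
    simp; ring
  have h2 := congrFun (ZMod.dft_dft (χ : ZMod N → ℂ)) 1
  rw [h1, map_smul, h1] at h2
  simp only [Pi.smul_apply, smul_eq_mul, map_one, show χ (-1) = -1 from ho] at h2
  simp at h2
  linear_combination h2

/-- The Fourier series of the Bernoulli polynomial is evaluated at j/N and weighted by χ(j). Summing
over j replaces each exponential by a Gauss sum; since χ and l are both odd, the frequencies n and
-n reinforce each other. -/
theorem two_mul_gaussSum_mul_LSeries (hp : χ.IsPrimitive) (hi : χ⁻¹ = χ) (ho : χ.Odd) {l : ℕ} (hl : Odd l)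
    (hl2 : 2 ≤ l) :
    2 * gaussSum χ ZMod.stdAddChar * LSeries (fun n => χ n) l =
      (-(2 * Real.pi * I) ^ l / l.factorial) * ∑ j : ZMod N, χ j * bernoulliFun l (j.val / N : ℝ) := by
  have hN : (0 : ℝ) < N := by exact_mod_cast NeZero.pos N
  have h1 (j : ZMod N) := (hasSum_one_div_nat_pow_mul_fourier hl2 (x := (j.val / N : ℝ))
    ⟨by positivity, (div_le_one hN).2 (by exact_mod_cast (ZMod.val_lt j).le)⟩).mul_left (χ j)
  have h2 := hasSum_sum (s := Finset.univ) fun j _ => h1 j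
  have hf (j : ZMod N) (n : ℤ) : fourier n ((j.val / N : ℝ) : UnitAddCircle) = ZMod.stdAddChar (j * (n : ZMod N)) := by
    have e : j * (n : ZMod N) = ((j.val * n : ℤ) : ZMod N) := by
      push_cast; rw [ZMod.natCast_val, ZMod.cast_id]
    rw [e, ZMod.stdAddChar_coe, fourier_coe_apply]
    congr 1
    push_cast
    ring
  have h3 : (fun n : ℕ => ∑ j : ZMod N, χ j * (1 / (n : ℂ) ^ l * (fourier (n : ℤ) ((j.val / N : ℝ) : UnitAddCircle) +
      (-1) ^ l * fourier (-(n : ℤ)) ((j.val / N : ℝ) : UnitAddCircle)))) =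
      fun n : ℕ => 2 * gaussSum χ ZMod.stdAddChar * LSeries.term (fun n => χ n) l n := by
    funext n
    have e1 := sum_stdAddChar_mul_character hp hi (n : ZMod N)
    have e2 := sum_stdAddChar_mul_character hp hi (-(n : ZMod N))
    rw [neg_eq_neg_one_mul (n : ZMod N), map_mul, show χ (-1) = -1 from ho, ← neg_eq_neg_one_mul] at e2
    simp only [hf, Int.cast_neg, Int.cast_natCast, hl.neg_one_pow]
    rw [LSeries.term_def]
    split_ifs with hn
    · subst hn
      simp [show l ≠ 0 by omega]
    · rw [Complex.cpow_natCast]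
      have : ∀ j : ZMod N, χ j * (1 / (n : ℂ) ^ l * (ZMod.stdAddChar (j * (n : ZMod N)) +
          -1 * ZMod.stdAddChar (j * -(n : ZMod N)))) = 1 / (n : ℂ) ^ l * (ZMod.stdAddChar (j * (n : ZMod N)) * χ j) -
          1 / (n : ℂ) ^ l * (ZMod.stdAddChar (j * -(n : ZMod N)) * χ j) := fun j => by ring
      rw [Finset.sum_congr rfl fun j _ => this j, Finset.sum_sub_distrib, ← Finset.mul_sum, ← Finset.mul_sum,
        e1, e2]
      ring
  rw [h3] at h2
  rw [LSeries, ← tsum_mul_left, h2.tsum_eq, Finset.mul_sum]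
  exact Finset.sum_congr rfl fun j _ => by ring

/-- The Gauss sum is ±i√N. Its sign is irrelevant for integrality and is left undetermined in ε. -/
theorem exists_sign_LSeries (hp : χ.IsPrimitive) (hi : χ⁻¹ = χ) (ho : χ.Odd) {l : ℕ} (hl : Odd l) (hl2 : 2 ≤ l) :
    ∃ ε : ℤ, 2 * ((l - 1).factorial : ℂ) / (2 * Real.pi) ^ l * ((N : ℂ) ^ (l - 1) * (Real.sqrt N : ℂ)) *
      LSeries (fun n => χ n) l =
      ε * ((l : ℂ)⁻¹ * ((N : ℂ) ^ (l - 1) * ∑ j : ZMod N, χ j * bernoulliFun l (j.val / N : ℝ))) := by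
  have hL := two_mul_gaussSum_mul_LSeries hp hi ho hl hl2
  have hG := gaussSum_sq_eq_neg hp hi ho
  set G := gaussSum χ ZMod.stdAddChar
  set S := ∑ j : ZMod N, χ j * bernoulliFun l (j.val / N : ℝ)
  set L := LSeries (fun n => χ n) l
  have hsq : ((Real.sqrt N : ℝ) : ℂ) ^ 2 = N := by
    rw [← Complex.ofReal_pow, Real.sq_sqrt (Nat.cast_nonneg N)]; simp
  have hs0 : ((Real.sqrt N : ℝ) : ℂ) ≠ 0 := by
    intro h; rw [h] at hsq; simp at hsq; exact NeZero.ne N (by exact_mod_cast hsq.symm)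
  have hG' : G = I * (Real.sqrt N : ℝ) ∨ G = -(I * (Real.sqrt N : ℝ)) := by
    apply sq_eq_sq_iff_eq_or_eq_neg.1
    rw [hG, mul_pow, I_sq, hsq]; ring
  have hπ : (2 * Real.pi : ℂ) ≠ 0 := by simp [Real.pi_ne_zero]
  have hfac : (l.factorial : ℂ) = l * ((l - 1).factorial : ℂ) := by
    exact_mod_cast (Nat.mul_factorial_pred (by omega)).symm
  have hf0 : ((l - 1).factorial : ℂ) ≠ 0 := by exact_mod_cast Nat.factorial_ne_zero _
  have hl0 : (l : ℂ) ≠ 0 := by exact_mod_cast (by omega : l ≠ 0)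
  obtain ⟨r, rfl⟩ := hl
  have hI : I ^ (2 * r + 1) = (-1) ^ r * I := by rw [pow_succ, pow_mul, I_sq]
  rw [hfac, mul_pow, hI] at hL
  simp only [Nat.add_sub_cancel] at *
  rcases hG' with h | h
  · refine ⟨-(-1) ^ r, ?_⟩
    rw [h] at hL
    have hL' : 2 * (Real.sqrt N : ℝ) * L = -(2 * Real.pi) ^ (2 * r + 1) * (-1) ^ r /
      (((2 * r + 1 : ℕ) : ℂ) * ((2 * r).factorial : ℂ)) * S := by
      apply mul_left_cancel₀ I_ne_zero
      linear_combination hL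
    push_cast at hL' hl0 ⊢
    calc _ = ((2 * r).factorial : ℂ) / (2 * Real.pi) ^ (2 * r + 1) * (N : ℂ) ^ (2 * r) *
        (2 * (Real.sqrt N : ℝ) * L) := by rw [div_eq_mul_inv, div_eq_mul_inv]; ring
      _ = _ := by rw [hL']; field_simp
  · refine ⟨(-1) ^ r, ?_⟩
    rw [h] at hL
    have hL' : 2 * (Real.sqrt N : ℝ) * L = (2 * Real.pi) ^ (2 * r + 1) * (-1) ^ r /
      (((2 * r + 1 : ℕ) : ℂ) * ((2 * r).factorial : ℂ)) * S := by
      apply mul_left_cancel₀ I_ne_zero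
      linear_combination -hL
    push_cast at hL' hl0 ⊢
    calc _ = ((2 * r).factorial : ℂ) / (2 * Real.pi) ^ (2 * r + 1) * (N : ℂ) ^ (2 * r) *
        (2 * (Real.sqrt N : ℝ) * L) := by rw [div_eq_mul_inv, div_eq_mul_inv]; ring
      _ = _ := by rw [hL']; field_simp

end LValue

end SiegelTwo
end

/-! ### p-integrality of Bernoulli numbers and of twisted Bernoulli sums -/

noncomputable section
namespace SiegelTwo
open Complex

section Padic

variable {p : ℕ} [hp : Fact p.Prime]

theorem isPadicIntegral_iff {a : ℂ} : IsPadicIntegral p a ↔ ∃ r : ℚ, a = r ∧ ‖(r : ℚ_[p])‖ ≤ 1 := by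
  constructor
  · rintro ⟨r, h, z, hz⟩
    exact ⟨r, h, hz ▸ z.2⟩
  · rintro ⟨r, h, hr⟩
    exact ⟨r, h, ⟨_, hr⟩, rfl⟩

namespace IsPadicIntegral

theorem intCast (n : ℤ) : IsPadicIntegral p (n : ℂ) :=
  isPadicIntegral_iff.2 ⟨n, by simp, by simpa using Padic.norm_int_le_one n⟩

theorem natCast (n : ℕ) : IsPadicIntegral p (n : ℂ) := by
  simpa using intCast (p := p) n

theorem mul {a b : ℂ} (ha : IsPadicIntegral p a) (hb : IsPadicIntegral p b) : IsPadicIntegral p (a * b) := by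
  rw [isPadicIntegral_iff] at *
  obtain ⟨r, rfl, hr⟩ := ha
  obtain ⟨s, rfl, hs⟩ := hb
  refine ⟨r * s, by simp, ?_⟩
  rw [Rat.cast_mul, norm_mul]
  exact mul_le_one₀ hr (norm_nonneg _) hs

theorem add {a b : ℂ} (ha : IsPadicIntegral p a) (hb : IsPadicIntegral p b) : IsPadicIntegral p (a + b) := by
  rw [isPadicIntegral_iff] at *
  obtain ⟨r, rfl, hr⟩ := ha
  obtain ⟨s, rfl, hs⟩ := hb
  refine ⟨r + s, by simp, ?_⟩
  rw [Rat.cast_add]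
  exact (Padic.nonarchimedean _ _).trans (max_le hr hs)

theorem neg {a : ℂ} (ha : IsPadicIntegral p a) : IsPadicIntegral p (-a) := by
  simpa using (intCast (p := p) (-1)).mul ha

theorem sub {a b : ℂ} (ha : IsPadicIntegral p a) (hb : IsPadicIntegral p b) : IsPadicIntegral p (a - b) := by
  rw [sub_eq_add_neg]
  exact ha.add hb.neg

theorem sum {ι : Type*} (s : Finset ι) {f : ι → ℂ} (h : ∀ i ∈ s, IsPadicIntegral p (f i)) :
    IsPadicIntegral p (∑ i ∈ s, f i) := by
  classical
  induction s using Finset.induction_on with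
  | empty => simpa using intCast (p := p) 0
  | insert i s hi ih =>
    rw [Finset.sum_insert hi]
    exact (h i (Finset.mem_insert_self _ _)).add (ih fun j hj => h j (Finset.mem_insert_of_mem hj))

theorem inv_natCast {n : ℕ} (h : ¬ p ∣ n) : IsPadicIntegral p ((n : ℂ)⁻¹) := by
  refine isPadicIntegral_iff.2 ⟨(n : ℚ)⁻¹, by simp, ?_⟩
  have : ‖(n : ℚ_[p])‖ = 1 := by
    rw [Padic.norm_natCast_eq_one_iff]
    exact ((Nat.Prime.coprime_iff_not_dvd hp.out).2 h)
  simp [this]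

theorem inv_natCast_of_lt {n : ℕ} (h0 : n ≠ 0) (h : n < p) : IsPadicIntegral p ((n : ℂ)⁻¹) :=
  inv_natCast fun hd => absurd (Nat.le_of_dvd (by omega) hd) (by omega)

/-- The recursion for Bernoulli numbers expresses the n-th one through earlier ones, dividing only
by n + 1, which is prime to p. -/
theorem bernoulli (n : ℕ) (h : n + 1 < p) : IsPadicIntegral p ((_root_.bernoulli n : ℚ) : ℂ) := by
  induction n using Nat.strong_induction_on with
  | _ n ih =>
    have h1 := sum_bernoulli (n + 1)
    rw [Finset.sum_range_succ, Nat.choose_succ_self_right] at h1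
    have h2 : ((_root_.bernoulli n : ℚ) : ℂ) = ((n + 1 : ℕ) : ℂ)⁻¹ * (((if n + 1 = 1 then 1 else 0 : ℤ) : ℂ) -
        ∑ k ∈ Finset.range n, ((n + 1).choose k : ℂ) * ((_root_.bernoulli k : ℚ) : ℂ)) := by
      have hc : ((if n + 1 = 1 then 1 else 0 : ℤ) : ℂ) = (((if n + 1 = 1 then 1 else 0 : ℚ)) : ℂ) := by
        split_ifs <;> simp
      rw [eq_inv_mul_iff_mul_eq₀ (by exact_mod_cast n.succ_ne_zero), hc, ← h1]
      push_cast
      ring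
    rw [h2]
    refine (inv_natCast_of_lt n.succ_ne_zero h).mul ((intCast _).sub (sum _ fun k hk => ?_))
    have := Finset.mem_range.1 hk
    exact (natCast _).mul (ih k this (by omega))

end IsPadicIntegral

end Padic

theorem not_prime_sq_dvd {D : ℤ} (hD : IsFundamental D) {p : ℕ} (hp : p.Prime) (h2 : p ≠ 2) {m : ℤ}
    (h : D = p * m) : ¬ (p : ℤ) ∣ m := by
  rintro ⟨E, rfl⟩
  have he : D = (p : ℤ) ^ 2 * E := by rw [h]; ring
  refine hD.2 p hp E he ?_
  have hpo : p % 2 = 1 := hp.mod_two_eq_one_iff_ne_two.2 h2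
  have := emod_four_of_mul (sq_emod_four_of_odd (x := (p : ℤ)) (by omega)) he
  have := hD.1
  omega

/-- The twisted power sums over a full period are divisible by every odd prime dividing the period. -/
theorem IsOddQuadraticSymbol.prime_dvd_sum {D : ℤ} {ψ : ℕ → ℤ} (hψ : IsOddQuadraticSymbol D ψ) [NeZero D.natAbs] {p : ℕ}
    [hp : Fact p.Prime] (hpD : p ∣ D.natAbs) {l : ℕ} (hl0 : l ≠ 0) (hl : 2 * l < p - 1) :
    (p : ℤ) ∣ ∑ j : ZMod D.natAbs, ψ j.val * (j.val : ℤ) ^ l := by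
  rw [← ZMod.intCast_zmod_eq_zero_iff_dvd]
  have hc (j : ZMod D.natAbs) : ((j.val : ℕ) : ZMod p) = ZMod.castHom hpD (ZMod p) j := by
    rw [ZMod.natCast_val, ZMod.castHom_apply]
  push_cast
  simp only [hc]
  -- A primitive root g modulo p is lifted to a unit u modulo |D|. Replacing j by uj multiplies the
  -- sum modulo p by ψ(u)g^l.
  obtain ⟨g, hg⟩ := IsCyclic.exists_generator (α := (ZMod p)ˣ)
  obtain ⟨u, hu⟩ := ZMod.unitsMap_surjective hpD g
  have hug : ZMod.castHom hpD (ZMod p) (u : ZMod D.natAbs) = g := by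
    rw [← hu]; rfl
  set S := ∑ j : ZMod D.natAbs, (ψ j.val : ZMod p) * ZMod.castHom hpD (ZMod p) j ^ l with hS
  have key : S = (ψ (u : ZMod D.natAbs).val : ZMod p) * (g : ZMod p) ^ l * S := by
    conv_lhs => rw [hS, ← Equiv.sum_comp (Units.mulLeft u)]
    rw [hS, Finset.mul_sum]
    refine Finset.sum_congr rfl fun j _ => ?_
    rw [Units.mulLeft_apply, hψ.val_mul, map_mul, hug]
    push_cast
    ring
  by_contra hS0
  have h1 : (ψ (u : ZMod D.natAbs).val : ZMod p) * (g : ZMod p) ^ l = 1 := by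
    apply mul_right_cancel₀ hS0
    rw [one_mul, ← key]
  have h2 : (ψ (u : ZMod D.natAbs).val : ZMod p) ^ 2 = 1 := by
    rcases hψ.trichotomy (u : ZMod D.natAbs).val with h | h | h
    · rw [h] at h1; simp at h1
    · rw [h]; simp
    · rw [h]; simp
  -- If that factor were 1, squaring would remove ψ(u) = ±1, contradicting that g has order p - 1 >
  -- 2l.
  have h3 : g ^ (2 * l) = 1 := by
    ext
    have : ((ψ (u : ZMod D.natAbs).val : ZMod p) * (g : ZMod p) ^ l) ^ 2 = 1 := by rw [h1, one_pow]
    rw [mul_pow, h2, one_mul] at this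
    push_cast
    rw [mul_comm, pow_mul, this]
  have h4 := orderOf_dvd_of_pow_eq_one h3
  rw [orderOf_eq_card_of_forall_mem_zpowers hg, Nat.card_eq_fintype_card, ZMod.card_units] at h4
  exact absurd (Nat.le_of_dvd (by omega) h4) (by omega)

theorem bernoulliFun_eq_sum (l : ℕ) (x : ℝ) :
    bernoulliFun l x = ∑ i ∈ Finset.range (l + 1), (bernoulli i : ℝ) * l.choose i * x ^ (l - i) := by
  rw [bernoulliFun, Polynomial.bernoulli, Polynomial.map_sum, Polynomial.eval_finsetSum]
  refine Finset.sum_congr rfl fun i _ => ?_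
  simp

/-- In the expansion of the Bernoulli polynomial only the leading term keeps a denominator:
N⁻¹∑ψ(j)j^l. If p divides N, it does so exactly once, and `prime_dvd_sum` compensates for it. -/
theorem isPadicIntegral_sum_bernoulliFun {D : ℤ} (hD : IsFundamental D) {ψ : ℕ → ℤ} (hψ : IsOddQuadraticSymbol D ψ)
    [NeZero D.natAbs] {p : ℕ} [hp : Fact p.Prime] {l : ℕ} (hl0 : l ≠ 0) (hl : 2 * l < p - 1) :
    IsPadicIntegral p ((D.natAbs : ℂ) ^ (l - 1) *
      ∑ j : ZMod D.natAbs, hψ.character j * bernoulliFun l (j.val / D.natAbs : ℝ)) := by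
  have hN0 : (D.natAbs : ℂ) ≠ 0 := by exact_mod_cast NeZero.ne D.natAbs
  set N := D.natAbs with hN
  have hterm (j : ZMod N) : (N : ℂ) ^ (l - 1) * (hψ.character j * bernoulliFun l (j.val / N : ℝ)) =
      (N : ℂ)⁻¹ * ((ψ j.val * (j.val : ℤ) ^ l : ℤ) : ℂ) + ∑ i ∈ Finset.range l,
        ((ψ j.val * (l.choose (i + 1) : ℤ) * (N : ℤ) ^ i * (j.val : ℤ) ^ (l - (i + 1)) : ℤ) : ℂ) *
          ((bernoulli (i + 1) : ℚ) : ℂ) := by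
    rw [bernoulliFun_eq_sum, Finset.sum_range_succ', hψ.character_apply]
    push_cast
    rw [mul_add, mul_add, add_comm, Finset.mul_sum, Finset.mul_sum]
    congr 1
    · obtain ⟨m, rfl⟩ := Nat.exists_eq_succ_of_ne_zero hl0
      simp only [bernoulli_zero, Nat.choose_zero_right, Nat.succ_eq_add_one, Nat.add_sub_cancel, Nat.sub_zero]
      push_cast
      rw [div_pow, pow_succ (N : ℂ)]
      field_simp
    · refine Finset.sum_congr rfl fun i hi => ?_
      obtain ⟨m, rfl⟩ : ∃ m, l = i + 1 + m := ⟨l - (i + 1), by have := Finset.mem_range.1 hi; omega⟩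
      rw [show i + 1 + m - 1 = i + m by omega, show i + 1 + m - (i + 1) = m by omega, div_pow, pow_add]
      field_simp
  rw [Finset.mul_sum, Finset.sum_congr rfl fun j _ => hterm j, Finset.sum_add_distrib, ← Finset.mul_sum]
  refine IsPadicIntegral.add ?_ (IsPadicIntegral.sum _ fun j _ => IsPadicIntegral.sum _ fun i hi =>
    (IsPadicIntegral.intCast _).mul (IsPadicIntegral.bernoulli _ ?_))
  · rw [← Int.cast_sum]
    by_cases hpN : p ∣ N
    · obtain ⟨c, hc⟩ := hψ.prime_dvd_sum hpN hl0 hl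
      rw [hc]
      obtain ⟨m, hm⟩ := hpN
      have hpm : ¬ p ∣ m := by
        rintro ⟨e, rfl⟩
        have : D = p * -((p * e : ℕ) : ℤ) := by
          have := hψ.neg
          have h3 : (N : ℤ) = p * ((p * e : ℕ) : ℤ) := by exact_mod_cast hm
          rw [mul_neg, ← h3]; omega
        exact not_prime_sq_dvd hD hp.out (by rintro rfl; omega) this ⟨-(e : ℤ), by push_cast; ring⟩
      have : (N : ℂ)⁻¹ * ((p * c : ℤ) : ℂ) = (m : ℂ)⁻¹ * (c : ℂ) := by
        have hp0 := prime_ne_zero p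
        rw [hm]
        push_cast
        rw [mul_inv]
        field_simp
      rw [this]
      exact (IsPadicIntegral.inv_natCast hpm).mul (IsPadicIntegral.intCast _)
    · exact (IsPadicIntegral.inv_natCast hpN).mul (IsPadicIntegral.intCast _)
  · have := Finset.mem_range.1 hi
    omega

end SiegelTwo
end

/-! ### Cancellation of π and integrality of the coefficients -/

noncomputable section
namespace SiegelTwo
open Complex

theorem riemannZeta_one_sub_two_mul {m : ℕ} (hm : m ≠ 0) :
    riemannZeta (1 - 2 * (m : ℂ)) =
      2 * ((2 * Real.pi) ^ (2 * m) : ℂ)⁻¹ * ((2 * m - 1).factorial : ℂ) * (-1) ^ m * riemannZeta (2 * (m : ℂ)) := by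
  have hc : (2 * (m : ℂ)) = ((2 * m : ℕ) : ℂ) := by push_cast; rfl
  have hΓ : Complex.Gamma ((2 * m : ℕ) : ℂ) = ((2 * m - 1).factorial : ℂ) := by
    obtain ⟨r, hr⟩ : ∃ r, 2 * m = r + 1 := ⟨2 * m - 1, by omega⟩
    rw [hr, Nat.add_sub_cancel, ← Complex.Gamma_nat_eq_factorial]
    push_cast; rfl
  have hcos : Complex.cos (Real.pi * (2 * (m : ℂ)) / 2) = (-1) ^ m := by
    rw [show (Real.pi * (2 * (m : ℂ)) / 2) = ((m * Real.pi : ℝ) : ℂ) by push_cast; ring, ← Complex.ofReal_cos,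
      Real.cos_nat_mul_pi]
    push_cast; rfl
  rw [riemannZeta_one_sub, hcos, hc, hΓ, Complex.cpow_neg, Complex.cpow_natCast]
  · intro n h
    rw [hc] at h
    have : ((2 * m : ℕ) : ℤ) = -(n : ℤ) := by exact_mod_cast h
    omega
  · intro h
    rw [hc] at h
    have : 2 * m = 1 := by exact_mod_cast h
    omega

/-- Legendre's duplication formula eliminates Γ(k - 1/2), together with √2 and √π. -/
theorem lipConst_mul_factorial {k : ℕ} (hk : Even k) (hk2 : 2 ≤ k) :
    lipConst k * ((2 * k - 3).factorial : ℝ) =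
      (2 * Real.pi) ^ k / ((k - 1).factorial : ℝ) * (2 * Real.pi) ^ (k - 1) * ((k - 2).factorial : ℝ) *
        2 ^ (2 * k - 3) := by
  obtain ⟨m, rfl⟩ : ∃ m, k = m + 2 := ⟨k - 2, by omega⟩
  have hd := Real.Gamma_mul_Gamma_add_half ((m : ℝ) + 1)
  have h1 : Real.Gamma ((m + 2 : ℕ) : ℝ) = ((m + 1).factorial : ℝ) := by
    rw [← Real.Gamma_nat_eq_factorial]; push_cast; ring_nf
  have h2 : Real.Gamma (2 * ((m : ℝ) + 1)) = ((2 * m + 1).factorial : ℝ) := by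
    rw [← Real.Gamma_nat_eq_factorial]; push_cast; ring_nf
  have h3 : ((m + 2 : ℕ) : ℝ) - 1 / 2 = (m : ℝ) + 1 + 1 / 2 := by push_cast; ring
  have h4 : (2 : ℝ) ^ (1 - 2 * ((m : ℝ) + 1)) = (2 ^ (2 * m + 1))⁻¹ := by
    rw [show (1 - 2 * ((m : ℝ) + 1)) = -((2 * m + 1 : ℕ) : ℝ) by push_cast; ring, Real.rpow_neg (by norm_num),
      Real.rpow_natCast]
  have h5 : (2 * Real.pi) ^ ((m : ℝ) + 1 + 1 / 2) = (2 * Real.pi) ^ (m + 1) * (Real.sqrt 2 * Real.sqrt Real.pi) := by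
    rw [Real.rpow_add (by positivity), ← Real.sqrt_eq_rpow, Real.sqrt_mul (by norm_num)]
    congr 1
    exact_mod_cast Real.rpow_natCast (2 * Real.pi) (m + 1)
  have h6 : (2 : ℝ) ^ (-(1 / 2 : ℝ)) = (Real.sqrt 2)⁻¹ := by
    rw [Real.rpow_neg (by norm_num), Real.sqrt_eq_rpow]
  have hg0 : Real.Gamma ((m : ℝ) + 1 + 1 / 2) ≠ 0 := (Real.Gamma_pos_of_pos (by positivity)).ne'
  rw [h2, h4, Real.Gamma_nat_eq_factorial] at hd
  have hs2 : Real.sqrt 2 ≠ 0 := by positivity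
  have hsp : Real.sqrt Real.pi ≠ 0 := by have := Real.pi_pos; positivity
  rw [lipConst, hk.neg_one_pow, h1, h3, h5, h6, show 2 * (m + 2) - 3 = 2 * m + 1 by omega,
    show m + 2 - 1 = m + 1 by omega, Nat.add_sub_cancel]
  have hd' : ((2 * m + 1).factorial : ℝ) * Real.sqrt Real.pi =
      m.factorial * Real.Gamma ((m : ℝ) + 1 + 1 / 2) * 2 ^ (2 * m + 1) := by
    rw [hd]; field_simp
  have hf : ((m + 1).factorial : ℝ) ≠ 0 := by exact_mod_cast Nat.factorial_ne_zero _
  generalize Real.Gamma ((m : ℝ) + 1 + 1 / 2) = G at *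
  field_simp
  linear_combination hd'

/-- The determinant is (√N·f/2)², so its power k - 3/2 is the integral power 2k - 3 of √N·f/2. -/
theorem lipCoeff_eq {k : ℕ} (hk : 2 ≤ k) {T : ℤ × ℤ × ℤ} (h1 : 0 < T.1) {N f : ℕ}
    (hT : discForm T = -(N * f ^ 2)) :
    lipCoeff k T = (N : ℝ) ^ (k - 2) * Real.sqrt N * (f : ℝ) ^ (2 * k - 3) / 2 ^ (2 * k - 3) := by
  have hT' : (T.2.1 : ℝ) ^ 2 - 4 * T.1 * T.2.2 = -(N * f ^ 2) := by
    rw [discForm] at hT; exact_mod_cast hT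
  have hx : (T.1 : ℝ) * T.2.2 - T.2.1 ^ 2 / 4 = (Real.sqrt N * f / 2) ^ 2 := by
    rw [div_pow, mul_pow, Real.sq_sqrt (Nat.cast_nonneg N)]
    linarith
  have hs : 0 ≤ Real.sqrt N * f / 2 := by positivity
  obtain ⟨m, rfl⟩ : ∃ m, k = m + 2 := ⟨k - 2, by omega⟩
  rw [lipCoeff, if_pos h1, hx, max_eq_left (by positivity), ← Real.rpow_natCast _ 2, ← Real.rpow_mul hs,
    show ((2 : ℕ) : ℝ) * (((m + 2 : ℕ) : ℝ) - 3 / 2) = ((2 * m + 1 : ℕ) : ℝ) by push_cast; ring,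
    Real.rpow_natCast, show 2 * (m + 2) - 3 = 2 * m + 1 by omega, Nat.add_sub_cancel, div_pow, mul_pow,
    pow_succ (Real.sqrt N), pow_mul, Real.sq_sqrt (Nat.cast_nonneg N)]

theorem lipCoeff_eq_zero {k : ℕ} (hk : 2 ≤ k) {T : ℤ × ℤ × ℤ} (h : ¬ (0 < T.1 ∧ discForm T < 0)) :
    lipCoeff k T = 0 := by
  rw [lipCoeff]
  split_ifs with h1
  · have h2 : 0 ≤ discForm T := not_lt.1 fun h2 => h ⟨h1, h2⟩
    have h3 : (0 : ℝ) ≤ (T.2.1 : ℝ) ^ 2 - 4 * T.1 * T.2.2 := by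
      rw [discForm] at h2; exact_mod_cast h2
    have hk' : (2 : ℝ) ≤ k := by exact_mod_cast hk
    rw [max_eq_right (by linarith), Real.zero_rpow (by linarith)]
  · rfl

section Main

variable {k : ℕ} {p : ℕ} [hp : Fact p.Prime]

theorem isPadicIntegral_riemannZeta_neg {n : ℕ} (hn : n + 2 < p) : IsPadicIntegral p (riemannZeta (-(n : ℂ))) := by
  rw [riemannZeta_neg_nat_eq_bernoulli, div_eq_mul_inv]
  have h1 := IsPadicIntegral.inv_natCast_of_lt (p := p) (n := n + 1) (by omega) (by omega)
  push_cast at h1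
  have h2 := IsPadicIntegral.intCast (p := p) ((-1) ^ n)
  push_cast at h2
  exact (h2.mul (IsPadicIntegral.bernoulli _ (by omega))).mul h1

/-- The functional equation at k replaces ζ(1-k)/ζ(k), and in the rank two term the one at 2k - 2
replaces ζ(3-2k) by ζ(2k-2). There the remaining 2(k-2)!/(2π)^(k-1) is the constant of
`exists_sign_LSeries` for l = k - 1. -/
theorem siegelCoeff_eq (hk : Even k) (hk4 : 4 ≤ k) (T : ℤ × ℤ × ℤ) :
    siegelCoeff k T = -I ^ k * (2 * ((k - 2).factorial : ℂ) / (2 * Real.pi) ^ (k - 1)) *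
        (2 ^ (2 * k - 3) * lipCoeff k T) * (riemannZeta (2 * (k : ℂ) - 2) * singularSeries k T) +
      riemannZeta (3 - 2 * (k : ℂ)) * rankOneCoeff k T +
      if T = 0 then 1 / 2 * riemannZeta (1 - (k : ℂ)) * riemannZeta (3 - 2 * (k : ℂ)) else 0 := by
  have hζ : riemannZeta k ≠ 0 := riemannZeta_ne_zero_of_one_lt_re (by
    simp only [natCast_re]; exact_mod_cast (by omega : 1 < k))
  have hlip := congrArg (fun x : ℝ => (x : ℂ)) (lipConst_mul_factorial hk (by omega))
  obtain ⟨r, hr⟩ := hk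
  have hI : I ^ k = (-1) ^ r := by rw [hr, ← two_mul, pow_mul, I_sq]
  have h1 := riemannZeta_one_sub_two_mul (m := r) (by omega)
  rw [show 2 * (r : ℂ) = (k : ℂ) by rw [hr]; push_cast; ring, show 2 * r = k by omega] at h1
  have h2 := riemannZeta_one_sub_two_mul (m := k - 1) (by omega)
  rw [Nat.cast_sub (by omega), show 2 * (k - 1) - 1 = 2 * k - 3 by omega,
    Odd.neg_one_pow (n := k - 1) (Nat.odd_iff.2 (by omega)), show 2 * ((k : ℂ) - (1 : ℕ)) = 2 * (k : ℂ) - 2 by push_cast; ring,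
    show 1 - (2 * (k : ℂ) - 2) = 3 - 2 * (k : ℂ) by ring] at h2
  have hΓ : Real.Gamma k = ((k - 1).factorial : ℝ) := by
    rw [← Real.Gamma_nat_eq_factorial, Nat.cast_sub (by omega)]; simp
  have hf : ((k - 1).factorial : ℂ) ≠ 0 := by exact_mod_cast Nat.factorial_ne_zero _
  have hπ : (2 * Real.pi : ℂ) ≠ 0 := by simp [Real.pi_ne_zero]
  have hsgn : ((-1 : ℂ) ^ r) * (-1) ^ r = 1 := by rw [← mul_pow]; simp
  have hsgn' : ((-1 : ℂ) ^ r)⁻¹ = (-1) ^ r := inv_eq_of_mul_eq_one_left hsgn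
  set Z := riemannZeta (2 * (k : ℂ) - 2)
  set W := riemannZeta (3 - 2 * (k : ℂ)) with hW
  have hc : 1 / 2 * riemannZeta (1 - (k : ℂ)) * W / riemannZeta k =
      ((2 * Real.pi : ℂ) ^ k)⁻¹ * ((k - 1).factorial : ℂ) * (-1) ^ r * W := by
    rw [h1]; field_simp
  rw [siegelCoeff, zetaCoeff, mul_add, mul_add, ← add_assoc]
  congr 1
  · congr 1
    · rw [hc, h2, hI]
      push_cast at hlip
      have hpow : (2 * Real.pi : ℂ) ^ (2 * (k - 1)) = (2 * Real.pi : ℂ) ^ (k - 1) * (2 * Real.pi : ℂ) ^ (k - 1) := by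
        rw [← pow_add]; congr 1; omega
      rw [hpow]
      have e : lipConst k = (2 * Real.pi : ℂ) ^ k / ((k - 1).factorial : ℂ) * (2 * Real.pi) ^ (k - 1) *
          ((k - 2).factorial : ℂ) * 2 ^ (2 * k - 3) / ((2 * k - 3).factorial : ℂ) := by
        rw [← hlip, mul_div_cancel_right₀ _ (by exact_mod_cast Nat.factorial_ne_zero _)]
      have hf3 : ((2 * k - 3).factorial : ℂ) ≠ 0 := by exact_mod_cast Nat.factorial_ne_zero _
      rw [e]
      generalize (2 * Real.pi : ℂ) = P at *
      have hP1 : P ^ k ≠ 0 := pow_ne_zero _ hπ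
      have hP2 : P ^ (k - 1) ≠ 0 := pow_ne_zero _ hπ
      generalize P ^ k = A at *
      generalize P ^ (k - 1) = B at *
      generalize ((2 * k - 3).factorial : ℂ) = F at *
      generalize ((k - 1).factorial : ℂ) = G at *
      field_simp
    · rw [hc, hI, hΓ, hsgn']
      push_cast
      have hP1 : (2 * Real.pi : ℂ) ^ k ≠ 0 := pow_ne_zero _ hπ
      generalize (2 * Real.pi : ℂ) ^ k = A at *
      generalize ((k - 1).factorial : ℂ) = G at *
      field_simp
      linear_combination (W * rankOneCoeff k T) * hsgn
  · split_ifs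
    · exact div_mul_cancel₀ _ hζ
    · simp

/-- With discriminant D·f², the factor f^(2k-3) in `lipCoeff` clears the denominators of the
singular series. What remains is an integer times (k-1)⁻¹ times the twisted Bernoulli sum of
`isPadicIntegral_sum_bernoulliFun`. -/
theorem isPadicIntegral_rankTwo (hk : Even k) (hk4 : 4 ≤ k) (hpk : 2 * k ≤ p) (T : ℤ × ℤ × ℤ) :
    IsPadicIntegral p (-I ^ k * (2 * ((k - 2).factorial : ℂ) / (2 * Real.pi) ^ (k - 1)) *
        (2 ^ (2 * k - 3) * lipCoeff k T) * (riemannZeta (2 * (k : ℂ) - 2) * singularSeries k T)) := by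
  by_cases h : 0 < T.1 ∧ discForm T < 0
  · have h4 : discForm T % 4 = 0 ∨ discForm T % 4 = 1 := by
      have e : discForm T = T.2.1 * T.2.1 - 4 * (T.1 * T.2.2) := by rw [discForm]; ring
      rcases Int.emod_two_eq_zero_or_one T.2.1 with h2 | h2
      · obtain ⟨c, hc⟩ : ∃ c, T.2.1 = 2 * c := ⟨T.2.1 / 2, by omega⟩
        left
        rw [e, hc, show 2 * c * (2 * c) = 4 * (c * c) by ring]
        omega
      · obtain ⟨c, hc⟩ : ∃ c, T.2.1 = 2 * c + 1 := ⟨T.2.1 / 2, by omega⟩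
        right
        rw [e, hc, show (2 * c + 1) * (2 * c + 1) = 4 * (c * c + c) + 1 by ring]
        omega
    obtain ⟨D, f, hD, hf, hDf⟩ := exists_eq_fundamental_mul_sq h.2.ne h4
    have hneg : D < 0 := by
      by_contra hD0
      have : 0 ≤ D * f ^ 2 := mul_nonneg (not_lt.1 hD0) (by positivity)
      have := h.2
      omega
    obtain ⟨ψ, hψ⟩ := exists_isOddQuadraticSymbol hD hneg
    have := hψ.neZero
    obtain ⟨n, hn⟩ := exists_int_singularSeries hk4 hD hψ.character (fun q _ => by
      rw [hψ.character_natCast, hψ.prime]) hf hDf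
    have hlo : Odd (k - 1) := by
      obtain ⟨r, hr⟩ := hk
      exact Nat.odd_iff.2 (by omega)
    obtain ⟨ε, hε⟩ := exists_sign_LSeries hψ.isPrimitive_character hψ.inv_character hψ.odd_character hlo (by omega)
    have hlip := lipCoeff_eq (k := k) (by omega) h.1 (N := D.natAbs) (f := f) (by
      rw [hDf, show (D.natAbs : ℤ) = -D by omega]; ring)
    have hI : ∃ s : ℤ, I ^ k = s := by
      obtain ⟨r, hr⟩ := hk
      exact ⟨(-1) ^ r, by rw [hr, ← two_mul, pow_mul, I_sq]; push_cast; rfl⟩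
    obtain ⟨s, hs⟩ := hI
    rw [Nat.cast_sub (by omega), Nat.cast_one, show k - 1 - 1 = k - 2 by omega] at hε
    have key : -I ^ k * (2 * ((k - 2).factorial : ℂ) / (2 * Real.pi) ^ (k - 1)) *
        (2 ^ (2 * k - 3) * lipCoeff k T) * (riemannZeta (2 * (k : ℂ) - 2) * singularSeries k T) =
        ((-s * n * ε : ℤ) : ℂ) * ((((k - 1 : ℕ) : ℂ))⁻¹ * ((D.natAbs : ℂ) ^ (k - 1 - 1) *
          ∑ j : ZMod D.natAbs, hψ.character j * bernoulliFun (k - 1) (j.val / D.natAbs : ℝ))) := by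
      have h2 : (2 ^ (2 * k - 3) * (lipCoeff k T : ℂ)) = (D.natAbs : ℂ) ^ (k - 2) * (Real.sqrt D.natAbs : ℂ) *
          (f : ℂ) ^ (2 * k - 3) := by
        rw [hlip]; push_cast; field_simp
      rw [h2, hs, Nat.cast_sub (by omega), Nat.cast_one, show k - 1 - 1 = k - 2 by omega]
      push_cast
      linear_combination (-(s : ℂ) * (2 * ((k - 2).factorial : ℂ) / (2 * Real.pi) ^ (k - 1)) *
        ((D.natAbs : ℂ) ^ (k - 2) * (Real.sqrt D.natAbs : ℂ))) * hn - (s : ℂ) * n * hε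
    rw [key]
    exact (IsPadicIntegral.intCast _).mul ((IsPadicIntegral.inv_natCast_of_lt (by omega) (by omega)).mul
      (isPadicIntegral_sum_bernoulliFun hD hψ (by omega) (by omega)))
  · rw [lipCoeff_eq_zero (by omega) h]
    simpa using IsPadicIntegral.intCast (p := p) 0

theorem isPadicIntegral_siegelCoeff (hk : Even k) (hk4 : 4 ≤ k) (hpk : 2 * k ≤ p) (T : ℤ × ℤ × ℤ) :
    IsPadicIntegral p (siegelCoeff k T) := by
  have hpk' : 2 * k < p := by
    refine lt_of_le_of_ne hpk fun h => ?_
    have := (Nat.prime_dvd_prime_iff_eq Nat.prime_two hp.out).1 ⟨k, h.symm⟩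
    omega
  have hζ : IsPadicIntegral p (riemannZeta (3 - 2 * (k : ℂ))) := by
    have := isPadicIntegral_riemannZeta_neg (p := p) (n := 2 * k - 3) (by omega)
    rwa [Nat.cast_sub (by omega), show -(((2 * k : ℕ) : ℂ) - (3 : ℕ)) = 3 - 2 * (k : ℂ) by push_cast; ring] at this
  have hζ' : IsPadicIntegral p (riemannZeta (1 - (k : ℂ))) := by
    have := isPadicIntegral_riemannZeta_neg (p := p) (n := k - 1) (by omega)
    rwa [Nat.cast_sub (by omega), show -((k : ℂ) - (1 : ℕ)) = 1 - (k : ℂ) by push_cast; ring] at this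
  rw [siegelCoeff_eq hk hk4]
  refine ((isPadicIntegral_rankTwo hk hk4 hpk T).add ?_).add ?_
  · obtain ⟨n, hn⟩ := exists_int_rankOneCoeff k T
    rw [hn]
    exact hζ.mul (IsPadicIntegral.intCast n)
  · split_ifs
    · have h2 := IsPadicIntegral.inv_natCast_of_lt (p := p) (n := 2) (by omega) (by omega)
      rw [one_div]
      exact (IsPadicIntegral.mul (by exact_mod_cast h2) hζ').mul hζ
    · simpa using IsPadicIntegral.intCast (p := p) 0

end Main

end SiegelTwo
end

theorem proposition3p1 (k : ℕ) (hk : Even k) (hk4 : 4 ≤ k) (p : ℕ) [Fact p.Prime]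
    (hp : 2 * (k : ℤ) - 2 < (p : ℤ) - 1) :
    (∀ Z ∈ SiegelTwo.upperHalfSpace, Summable (SiegelTwo.eisensteinTerm k hk Z)) ∧
    (∃ A : SiegelTwo.halfIntegral → ℂ,
      SiegelTwo.HasFourierExpansion (SiegelTwo.siegelG k hk) A) ∧
    (∀ A : SiegelTwo.halfIntegral → ℂ,
      SiegelTwo.HasFourierExpansion (SiegelTwo.siegelG k hk) A →
        ∀ T : SiegelTwo.halfIntegral, SiegelTwo.IsPadicIntegral p (A T)) := by
  refine ⟨fun Z hZ => SiegelTwo.summable_eisensteinTerm_of_mem hk hk4 hZ,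
    ⟨_, SiegelTwo.hasFourierExpansion_siegelG hk hk4⟩, fun A hA T => ?_⟩
  rw [SiegelTwo.fourierExpansion_unique hA (SiegelTwo.hasFourierExpansion_siegelG hk hk4)]
  exact SiegelTwo.isPadicIntegral_siegelCoeff hk hk4 (by omega) _
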